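/- Let $\mathcal V$ be a right closed braided monoidal bicategory, taken semi-strict: a Gray monoid (a strict 2-category with a strictly associative and unital tensor product that is 2-functorial in each variable, with invertible interchangers) with a semi-strict braiding $\beta$, and for every object $A$ a coherent pseudoadjunction $-\otimes A\dashv[A,-]$. Regard $\mathcal V$ as a $\mathcal V$-bicategory with hom-objects $[A,B]$, and let $\mathcal B$ be a $\mathcal V$-bicategory, with opposite $\mathcal B^{\mathsf{op}}$ (composition $m\circ\beta$). Write $f_*=[-,f]$ and $f^*=[f,-]$. **Bicoends.** Let $P\colon\mathcal B^{\mathsf{op}}\otimes\mathcal B\to\mathcal V$ be a $\mathcal V$-pseudofunctor. An extra-pseudonatural transformation $i\colon P\Rightarrow x$ consists of 1-cells $i_b\colon P(b,b)\to x$ and invertible 2-cells $(i_a)_*\circ P_{-a}\cong(i_b)_*\circ P_{b-}$ between 1-cells $\mathcal B(a,b)\to[P(b,a),x]$, compatible with the units of $\mathcal B$ (for each $b$, the 2-cell at $(b,b)$ precomposed with $u_b$ is the identity modulo the unit cells of $P_{-b}$ and $P_{b-}$) and with its composition (for each $a,b,c$, on $\mathcal B(a,b)\otimes\mathcal B(b,c)$,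 the 2-cell at $(a,c)$ is the pasting of those at $(a,b)$ and $(b,c)$ with the exchange cell of $P$, modulo the multiplication cells of $P_{-a}$ and $P_{c-}$). A morphism $i\to j$ is a family of 2-cells $i_b\Rightarrow j_b$ compatible with these 2-cells. This gives a category $\mathcal V\text{-}\mathsf{PsNat}^{\mathsf e}(P,x)$. A pair $(c,i)$ with $i\colon P\Rightarrow c$ is a bicoend of $P$ if * (BC1) for every $x$ and $j\colon P\Rightarrow x$ there are a 1-cell $k\colon c\to x$ and invertible 2-cells $k\circ i_b\cong j_b$ forming a morphism $k\circ i\to j$; * (BC2) for all $k,l\colon c\to x$ and every morphism $\Gamma\colon k\circ i\to l\circ i$ there is a unique 2-cell $\gamma\colon k\Rightarrow l$ with $\Gamma_b=\gamma* i_b$ for all $b$. Then composition makes $x\mapsto\mathcal V\text{-}\mathsf{PsNat}^{\mathsf e}(P,x)$ a pseudofunctor $\mathcal V\to\mathsf{Cat}$, and: 1. if $(c,i)$ is a bicoend of $P$, then precomposition with $i$, $k\mapsto k\circ i$, $\gamma\mapsto(\gamma*i_b)_b$, is an equivalence of categories $$\mathcal V(c,x)\simeq\mathcal V\text{-}\mathsf{PsNat}^{\mathsf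 e}(P,x)$$ for every $x$, pseudonaturally in $x$; 2. conversely, if $i\colon P\Rightarrow c$ is such that precomposition with $i$ is an equivalence for every $x$, then $(c,i)$ is a bicoend of $P$; and if $\Phi\colon\mathcal V(c,-)\Rightarrow\mathcal V\text{-}\mathsf{PsNat}^{\mathsf e}(P,-)$ is any pseudonatural transformation all of whose components are equivalences, then $(c,\Phi_c(1_c))$ is a bicoend of $P$. **Biends.** Let $P$ be a $\mathcal V$-pseudofunctor to $\mathcal V$ of one covariant and one contravariant variable in $\mathcal B$: either (a) $P\colon\mathcal B\otimes\mathcal B^{\mathsf{op}}\to\mathcal V$, or (b) $P\colon\mathcal B^{\mathsf{op}}\otimes\mathcal B\to\mathcal V$, where in case (b) the braiding is equipped with a syllepsis $\beta_{B,A}\circ\beta_{A,B}\cong 1$ (in particular if $\mathcal V$ is symmetric). Dually, an extra-pseudonatural transformation $i\colon x\Rightarrow P$ has 1-cells $i_b$ from $x$ to the diagonal values of $P$ and invertible 2-cells that relate, after $(i_b)^*$ and $(i_a)^*$, the contravariant and the covariant action of $\mathcal B(a,b)$, with the dual unit and functoriality axioms; these form categories $\mathcal V\text{-}\mathsf{PsNat}^{\mathsf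 e}(x,P)$, and biends $(e,i)$, $i\colon e\Rightarrow P$, are defined by the duals of (BC1) and (BC2). Then $x\mapsto\mathcal V\text{-}\mathsf{PsNat}^{\mathsf e}(x,P)$ is a pseudofunctor $\mathcal V^{\mathsf{op}}\to\mathsf{Cat}$, and: 3. if $(e,i)$ is a biend of $P$, then $k\mapsto i\circ k$, $\gamma\mapsto(i_b*\gamma)_b$, is an equivalence of categories $$\mathcal V(x,e)\simeq\mathcal V\text{-}\mathsf{PsNat}^{\mathsf e}(x,P)$$ for every $x$, pseudonaturally in $x$; 4. conversely, if $i\colon e\Rightarrow P$ is such that composition with $i$ is an equivalence for every $x$, then $(e,i)$ is a biend of $P$; and if $\Phi\colon\mathcal V(-,e)\Rightarrow\mathcal V\text{-}\mathsf{PsNat}^{\mathsf e}(-,P)$ is any pseudonatural transformation all of whose components are equivalences, then $(e,\Phi_e(1_e))$ is a biend of $P$. -/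

import Mathlib

open CategoryTheory Bicategory Opposite

universe w v u u₁ u₂ u₃

noncomputable section

/-- A Gray monoid (semi-strict monoidal bicategory): a strict 2-category `V` with a tensor
product on objects which is strictly associative and unital and which extends to strict 2-functors
`A ⊗ -` (`lmap`) and `- ⊗ B` (`rmap`), with invertible interchangers
`inter f g : (A ⊗ g) ≫ (f ⊗ B') ≅ (f ⊗ B) ≫ (A' ⊗ g)`. -/
class GrayMonoid (V : Type u) [Bicategory.{w, v} V] [Bicategory.Strict V] where
  tensor : V → V → V
  unit : V
  tensor_assoc (A B C : V) : tensor (tensor A B) C = tensor A (tensor B C)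
  unit_tensor (A : V) : tensor unit A = A
  tensor_unit (A : V) : tensor A unit = A
  lmap (A : V) {X Y : V} (f : X ⟶ Y) : tensor A X ⟶ tensor A Y
  lmap₂ (A : V) {X Y : V} {f g : X ⟶ Y} (θ : f ⟶ g) : lmap A f ⟶ lmap A g
  rmap {X Y : V} (f : X ⟶ Y) (B : V) : tensor X B ⟶ tensor Y B
  rmap₂ {X Y : V} {f g : X ⟶ Y} (θ : f ⟶ g) (B : V) : rmap f B ⟶ rmap g B
  -- strict 2-functoriality of `A ⊗ -`
  lmap_id (A X : V) : lmap A (𝟙 X) = 𝟙 (tensor A X)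
  lmap_comp (A : V) {X Y Z : V} (f : X ⟶ Y) (g : Y ⟶ Z) : lmap A (f ≫ g) = lmap A f ≫ lmap A g
  lmap₂_id (A : V) {X Y : V} (f : X ⟶ Y) : lmap₂ A (𝟙 f) = 𝟙 (lmap A f)
  lmap₂_comp (A : V) {X Y : V} {f g h : X ⟶ Y} (θ : f ⟶ g) (κ : g ⟶ h) :
    lmap₂ A (θ ≫ κ) = lmap₂ A θ ≫ lmap₂ A κ
  lmap₂_whiskerLeft (A : V) {X Y Z : V} (f : X ⟶ Y) {g h : Y ⟶ Z} (θ : g ⟶ h) :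
    lmap₂ A (f ◁ θ) =
      eqToHom (lmap_comp A f g) ≫ lmap A f ◁ lmap₂ A θ ≫ eqToHom (lmap_comp A f h).symm
  lmap₂_whiskerRight (A : V) {X Y Z : V} {f g : X ⟶ Y} (θ : f ⟶ g) (h : Y ⟶ Z) :
    lmap₂ A (θ ▷ h) =
      eqToHom (lmap_comp A f h) ≫ lmap₂ A θ ▷ lmap A h ≫ eqToHom (lmap_comp A g h).symm
  -- strict 2-functoriality of `- ⊗ B`
  rmap_id (X B : V) : rmap (𝟙 X) B = 𝟙 (tensor X B)
  rmap_comp {X Y Z : V} (f : X ⟶ Y) (g : Y ⟶ Z) (B : V) : rmap (f ≫ g) B = rmap f B ≫ rmap g B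
  rmap₂_id {X Y : V} (f : X ⟶ Y) (B : V) : rmap₂ (𝟙 f) B = 𝟙 (rmap f B)
  rmap₂_comp {X Y : V} {f g h : X ⟶ Y} (θ : f ⟶ g) (κ : g ⟶ h) (B : V) :
    rmap₂ (θ ≫ κ) B = rmap₂ θ B ≫ rmap₂ κ B
  rmap₂_whiskerLeft {X Y Z : V} (f : X ⟶ Y) {g h : Y ⟶ Z} (θ : g ⟶ h) (B : V) :
    rmap₂ (f ◁ θ) B =
      eqToHom (rmap_comp f g B) ≫ rmap f B ◁ rmap₂ θ B ≫ eqToHom (rmap_comp f h B).symm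
  rmap₂_whiskerRight {X Y Z : V} {f g : X ⟶ Y} (θ : f ⟶ g) (h : Y ⟶ Z) (B : V) :
    rmap₂ (θ ▷ h) B =
      eqToHom (rmap_comp f h B) ≫ rmap₂ θ B ▷ rmap h B ≫ eqToHom (rmap_comp g h B).symm
  -- strict associativity and unitality of the tensor product on 1-cells and 2-cells
  lmap_lmap (A B : V) {X Y : V} (f : X ⟶ Y) : HEq (lmap (tensor A B) f) (lmap A (lmap B f))
  lmap₂_lmap₂ (A B : V) {X Y : V} {f g : X ⟶ Y} (θ : f ⟶ g) :
    HEq (lmap₂ (tensor A B) θ) (lmap₂ A (lmap₂ B θ))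
  rmap_rmap {X Y : V} (f : X ⟶ Y) (A B : V) : HEq (rmap f (tensor A B)) (rmap (rmap f A) B)
  rmap₂_rmap₂ {X Y : V} {f g : X ⟶ Y} (θ : f ⟶ g) (A B : V) :
    HEq (rmap₂ θ (tensor A B)) (rmap₂ (rmap₂ θ A) B)
  rmap_lmap (A : V) {X Y : V} (f : X ⟶ Y) (B : V) : HEq (rmap (lmap A f) B) (lmap A (rmap f B))
  rmap₂_lmap₂ (A : V) {X Y : V} {f g : X ⟶ Y} (θ : f ⟶ g) (B : V) :
    HEq (rmap₂ (lmap₂ A θ) B) (lmap₂ A (rmap₂ θ B))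
  lmap_unit {X Y : V} (f : X ⟶ Y) : HEq (lmap unit f) f
  lmap₂_unit {X Y : V} {f g : X ⟶ Y} (θ : f ⟶ g) : HEq (lmap₂ unit θ) θ
  rmap_unit {X Y : V} (f : X ⟶ Y) : HEq (rmap f unit) f
  rmap₂_unit {X Y : V} {f g : X ⟶ Y} (θ : f ⟶ g) : HEq (rmap₂ θ unit) θ
  -- the interchangers and their axioms
  inter {A A' B B' : V} (f : A ⟶ A') (g : B ⟶ B') :
    lmap A g ≫ rmap f B' ≅ rmap f B ≫ lmap A' g
  inter_naturality_left {A A' B B' : V} {f f' : A ⟶ A'} (θ : f ⟶ f') (g : B ⟶ B') :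
    lmap A g ◁ rmap₂ θ B' ≫ (inter f' g).hom = (inter f g).hom ≫ rmap₂ θ B ▷ lmap A' g
  inter_naturality_right {A A' B B' : V} (f : A ⟶ A') {g g' : B ⟶ B'} (θ : g ⟶ g') :
    lmap₂ A θ ▷ rmap f B' ≫ (inter f g').hom = (inter f g).hom ≫ rmap f B ◁ lmap₂ A' θ
  inter_id_left (A : V) {B B' : V} (g : B ⟶ B') :
    inter (𝟙 A) g = eqToIso (by simp only [rmap_id, Category.id_comp, Category.comp_id])
  inter_id_right {A A' : V} (f : A ⟶ A') (B : V) :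
    inter f (𝟙 B) = eqToIso (by simp only [lmap_id, Category.id_comp, Category.comp_id])
  inter_comp_left {A A' A'' B B' : V} (f : A ⟶ A') (f' : A' ⟶ A'') (g : B ⟶ B') :
    (inter (f ≫ f') g).hom =
      eqToHom (by simp only [rmap_comp, Category.assoc]) ≫
      (inter f g).hom ▷ rmap f' B' ≫ eqToHom (by simp only [Category.assoc]) ≫
      rmap f B ◁ (inter f' g).hom ≫ eqToHom (by simp only [rmap_comp, Category.assoc])
  inter_comp_right {A A' B B' B'' : V} (f : A ⟶ A') (g : B ⟶ B') (g' : B' ⟶ B'') :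
    (inter f (g ≫ g')).hom =
      eqToHom (by simp only [lmap_comp, Category.assoc]) ≫
      lmap A g ◁ (inter f g').hom ≫ eqToHom (by simp only [Category.assoc]) ≫
      (inter f g).hom ▷ lmap A' g' ≫ eqToHom (by simp only [lmap_comp, Category.assoc])
  inter_lmap (X : V) {A A' B B' : V} (f : A ⟶ A') (g : B ⟶ B') :
    HEq (inter (lmap X f) g).hom (lmap₂ X (inter f g).hom)
  inter_rmap_lmap {A A' B B' : V} (f : A ⟶ A') (X : V) (g : B ⟶ B') :
    HEq (inter (rmap f X) g).hom (inter f (lmap X g)).hom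
  inter_rmap {A A' B B' : V} (f : A ⟶ A') (g : B ⟶ B') (X : V) :
    HEq (inter f (rmap g X)).hom (rmap₂ (inter f g).hom X)

infixr:70 "⊠" => GrayMonoid.tensor
notation "𝕀" => GrayMonoid.unit
/-- `A ⊠ₗ f` is the 1-cell `A ⊗ f`, and `f ⊠ᵣ B` is the 1-cell `f ⊗ B`. -/
infixr:85 "⊠ₗ" => GrayMonoid.lmap
infixl:84 "⊠ᵣ" => GrayMonoid.rmap
infixr:85 "⊠ₗ₂" => GrayMonoid.lmap₂
infixl:84 "⊠ᵣ₂" => GrayMonoid.rmap₂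

namespace GrayMonoid

attribute [simp] lmap_id lmap_comp rmap_id rmap_comp lmap₂_id lmap₂_comp rmap₂_id rmap₂_comp

theorem eq_of_heq_hom {V : Type u} [Bicategory.{w, v} V] [Bicategory.Strict V] {X Y X' Y' : V} {f : X ⟶ Y} {g : X' ⟶ Y'} (hX : X = X') (hY : Y = Y')
    (h : HEq f g) : f = eqToHom hX ≫ g ≫ eqToHom hY.symm := by
  subst hX hY
  simpa using eq_of_heq h

theorem family_eq {V : Type u} [Bicategory.{w, v} V] [Bicategory.Strict V] {F G : V → V}
    (φ : ∀ X, F X ⟶ G X) {X X' : V} (h : X = X') :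
    eqToHom (congrArg F h) ≫ φ X' ≫ eqToHom (congrArg G h).symm = φ X := by subst h; simp

variable {V : Type u} [Bicategory.{w, v} V] [Bicategory.Strict V] [GrayMonoid V]

@[simp] theorem lmap_eqToHom (A : V) {X Y : V} (h : X = Y) :
    A ⊠ₗ (eqToHom h) = eqToHom (congrArg (A ⊠ ·) h) := by subst h; simp

@[simp] theorem rmap_eqToHom {X Y : V} (h : X = Y) (B : V) :
    (eqToHom h) ⊠ᵣ B = eqToHom (congrArg (· ⊠ B) h) := by subst h; simp

@[simp] theorem lmap₂_eqToHom (A : V) {X Y : V} {f g : X ⟶ Y} (h : f = g) :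
    A ⊠ₗ₂ (eqToHom h) = eqToHom (congrArg (A ⊠ₗ ·) h) := by subst h; simp

@[simp] theorem rmap₂_eqToHom {X Y : V} {f g : X ⟶ Y} (h : f = g) (B : V) :
    (eqToHom h) ⊠ᵣ₂ B = eqToHom (congrArg (· ⊠ᵣ B) h) := by subst h; simp

@[simp] theorem lmap_tensor (A B : V) {X Y : V} (f : X ⟶ Y) :
    (A ⊠ B) ⊠ₗ f = eqToHom (tensor_assoc A B X) ≫ A ⊠ₗ B ⊠ₗ f ≫ eqToHom (tensor_assoc A B Y).symm :=
  eq_of_heq_hom (tensor_assoc A B X) (tensor_assoc A B Y) (lmap_lmap A B f)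

@[simp] theorem rmap_tensor (A B : V) {X Y : V} (f : X ⟶ Y) :
    f ⊠ᵣ (A ⊠ B) = eqToHom (tensor_assoc X A B).symm ≫ f ⊠ᵣ A ⊠ᵣ B ≫ eqToHom (tensor_assoc Y A B) :=
  eq_of_heq_hom (tensor_assoc X A B).symm (tensor_assoc Y A B).symm (rmap_rmap f A B)

@[simp] theorem rmap_lmap_eq (A B : V) {X Y : V} (f : X ⟶ Y) :
    (A ⊠ₗ f) ⊠ᵣ B = eqToHom (tensor_assoc A X B) ≫ A ⊠ₗ (f ⊠ᵣ B) ≫ eqToHom (tensor_assoc A Y B).symm :=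
  eq_of_heq_hom (tensor_assoc A X B) (tensor_assoc A Y B) (rmap_lmap A f B)

@[simp] theorem lmap_unit_eq {X Y : V} (f : X ⟶ Y) :
    (𝕀 : V) ⊠ₗ f = eqToHom (unit_tensor X) ≫ f ≫ eqToHom (unit_tensor Y).symm :=
  eq_of_heq_hom (unit_tensor X) (unit_tensor Y) (lmap_unit f)

@[simp] theorem rmap_unit_eq {X Y : V} (f : X ⟶ Y) :
    f ⊠ᵣ (𝕀 : V) = eqToHom (tensor_unit X) ≫ f ≫ eqToHom (tensor_unit Y).symm :=
  eq_of_heq_hom (tensor_unit X) (tensor_unit Y) (rmap_unit f)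

end GrayMonoid

open GrayMonoid

section Combinators

variable {V : Type u} [Bicategory.{w, v} V] [Bicategory.Strict V] [GrayMonoid V]

/-- Composition of 1-cells up to a (strict associativity or unit) identification of objects. -/
def ccomp {X Y Y' Z : V} (f : X ⟶ Y) (g : Y' ⟶ Z)
    (h : Y = Y' := by simp only [tensor_assoc, unit_tensor, tensor_unit]) : X ⟶ Z :=
  f ≫ eqToHom h ≫ g

infixr:80 "≫ₑ" => ccomp

/-- A 2-isomorphism between (propositionally) the same 1-cells. -/
def icast {X Y : V} {f f' g g' : X ⟶ Y} (η : f' ≅ g')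
    (h : f = f' := by simp [ccomp]) (h' : g' = g := by simp [ccomp]) : f ≅ g :=
  eqToIso h ≪≫ η ≪≫ eqToIso h'

/-- Vertical composition of 2-isomorphisms with (propositionally) matching boundary. -/
def vcat {X Y : V} {f g g' k : X ⟶ Y} (η : f ≅ g) (θ : g' ≅ k)
    (h : g = g' := by simp [ccomp]) : f ≅ k :=
  η ≪≫ eqToIso h ≪≫ θ

infixl:60 "⊚" => vcat

/-- Whiskering of a 2-isomorphism (on both sides, on the left, on the right, on neither side), up to
identifications of objects. -/
def cw {X₀ X Y Y' Z Z' W W₀ : V} (h : X ⟶ Y) {f g : Y' ⟶ Z} (η : f ≅ g) (k : Z' ⟶ W)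
    (e₀ : X₀ = X := by simp only [tensor_assoc, unit_tensor, tensor_unit])
    (e : Y = Y' := by simp only [tensor_assoc, unit_tensor, tensor_unit])
    (e' : Z = Z' := by simp only [tensor_assoc, unit_tensor, tensor_unit])
    (e₁ : W = W₀ := by simp only [tensor_assoc, unit_tensor, tensor_unit]) :
    ((eqToHom e₀ ≫ h ≫ eqToHom e) ≫ f ≫ (eqToHom e' ≫ k ≫ eqToHom e₁) : X₀ ⟶ W₀) ≅
      (eqToHom e₀ ≫ h ≫ eqToHom e) ≫ g ≫ (eqToHom e' ≫ k ≫ eqToHom e₁) :=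
  whiskerLeftIso _ (whiskerRightIso η _)

def cwl {X₀ X Y Y' Z W₀ : V} (h : X ⟶ Y) {f g : Y' ⟶ Z} (η : f ≅ g)
    (e₀ : X₀ = X := by simp only [tensor_assoc, unit_tensor, tensor_unit])
    (e : Y = Y' := by simp only [tensor_assoc, unit_tensor, tensor_unit])
    (e₁ : Z = W₀ := by simp only [tensor_assoc, unit_tensor, tensor_unit]) :
    ((eqToHom e₀ ≫ h ≫ eqToHom e) ≫ f ≫ eqToHom e₁ : X₀ ⟶ W₀) ≅
      (eqToHom e₀ ≫ h ≫ eqToHom e) ≫ g ≫ eqToHom e₁ :=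
  whiskerLeftIso _ (whiskerRightIso η _)

def cwr {X₀ Y' Z Z' W W₀ : V} {f g : Y' ⟶ Z} (η : f ≅ g) (k : Z' ⟶ W)
    (e₀ : X₀ = Y' := by simp only [tensor_assoc, unit_tensor, tensor_unit])
    (e' : Z = Z' := by simp only [tensor_assoc, unit_tensor, tensor_unit])
    (e₁ : W = W₀ := by simp only [tensor_assoc, unit_tensor, tensor_unit]) :
    (eqToHom e₀ ≫ f ≫ (eqToHom e' ≫ k ≫ eqToHom e₁) : X₀ ⟶ W₀) ≅
      eqToHom e₀ ≫ g ≫ (eqToHom e' ≫ k ≫ eqToHom e₁) :=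
  whiskerLeftIso _ (whiskerRightIso η _)

def cw₀ {X₀ Y' Z W₀ : V} {f g : Y' ⟶ Z} (η : f ≅ g)
    (e₀ : X₀ = Y' := by simp only [tensor_assoc, unit_tensor, tensor_unit])
    (e₁ : Z = W₀ := by simp only [tensor_assoc, unit_tensor, tensor_unit]) :
    (eqToHom e₀ ≫ f ≫ eqToHom e₁ : X₀ ⟶ W₀) ≅ eqToHom e₀ ≫ g ≫ eqToHom e₁ :=
  whiskerLeftIso _ (whiskerRightIso η _)

/-- `A ⊗ η` and `η ⊗ B` for 2-isomorphisms. -/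
@[simps] def lI (A : V) {X Y : V} {f g : X ⟶ Y} (η : f ≅ g) : A ⊠ₗ f ≅ A ⊠ₗ g where
  hom := A ⊠ₗ₂ η.hom
  inv := A ⊠ₗ₂ η.inv
  hom_inv_id := by simp [← lmap₂_comp]
  inv_hom_id := by simp [← lmap₂_comp]

@[simps] def rI {X Y : V} {f g : X ⟶ Y} (η : f ≅ g) (B : V) : f ⊠ᵣ B ≅ g ⊠ᵣ B where
  hom := η.hom ⊠ᵣ₂ B
  inv := η.inv ⊠ᵣ₂ B
  hom_inv_id := by simp [← rmap₂_comp]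
  inv_hom_id := by simp [← rmap₂_comp]

end Combinators

/-- A semi-strict braiding on a Gray monoid: pseudonatural equivalences `β A B : A ⊗ B ⟶ B ⊗ A`
(`brL`, `brR` are the pseudonaturality 2-cells in the two variables) and invertible modifications
`brRR A B C : β_{A,BC} ≅ (β_{A,B} ⊗ C) ≫ (B ⊗ β_{A,C})` and
`brSS A B C : β_{AB,C} ≅ (A ⊗ β_{B,C}) ≫ (β_{A,C} ⊗ B)`, subject to the four braiding axioms and
strict unitality. -/
class Braiding (V : Type u) [Bicategory.{w, v} V] [Bicategory.Strict V] [GrayMonoid V] where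
  β (A B : V) : A ⊠ B ⟶ B ⊠ A
  β_equivalence (A B : V) : ∃ g : B ⊠ A ⟶ A ⊠ B,
    Nonempty (β A B ≫ g ≅ 𝟙 (A ⊠ B)) ∧ Nonempty (g ≫ β A B ≅ 𝟙 (B ⊠ A))
  brL {A A' : V} (f : A ⟶ A') (B : V) : f ⊠ᵣ B ≫ β A' B ≅ β A B ≫ B ⊠ₗ f
  brR (A : V) {B B' : V} (g : B ⟶ B') : A ⊠ₗ g ≫ β A B' ≅ β A B ≫ g ⊠ᵣ A
  -- pseudonaturality of the braiding on `V ⊗ V`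
  brL_naturality {A A' : V} {f f' : A ⟶ A'} (θ : f ⟶ f') (B : V) :
    (θ ⊠ᵣ₂ B) ▷ β A' B ≫ (brL f' B).hom = (brL f B).hom ≫ β A B ◁ (B ⊠ₗ₂ θ)
  brR_naturality (A : V) {B B' : V} {g g' : B ⟶ B'} (θ : g ⟶ g') :
    (A ⊠ₗ₂ θ) ▷ β A B' ≫ (brR A g').hom = (brR A g).hom ≫ β A B ◁ (θ ⊠ᵣ₂ A)
  brL_id (A B : V) : brL (𝟙 A) B = icast (Iso.refl (β A B))
  brR_id (A B : V) : brR A (𝟙 B) = icast (Iso.refl (β A B))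
  brL_comp {A A' A'' : V} (f : A ⟶ A') (f' : A' ⟶ A'') (B : V) :
    brL (f ≫ f') B = icast (cwl (f ⊠ᵣ B) (brL f' B) ⊚ cwr (brL f B) (B ⊠ₗ f'))
  brR_comp (A : V) {B B' B'' : V} (g : B ⟶ B') (g' : B' ⟶ B'') :
    brR A (g ≫ g') = icast (cwl (A ⊠ₗ g) (brR A g') ⊚ cwr (brR A g) (g' ⊠ᵣ A))
  br_inter {A A' B B' : V} (f : A ⟶ A') (g : B ⟶ B') :
    Iso.refl (A ⊠ₗ g ≫ f ⊠ᵣ B' ≫ β A' B') ⊚ cwl (A ⊠ₗ g) (brL f B') ⊚ cwr (brR A g) (B' ⊠ₗ f) =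
    icast (cwr (inter f g) (β A' B') ⊚ cwl (f ⊠ᵣ B) (brR A' g) ⊚
      cwr (brL f B) (g ⊠ᵣ A') ⊚ cwl (β A B) (inter g f))
  -- the two hexagon modifications
  brRR (A B C : V) : β A (B ⊠ C) ≅ 𝟙 (A ⊠ B ⊠ C) ≫ₑ β A B ⊠ᵣ C ≫ₑ B ⊠ₗ β A C ≫ₑ 𝟙 ((B ⊠ C) ⊠ A)
  brSS (A B C : V) : β (A ⊠ B) C ≅ 𝟙 ((A ⊠ B) ⊠ C) ≫ₑ A ⊠ₗ β B C ≫ₑ β A C ⊠ᵣ B ≫ₑ 𝟙 (C ⊠ A ⊠ B)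
  brRR_naturality₁ {A A' : V} (f : A ⟶ A') (B C : V) :
    brL f (B ⊠ C) ⊚ cwr (brRR A B C) ((B ⊠ C) ⊠ₗ f) =
    icast (cwl (f ⊠ᵣ (B ⊠ C)) (brRR A' B C) ⊚ cwr (rI (brL f B) C) (B ⊠ₗ β A' C) ⊚
      cwl (β A B ⊠ᵣ C) (lI B (brL f C)))
  brRR_naturality₂ (A : V) {B B' : V} (g : B ⟶ B') (C : V) :
    brR A (g ⊠ᵣ C) ⊚ cwr (brRR A B C) ((g ⊠ᵣ C) ⊠ᵣ A) =
    icast (cwl (A ⊠ₗ (g ⊠ᵣ C)) (brRR A B' C) ⊚ cwr (rI (brR A g) C) (B' ⊠ₗ β A C) ⊚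
      cwl (β A B ⊠ᵣ C) (inter g (β A C)).symm)
  brRR_naturality₃ (A B : V) {C C' : V} (h : C ⟶ C') :
    brR A (B ⊠ₗ h) ⊚ cwr (brRR A B C) ((B ⊠ₗ h) ⊠ᵣ A) =
    icast (cwl (A ⊠ₗ B ⊠ₗ h) (brRR A B C') ⊚ cwr (inter (β A B) h) (B ⊠ₗ β A C') ⊚
      cwl (β A B ⊠ᵣ C) (lI B (brR A h)))
  brSS_naturality₁ {A A' : V} (f : A ⟶ A') (B C : V) :
    brL (f ⊠ᵣ B) C ⊚ cwr (brSS A B C) (C ⊠ₗ (f ⊠ᵣ B)) =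
    icast (cwl ((f ⊠ᵣ B) ⊠ᵣ C) (brSS A' B C) ⊚ cwr (inter f (β B C)).symm (β A' C ⊠ᵣ B) ⊚
      cwl (A ⊠ₗ β B C) (rI (brL f C) B))
  brSS_naturality₂ (A : V) {B B' : V} (g : B ⟶ B') (C : V) :
    brL (A ⊠ₗ g) C ⊚ cwr (brSS A B C) (C ⊠ₗ A ⊠ₗ g) =
    icast (cwl ((A ⊠ₗ g) ⊠ᵣ C) (brSS A B' C) ⊚ cwr (lI A (brL g C)) (β A C ⊠ᵣ B') ⊚
      cwl (A ⊠ₗ β B C) (inter (β A C) g))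
  brSS_naturality₃ (A B : V) {C C' : V} (h : C ⟶ C') :
    brR (A ⊠ B) h ⊚ cwr (brSS A B C) (h ⊠ᵣ (A ⊠ B)) =
    icast (cwl ((A ⊠ B) ⊠ₗ h) (brSS A B C') ⊚ cwr (lI A (brR B h)) (β A C' ⊠ᵣ B) ⊚
      cwl (A ⊠ₗ β B C) (rI (brR A h) B))
  -- the four braiding axioms
  brRR_brRR (A B C D : V) :
    brRR A B (C ⊠ D) ⊚ cwl (β A B ⊠ᵣ (C ⊠ D)) (lI B (brRR A C D)) =
    icast (cw₀ (brRR A (B ⊠ C) D) ⊚ cwr (rI (brRR A B C) D) ((B ⊠ C) ⊠ₗ β A D))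
      (family_eq (β A) (tensor_assoc B C D).symm).symm
  brSS_brSS (A B C D : V) :
    brSS (A ⊠ B) C D ⊚ cwl ((A ⊠ B) ⊠ₗ β C D) (rI (brSS A B D) C) =
    icast (cw₀ (brSS A (B ⊠ C) D) ⊚ cwr (lI A (brSS B C D)) (β A D ⊠ᵣ (B ⊠ C)))
      (family_eq (β · D) (tensor_assoc A B C)).symm
  brSS_brRR (A B C D : V) :
    Iso.refl (𝟙 ((A ⊠ B) ⊠ C ⊠ D) ≫ₑ β (A ⊠ B) C ⊠ᵣ D ≫ₑ C ⊠ₗ β (A ⊠ B) D ≫ₑ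
        𝟙 ((C ⊠ D) ⊠ A ⊠ B)) ⊚
      cwr (rI (brSS A B C) D) (C ⊠ₗ β (A ⊠ B) D) ⊚
      cwl (A ⊠ₗ β B C ⊠ᵣ D ≫ₑ β A C ⊠ᵣ (B ⊠ D)) (lI C (brSS A B D)) ⊚
      cw (A ⊠ₗ β B C ⊠ᵣ D) (inter (β A C) (β B D)).symm (C ⊠ₗ β A D ⊠ᵣ B) ⊚
      cwr (lI A (brRR B C D)).symm (β A C ⊠ᵣ D ⊠ᵣ B ≫ₑ C ⊠ₗ β A D ⊠ᵣ B) ⊚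
      cwl (A ⊠ₗ β B (C ⊠ D)) (rI (brRR A C D) B).symm =
    icast (cw₀ (brRR (A ⊠ B) C D).symm ⊚ brSS A B (C ⊠ D))
  yang_baxter (A B C : V) :
    Iso.refl (𝟙 (A ⊠ B ⊠ C) ≫ₑ β A B ⊠ᵣ C ≫ₑ B ⊠ₗ β A C ≫ₑ β B C ⊠ᵣ A ≫ₑ 𝟙 (C ⊠ B ⊠ A)) ⊚
      cwr (brRR A B C).symm (β B C ⊠ᵣ A) ⊚ cw₀ (brR A (β B C)).symm ⊚
      cwl (A ⊠ₗ β B C) (brRR A C B) =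
    icast (cwl (β A B ⊠ᵣ C) (brSS B A C).symm ⊚ cw₀ (brL (β A B) C) ⊚
      cwr (brSS A B C) (C ⊠ₗ β A B))
  -- strict unitality
  β_unit_right (A : V) : HEq (β A 𝕀) (𝟙 A)
  β_unit_left (A : V) : HEq (β 𝕀 A) (𝟙 A)
  brRR_unit₁ (A B : V) : HEq (brRR 𝕀 A B).hom (𝟙 (β 𝕀 (A ⊠ B)))
  brRR_unit₂ (A B : V) : HEq (brRR A 𝕀 B).hom (𝟙 (β A B))
  brRR_unit₃ (A B : V) : HEq (brRR A B 𝕀).hom (𝟙 (β A B))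
  brSS_unit₁ (A B : V) : HEq (brSS 𝕀 A B).hom (𝟙 (β A B))
  brSS_unit₂ (A B : V) : HEq (brSS A 𝕀 B).hom (𝟙 (β A B))
  brSS_unit₃ (A B : V) : HEq (brSS A B 𝕀).hom (𝟙 (β (A ⊠ B) 𝕀))

open Braiding

section

variable {V : Type u} [Bicategory.{w, v} V] [Bicategory.Strict V] [GrayMonoid V] [Braiding V]

@[simp] theorem β_unit_right_eq (A : V) :
    β A 𝕀 = eqToHom ((tensor_unit A).trans (unit_tensor A).symm) := by
  simpa using eq_of_heq_hom (tensor_unit A) (unit_tensor A) (β_unit_right A)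

@[simp] theorem β_unit_left_eq (A : V) :
    β 𝕀 A = eqToHom ((unit_tensor A).trans (tensor_unit A).symm) := by
  simpa using eq_of_heq_hom (unit_tensor A) (tensor_unit A) (β_unit_left A)

end

section Closed

/-- The strict 2-functor `- ⊗ A` as a pseudofunctor. -/
def tensorRight (V : Type u) [Bicategory.{w, v} V] [Bicategory.Strict V] [GrayMonoid V] (A : V) :
    V ⥤ᵖ V where
  obj X := X ⊠ A
  map f := f ⊠ᵣ A
  map₂ θ := θ ⊠ᵣ₂ A
  mapId X := eqToIso (rmap_id X A)
  mapComp f g := eqToIso (rmap_comp f g A)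
  map₂_whisker_left f g h θ := by simp [rmap₂_whiskerLeft]
  map₂_whisker_right θ h := by simp [rmap₂_whiskerRight]
  map₂_associator f g h := by simp [Bicategory.Strict.associator_eqToIso]
  map₂_left_unitor f := by simp [Bicategory.Strict.leftUnitor_eqToIso]
  map₂_right_unitor f := by simp [Bicategory.Strict.rightUnitor_eqToIso]

/-- The data of a right closed structure: for every object `A` a pseudofunctor `[A, -]`,
pseudonatural transformations `id ⇒ [A, - ⊗ A]` and `[A, -] ⊗ A ⇒ id`, and invertible 2-cells
filling the triangles. -/
class RightClosedData (V : Type u) [Bicategory.{w, v} V] [Bicategory.Strict V] [GrayMonoid V] where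
  ihom (A : V) : V ⥤ᵖ V
  coevT (A : V) : Pseudofunctor.StrongTrans (Pseudofunctor.id V) ((tensorRight V A).comp (ihom A))
  evT (A : V) : Pseudofunctor.StrongTrans ((ihom A).comp (tensorRight V A)) (Pseudofunctor.id V)
  triS (A B : V) :
    𝟙 (B ⊠ A) ≅ ((coevT A).app B : B ⟶ (ihom A).obj (B ⊠ A)) ⊠ᵣ A ≫ (evT A).app (B ⊠ A)
  triT (A B : V) :
    (coevT A).app ((ihom A).obj B) ≫ (ihom A).map ((evT A).app B) ≅ 𝟙 ((ihom A).obj B)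

section

variable {V : Type u} [Bicategory.{w, v} V] [Bicategory.Strict V] [GrayMonoid V] [RightClosedData V]

/-- The internal hom `[A, B]`, its action `[A, f]` on 1-cells and `[A, θ]` on 2-cells. -/
def iho (A B : V) : V := (RightClosedData.ihom A).obj B
def ihm (A : V) {B B' : V} (f : B ⟶ B') : iho A B ⟶ iho A B' := (RightClosedData.ihom A).map f
def ihm₂ (A : V) {B B' : V} {f g : B ⟶ B'} (θ : f ⟶ g) : ihm A f ⟶ ihm A g :=
  (RightClosedData.ihom A).map₂ θ
@[simp] theorem ihm₂_id (A : V) {B B' : V} (f : B ⟶ B') : ihm₂ A (𝟙 f) = 𝟙 (ihm A f) :=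
  (RightClosedData.ihom A).map₂_id f
@[simp] theorem ihm₂_comp (A : V) {B B' : V} {f g h : B ⟶ B'} (θ : f ⟶ g) (κ : g ⟶ h) :
    ihm₂ A (θ ≫ κ) = ihm₂ A θ ≫ ihm₂ A κ := (RightClosedData.ihom A).map₂_comp θ κ
def ihI (A : V) {B B' : V} {f g : B ⟶ B'} (θ : f ≅ g) : ihm A f ≅ ihm A g :=
  (RightClosedData.ihom A).map₂Iso θ
def ihId (A B : V) : ihm A (𝟙 B) ≅ 𝟙 (iho A B) := (RightClosedData.ihom A).mapId B
def ihComp (A : V) {B B' B'' : V} (f : B ⟶ B') (g : B' ⟶ B'') :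
    ihm A (f ≫ g) ≅ ihm A f ≫ ihm A g := (RightClosedData.ihom A).mapComp f g

/-- The unit (coevaluation) and counit (evaluation), with their pseudonaturality 2-cells. -/
def coev (A B : V) : B ⟶ iho A (B ⊠ A) := (RightClosedData.coevT A).app B
def ev (A B : V) : iho A B ⊠ A ⟶ B := (RightClosedData.evT A).app B
def coevN (A : V) {B B' : V} (f : B ⟶ B') : f ≫ coev A B' ≅ coev A B ≫ ihm A (f ⊠ᵣ A) :=
  (RightClosedData.coevT A).naturality f
def evN (A : V) {B B' : V} (f : B ⟶ B') : ihm A f ⊠ᵣ A ≫ ev A B' ≅ ev A B ≫ f :=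
  (RightClosedData.evT A).naturality f
def triS (A B : V) : 𝟙 (B ⊠ A) ≅ coev A B ⊠ᵣ A ≫ ev A (B ⊠ A) := RightClosedData.triS A B
def triT (A B : V) : coev A (iho A B) ≫ ihm A (ev A B) ≅ 𝟙 (iho A B) := RightClosedData.triT A B

end

/-- Right closedness: the 2-cells `triS`, `triT` are modifications and satisfy the two swallowtail
identities, so that `- ⊗ A ⊣ [A, -]` is a coherent pseudoadjunction for every `A`. -/
class RightClosed (V : Type u) [Bicategory.{w, v} V] [Bicategory.Strict V] [GrayMonoid V]
    [RightClosedData V] : Prop where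
  triS_naturality (A : V) {B B' : V} (f : B ⟶ B') :
    Iso.refl (f ⊠ᵣ A) ⊚ cwl (f ⊠ᵣ A) (triS A B') ⊚ cwr (rI (coevN A f) A) (ev A (B' ⊠ A)) ⊚
      cwl (coev A B ⊠ᵣ A) (evN A (f ⊠ᵣ A)) =
    icast (Iso.refl (f ⊠ᵣ A) ⊚ cwr (triS A B) (f ⊠ᵣ A))
  triT_naturality (A : V) {B B' : V} (f : B ⟶ B') :
    Iso.refl (ihm A f ≫ coev A (iho A B') ≫ ihm A (ev A B')) ⊚
      cwr (coevN A (ihm A f)) (ihm A (ev A B')) ⊚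
      cwl (coev A (iho A B)) ((ihComp A (ihm A f ⊠ᵣ A) (ev A B')).symm ≪≫ ihI A (evN A f) ≪≫
        ihComp A (ev A B) f) ⊚
      cwr (triT A B) (ihm A f) =
    icast (Iso.refl (ihm A f ≫ coev A (iho A B') ≫ ihm A (ev A B')) ⊚ cwl (ihm A f) (triT A B'))
  swallowtail_coev (A B : V) :
    Iso.refl (coev A B) ⊚ cwl (coev A B) (ihId A (B ⊠ A)).symm ⊚
      cwl (coev A B) (ihI A (triS A B) ≪≫ ihComp A (coev A B ⊠ᵣ A) (ev A (B ⊠ A))) ⊚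
      cwr (coevN A (coev A B)).symm (ihm A (ev A (B ⊠ A))) ⊚
      cwl (coev A B) (triT A (B ⊠ A)) ⊚ Iso.refl (coev A B) = Iso.refl (coev A B)
  swallowtail_ev (A B : V) :
    Iso.refl (ev A B) ⊚ cwr (triS A (iho A B)) (ev A B) ⊚
      cwl (coev A (iho A B) ⊠ᵣ A) (evN A (ev A B)).symm ⊚
      cwr (rI (triT A B) A) (ev A B) ⊚ Iso.refl (ev A B) = Iso.refl (ev A B)

section

variable {V : Type u} [Bicategory.{w, v} V] [Bicategory.Strict V] [GrayMonoid V] [RightClosedData V]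

/-- The transpose `X ⟶ [A, B]` of a 1-cell `X ⊗ A ⟶ B`, and conversely. -/
def curry (A : V) {X B : V} (f : X ⊠ A ⟶ B) : X ⟶ iho A B := coev A X ≫ ihm A f
@[simp] def uncurry (A : V) {X B : V} (g : X ⟶ iho A B) : X ⊠ A ⟶ B := g ⊠ᵣ A ≫ ev A B

def uncurryCurry (A : V) {X B : V} (f : X ⊠ A ⟶ B) : uncurry A (curry A f) ≅ f :=
  icast (Iso.refl (coev A X ⊠ᵣ A ≫ ihm A f ⊠ᵣ A ≫ ev A B) ⊚ cwl (coev A X ⊠ᵣ A) (evN A f) ⊚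
    cwr (triS A X).symm f) (by simp [uncurry, curry])

def curryUncurry (A : V) {X B : V} (g : X ⟶ iho A B) : g ≅ curry A (uncurry A g) :=
  icast (cwl g (triT A B).symm ⊚ cwr (coevN A g) (ihm A (ev A B)) ⊚
    cwl (coev A X) (ihComp A (g ⊠ᵣ A) (ev A B)).symm) (h' := by simp [uncurry, curry])

/-- The 2-isomorphism `g ≅ g'` of 1-cells `X ⟶ [A, B]` with a given transpose. -/
def ofUncurry {A X B : V} {g g' : X ⟶ iho A B} (θ : uncurry A g ≅ uncurry A g') : g ≅ g' :=
  curryUncurry A g ≪≫ whiskerLeftIso (coev A X) (ihI A θ) ≪≫ (curryUncurry A g').symm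

/-- Composition `[B, C] ⊗ [A, B] ⟶ [A, C]`: the transpose of evaluating twice. -/
def icomp (A B C : V) : iho B C ⊠ iho A B ⟶ iho A C :=
  curry A (𝟙 ((iho B C ⊠ iho A B) ⊠ A) ≫ₑ iho B C ⊠ₗ ev A B ≫ₑ ev B C)

/-- The unit `𝕀 ⟶ [A, A]`: the transpose of the identity. -/
def iunit (A : V) : 𝕀 ⟶ iho A A := curry A (𝟙 (𝕀 ⊠ A) ≫ₑ 𝟙 A)

/-- `[f, C] : [A', C] ⟶ [A, C]` for `f : A ⟶ A'`: the transpose of `([A', C] ⊗ f) ≫ ev`; and its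
action on 2-cells. -/
def ipre {A A' : V} (f : A ⟶ A') (C : V) : iho A' C ⟶ iho A C :=
  curry A (iho A' C ⊠ₗ f ≫ ev A' C)

def ipre₂ {A A' : V} {f f' : A ⟶ A'} (γ : f ⟶ f') (C : V) : ipre f C ⟶ ipre f' C :=
  coev A (iho A' C) ◁ ihm₂ A ((iho A' C ⊠ₗ₂ γ) ▷ ev A' C)

@[simp] theorem ipre₂_id {A A' : V} (f : A ⟶ A') (C : V) : ipre₂ (𝟙 f) C = 𝟙 (ipre f C) := by
  simp [ipre₂, ipre, curry]

@[simp] theorem ipre₂_comp {A A' : V} {f g k : A ⟶ A'} (γ : f ⟶ g) (δ : g ⟶ k) (C : V) :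
    ipre₂ (γ ≫ δ) C = ipre₂ γ C ≫ ipre₂ δ C := by
  simp [ipre₂, ipre, curry]

def icompEv (A B C : V) : uncurry A (icomp A B C) ≅
    𝟙 ((iho B C ⊠ iho A B) ⊠ A) ≫ₑ iho B C ⊠ₗ ev A B ≫ₑ ev B C := uncurryCurry A _

def iunitEv (A : V) : uncurry A (iunit A) ≅ 𝟙 (𝕀 ⊠ A) ≫ₑ 𝟙 A := uncurryCurry A _

def ipreEv {A A' : V} (f : A ⟶ A') (C : V) : uncurry A (ipre f C) ≅ iho A' C ⊠ₗ f ≫ ev A' C :=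
  uncurryCurry A _

/-- Pseudo-functoriality of `[-, C]` on composites and identities. -/
def ipreComp {A A' A'' : V} (f : A ⟶ A') (g : A' ⟶ A'') (C : V) :
    ipre (f ≫ g) C ≅ ipre g C ≫ ipre f C :=
  ofUncurry (icast (ipreEv (f ≫ g) C ⊚ cwl (iho A'' C ⊠ₗ f) (ipreEv g C).symm ⊚
    cwr (inter (ipre g C) f) (ev A' C) ⊚ cwl (ipre g C ⊠ᵣ A) (ipreEv f C).symm)
    (h' := by simp [uncurry]) (h := rfl))

/-- Naturality of composition in its two outer variables. -/
def icompPost (A B : V) {C C' : V} (k : C ⟶ C') :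
    icomp A B C ≫ ihm A k ≅ ihm B k ⊠ᵣ iho A B ≫ icomp A B C' :=
  ofUncurry (icast (
    cwl (icomp A B C ⊠ᵣ A) (evN A k) ⊚
    cwr (icompEv A B C) k ⊚
    cwl (iho B C ⊠ₗ ev A B) (evN B k).symm ⊚
    cwr (inter (ihm B k) (ev A B)) (ev B C') ⊚
    cwl (ihm B k ⊠ᵣ iho A B ⊠ᵣ A) (icompEv A B C').symm))

def icompPre {A A' : V} (f : A ⟶ A') (B C : V) :
    icomp A' B C ≫ ipre f C ≅ iho B C ⊠ₗ ipre f B ≫ icomp A B C :=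
  ofUncurry (icast (
    cwl (icomp A' B C ⊠ᵣ A) (ipreEv f C) ⊚
    cwr (inter (icomp A' B C) f).symm (ev A' C) ⊚
    cwl ((iho B C ⊠ iho A' B) ⊠ₗ f) (icompEv A' B C) ⊚
    cwr (lI (iho B C) (ipreEv f B)).symm (ev B C) ⊚
    cwl (iho B C ⊠ₗ ipre f B ⊠ᵣ A) (icompEv A B C).symm))

end

end Closed

section Enriched

/-- The data of a `V`-bicategory: hom-objects, composition, units, associator and unitors. -/
structure VBicatData (V : Type u) [Bicategory.{w, v} V] [Bicategory.Strict V] [GrayMonoid V] where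
  Obj : Type u₁
  Hom : Obj → Obj → V
  m (a b c : Obj) : Hom b c ⊠ Hom a b ⟶ Hom a c
  u (a : Obj) : 𝕀 ⟶ Hom a a
  assoc (a b c d : Obj) : 𝟙 ((Hom c d ⊠ Hom b c) ⊠ Hom a b) ≫ₑ m b c d ⊠ᵣ Hom a b ≫ₑ m a b d ≅
    𝟙 ((Hom c d ⊠ Hom b c) ⊠ Hom a b) ≫ₑ Hom c d ⊠ₗ m a b c ≫ₑ m a c d
  lun (a b : Obj) : 𝟙 (Hom a b) ≫ₑ u b ⊠ᵣ Hom a b ≫ₑ m a b b ≅ 𝟙 (Hom a b)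
  run (a b : Obj) : 𝟙 (Hom a b) ≫ₑ Hom a b ⊠ₗ u a ≫ₑ m a a b ≅ 𝟙 (Hom a b)

variable {V : Type u} [Bicategory.{w, v} V] [Bicategory.Strict V] [GrayMonoid V]

/-- The axioms of a `V`-bicategory: the identity coherence and the associativity coherence. -/
structure VBicatData.Lawful (C : VBicatData.{w, v, u, u₁} V) : Prop where
  triangle (a b c : C.Obj) :
    Iso.refl (𝟙 (C.Hom b c ⊠ C.Hom a b) ≫ₑ C.Hom b c ⊠ₗ C.u b ⊠ᵣ C.Hom a b ≫ₑ
        C.m b b c ⊠ᵣ C.Hom a b ≫ₑ C.m a b c) ⊚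
      cwl (C.Hom b c ⊠ₗ C.u b ⊠ᵣ C.Hom a b) (C.assoc a b b c) ⊚
      cwr (lI (C.Hom b c) (C.lun a b)) (C.m a b c) ⊚ Iso.refl (C.m a b c) =
    Iso.refl (𝟙 (C.Hom b c ⊠ C.Hom a b) ≫ₑ C.Hom b c ⊠ₗ C.u b ⊠ᵣ C.Hom a b ≫ₑ
        C.m b b c ⊠ᵣ C.Hom a b ≫ₑ C.m a b c) ⊚
      cwr (rI (C.run b c) (C.Hom a b)) (C.m a b c) ⊚ Iso.refl (C.m a b c)
  pentagon (a b c d e : C.Obj) :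
    Iso.refl (𝟙 (((C.Hom d e ⊠ C.Hom c d) ⊠ C.Hom b c) ⊠ C.Hom a b) ≫ₑ
        C.m c d e ⊠ᵣ (C.Hom b c ⊠ C.Hom a b) ≫ₑ C.m b c e ⊠ᵣ C.Hom a b ≫ₑ C.m a b e) ⊚
      cwr (rI (C.assoc b c d e) (C.Hom a b)) (C.m a b e) ⊚
      cwl (C.Hom d e ⊠ₗ C.m b c d ⊠ᵣ C.Hom a b) (C.assoc a b d e) ⊚
      cwr (lI (C.Hom d e) (C.assoc a b c d)) (C.m a d e) =
    icast (Iso.refl (𝟙 (((C.Hom d e ⊠ C.Hom c d) ⊠ C.Hom b c) ⊠ C.Hom a b) ≫ₑ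
        C.m c d e ⊠ᵣ (C.Hom b c ⊠ C.Hom a b) ≫ₑ C.m b c e ⊠ᵣ C.Hom a b ≫ₑ C.m a b e) ⊚
      cwl (C.m c d e ⊠ᵣ (C.Hom b c ⊠ C.Hom a b)) (C.assoc a b c e) ⊚
      cwr (inter (C.m c d e) (C.m a b c)).symm (C.m a c e) ⊚
      cwl ((C.Hom d e ⊠ C.Hom c d) ⊠ₗ C.m a b c) (C.assoc a c d e))

/-- A `V`-pseudofunctor. Its structure cells are `map₂ : (F ⊗ F) ≫ m ≅ m ≫ F`, where
`F ⊗ F = (F ⊗ 1) ≫ (1 ⊗ F)`, and `map₀ : u ≅ u ≫ F`. -/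
structure VPsfData (C : VBicatData.{w, v, u, u₁} V) (D : VBicatData.{w, v, u, u₂} V) where
  obj : C.Obj → D.Obj
  map (a b : C.Obj) : C.Hom a b ⟶ D.Hom (obj a) (obj b)
  map₂ (a b c : C.Obj) :
    map b c ⊠ᵣ C.Hom a b ≫ D.Hom (obj b) (obj c) ⊠ₗ map a b ≫ D.m (obj a) (obj b) (obj c) ≅
      C.m a b c ≫ map a c
  map₀ (a : C.Obj) : D.u (obj a) ≅ C.u a ≫ map a a

variable {C : VBicatData.{w, v, u, u₁} V} {D : VBicatData.{w, v, u, u₂} V}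

structure VPsfData.Lawful (F : VPsfData C D) : Prop where
  map_assoc (a b c d : C.Obj) :
    Iso.refl (𝟙 ((C.Hom c d ⊠ C.Hom b c) ⊠ C.Hom a b) ≫ₑ F.map c d ⊠ᵣ (C.Hom b c ⊠ C.Hom a b) ≫ₑ
        D.Hom (F.obj c) (F.obj d) ⊠ₗ F.map b c ⊠ᵣ C.Hom a b ≫ₑ
        (D.Hom (F.obj c) (F.obj d) ⊠ D.Hom (F.obj b) (F.obj c)) ⊠ₗ F.map a b ≫ₑ
        D.m (F.obj b) (F.obj c) (F.obj d) ⊠ᵣ D.Hom (F.obj a) (F.obj b) ≫ₑ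
        D.m (F.obj a) (F.obj b) (F.obj d)) ⊚
      cw (F.map c d ⊠ᵣ (C.Hom b c ⊠ C.Hom a b) ≫ₑ
          D.Hom (F.obj c) (F.obj d) ⊠ₗ F.map b c ⊠ᵣ C.Hom a b)
        (inter (D.m (F.obj b) (F.obj c) (F.obj d)) (F.map a b))
        (D.m (F.obj a) (F.obj b) (F.obj d)) ⊚
      cwr (rI (F.map₂ b c d) (C.Hom a b)) (D.Hom (F.obj b) (F.obj d) ⊠ₗ F.map a b ≫ₑ
        D.m (F.obj a) (F.obj b) (F.obj d)) ⊚
      cwl (C.m b c d ⊠ᵣ C.Hom a b) (F.map₂ a b d) ⊚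
      cwr (C.assoc a b c d) (F.map a d) =
    icast (
      Iso.refl (𝟙 ((C.Hom c d ⊠ C.Hom b c) ⊠ C.Hom a b) ≫ₑ F.map c d ⊠ᵣ (C.Hom b c ⊠ C.Hom a b) ≫ₑ
        D.Hom (F.obj c) (F.obj d) ⊠ₗ F.map b c ⊠ᵣ C.Hom a b ≫ₑ
        (D.Hom (F.obj c) (F.obj d) ⊠ D.Hom (F.obj b) (F.obj c)) ⊠ₗ F.map a b ≫ₑ
        D.m (F.obj b) (F.obj c) (F.obj d) ⊠ᵣ D.Hom (F.obj a) (F.obj b) ≫ₑ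
        D.m (F.obj a) (F.obj b) (F.obj d)) ⊚
      cwl (F.map c d ⊠ᵣ (C.Hom b c ⊠ C.Hom a b) ≫ₑ
          D.Hom (F.obj c) (F.obj d) ⊠ₗ F.map b c ⊠ᵣ C.Hom a b ≫ₑ
          (D.Hom (F.obj c) (F.obj d) ⊠ D.Hom (F.obj b) (F.obj c)) ⊠ₗ F.map a b)
        (D.assoc (F.obj a) (F.obj b) (F.obj c) (F.obj d)) ⊚
      cw (F.map c d ⊠ᵣ (C.Hom b c ⊠ C.Hom a b)) (lI (D.Hom (F.obj c) (F.obj d)) (F.map₂ a b c))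
        (D.m (F.obj a) (F.obj c) (F.obj d)) ⊚
      cwr (inter (F.map c d) (C.m a b c)).symm
        (D.Hom (F.obj c) (F.obj d) ⊠ₗ F.map a c ≫ₑ D.m (F.obj a) (F.obj c) (F.obj d)) ⊚
      cwl (C.Hom c d ⊠ₗ C.m a b c) (F.map₂ a c d))
  map_lun (a b : C.Obj) :
    Iso.refl (𝟙 (C.Hom a b) ≫ₑ F.map a b ≫ₑ D.u (F.obj b) ⊠ᵣ D.Hom (F.obj a) (F.obj b) ≫ₑ
        D.m (F.obj a) (F.obj b) (F.obj b)) ⊚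
      cw (F.map a b) (rI (F.map₀ b) (D.Hom (F.obj a) (F.obj b)))
        (D.m (F.obj a) (F.obj b) (F.obj b)) ⊚
      cwr (inter (C.u b ≫ F.map b b) (F.map a b)) (D.m (F.obj a) (F.obj b) (F.obj b)) ⊚
      cwl (C.u b ⊠ᵣ C.Hom a b) (F.map₂ a b b) ⊚
      cwr (C.lun a b) (F.map a b) =
    icast (Iso.refl (𝟙 (C.Hom a b) ≫ₑ F.map a b ≫ₑ D.u (F.obj b) ⊠ᵣ D.Hom (F.obj a) (F.obj b) ≫ₑ
        D.m (F.obj a) (F.obj b) (F.obj b)) ⊚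
      cwl (F.map a b) (D.lun (F.obj a) (F.obj b)))
  map_run (a b : C.Obj) :
    Iso.refl (𝟙 (C.Hom a b) ≫ₑ F.map a b ≫ₑ D.Hom (F.obj a) (F.obj b) ⊠ₗ D.u (F.obj a) ≫ₑ
        D.m (F.obj a) (F.obj a) (F.obj b)) ⊚
      cw (F.map a b) (lI (D.Hom (F.obj a) (F.obj b)) (F.map₀ a))
        (D.m (F.obj a) (F.obj a) (F.obj b)) ⊚
      cwr (inter (F.map a b) (C.u a)).symm (D.Hom (F.obj a) (F.obj b) ⊠ₗ F.map a a ≫ₑ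
        D.m (F.obj a) (F.obj a) (F.obj b)) ⊚
      cwl (C.Hom a b ⊠ₗ C.u a) (F.map₂ a a b) ⊚
      cwr (C.run a b) (F.map a b) =
    icast (Iso.refl (𝟙 (C.Hom a b) ≫ₑ F.map a b ≫ₑ D.Hom (F.obj a) (F.obj b) ⊠ₗ D.u (F.obj a) ≫ₑ
        D.m (F.obj a) (F.obj a) (F.obj b)) ⊚
      cwl (F.map a b) (D.run (F.obj a) (F.obj b)))

end Enriched

section Constructions

variable {V : Type u} [Bicategory.{w, v} V] [Bicategory.Strict V] [GrayMonoid V]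

/-- The opposite of a `V`-bicategory: `C^op(a, b) = C(b, a)` with composition `β ≫ m`. -/
def VBicatData.op [Braiding V] (C : VBicatData.{w, v, u, u₁} V) : VBicatData.{w, v, u, u₁} V where
  Obj := C.Obj
  Hom a b := C.Hom b a
  m a b c := β (C.Hom c b) (C.Hom b a) ≫ C.m c b a
  u a := C.u a
  assoc a b c d := icast (
    cw (β (C.Hom d c) (C.Hom c b) ⊠ᵣ C.Hom b a) (brL (C.m d c b) (C.Hom b a)) (C.m d b a) ⊚
    cwr (brL (β (C.Hom d c) (C.Hom c b)) (C.Hom b a))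
      (C.Hom b a ⊠ₗ C.m d c b ≫ₑ C.m d b a) ⊚
    cwr (brSS (C.Hom d c) (C.Hom c b) (C.Hom b a))
      (C.Hom b a ⊠ₗ β (C.Hom d c) (C.Hom c b) ≫ₑ C.Hom b a ⊠ₗ C.m d c b ≫ₑ C.m d b a) ⊚
    cw (C.Hom d c ⊠ₗ β (C.Hom c b) (C.Hom b a)) (brRR (C.Hom d c) (C.Hom b a) (C.Hom c b)).symm
      (C.Hom b a ⊠ₗ C.m d c b ≫ₑ C.m d b a) ⊚
    cwl (C.Hom d c ⊠ₗ β (C.Hom c b) (C.Hom b a) ≫ₑ β (C.Hom d c) (C.Hom b a ⊠ C.Hom c b))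
      (C.assoc d c b a).symm ⊚
    cw (C.Hom d c ⊠ₗ β (C.Hom c b) (C.Hom b a)) (brR (C.Hom d c) (C.m c b a)).symm (C.m d c a))
  lun a b := icast (cwr (brL (C.u b) (C.Hom b a)) (C.m b b a) ⊚ cw₀ (C.run b a))
  run a b := icast (cwr (brR (C.Hom b a) (C.u a)) (C.m b a a) ⊚ cw₀ (C.lun b a))

/-- The composition `(1 ⊗ β ⊗ 1) ≫ (m ⊗ m)` of a tensor product, and its associator and unitors. -/
@[simp] def tensorM [Braiding V] {B₁ B₂ B₁₂ C₁ C₂ C₁₂ : V} (mB : B₁ ⊠ B₂ ⟶ B₁₂) (mC : C₁ ⊠ C₂ ⟶ C₁₂) :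
    (B₁ ⊠ C₁) ⊠ (B₂ ⊠ C₂) ⟶ B₁₂ ⊠ C₁₂ :=
  𝟙 ((B₁ ⊠ C₁) ⊠ B₂ ⊠ C₂) ≫ₑ B₁ ⊠ₗ β C₁ B₂ ⊠ᵣ C₂ ≫ₑ mB ⊠ᵣ (C₁ ⊠ C₂) ≫ₑ B₁₂ ⊠ₗ mC

def tensorAssoc [Braiding V] {B₁ B₂ B₃ B₁₂ B₂₃ B₁₃ C₁ C₂ C₃ C₁₂ C₂₃ C₁₃ : V}
    {mB : B₁ ⊠ B₂ ⟶ B₁₂} {mB' : B₁₂ ⊠ B₃ ⟶ B₁₃} {nB : B₂ ⊠ B₃ ⟶ B₂₃} {nB' : B₁ ⊠ B₂₃ ⟶ B₁₃}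
    {mC : C₁ ⊠ C₂ ⟶ C₁₂} {mC' : C₁₂ ⊠ C₃ ⟶ C₁₃} {nC : C₂ ⊠ C₃ ⟶ C₂₃} {nC' : C₁ ⊠ C₂₃ ⟶ C₁₃}
    (αB : 𝟙 ((B₁ ⊠ B₂) ⊠ B₃) ≫ₑ mB ⊠ᵣ B₃ ≫ₑ mB' ≅ 𝟙 ((B₁ ⊠ B₂) ⊠ B₃) ≫ₑ B₁ ⊠ₗ nB ≫ₑ nB')
    (αC : 𝟙 ((C₁ ⊠ C₂) ⊠ C₃) ≫ₑ mC ⊠ᵣ C₃ ≫ₑ mC' ≅ 𝟙 ((C₁ ⊠ C₂) ⊠ C₃) ≫ₑ C₁ ⊠ₗ nC ≫ₑ nC') :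
    𝟙 (((B₁ ⊠ C₁) ⊠ (B₂ ⊠ C₂)) ⊠ (B₃ ⊠ C₃)) ≫ₑ tensorM mB mC ⊠ᵣ (B₃ ⊠ C₃) ≫ₑ tensorM mB' mC' ≅
    𝟙 (((B₁ ⊠ C₁) ⊠ (B₂ ⊠ C₂)) ⊠ (B₃ ⊠ C₃)) ≫ₑ (B₁ ⊠ C₁) ⊠ₗ tensorM nB nC ≫ₑ tensorM nB' nC' :=
  icast (
      cw (B₁ ⊠ₗ β C₁ B₂ ⊠ᵣ C₂ ⊠ᵣ B₃ ⊠ᵣ C₃ ≫ₑ mB ⊠ᵣ C₁ ⊠ᵣ C₂ ⊠ᵣ B₃ ⊠ᵣ C₃)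
        (lI B₁₂ (rI (brL mC B₃) C₃))
        (mB' ⊠ᵣ (C₁₂ ⊠ C₃) ≫ₑ B₁₃ ⊠ₗ mC') ⊚
      cw (B₁ ⊠ₗ β C₁ B₂ ⊠ᵣ C₂ ⊠ᵣ B₃ ⊠ᵣ C₃ ≫ₑ mB ⊠ᵣ C₁ ⊠ᵣ C₂ ⊠ᵣ B₃ ⊠ᵣ C₃)
        (lI B₁₂ (rI (brSS C₁ C₂ B₃) C₃))
        (B₁₂ ⊠ₗ B₃ ⊠ₗ mC ⊠ᵣ C₃ ≫ₑ mB' ⊠ᵣ (C₁₂ ⊠ C₃) ≫ₑ B₁₃ ⊠ₗ mC') ⊚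
      cw (B₁ ⊠ₗ β C₁ B₂ ⊠ᵣ C₂ ⊠ᵣ B₃ ⊠ᵣ C₃)
        (inter mB (C₁ ⊠ₗ β C₂ B₃ ⊠ᵣ C₃ ≫ₑ β C₁ B₃ ⊠ᵣ C₂ ⊠ᵣ C₃)).symm
        (B₁₂ ⊠ₗ B₃ ⊠ₗ mC ⊠ᵣ C₃ ≫ₑ mB' ⊠ᵣ (C₁₂ ⊠ C₃) ≫ₑ B₁₃ ⊠ₗ mC') ⊚
      cw (B₁ ⊠ₗ β C₁ B₂ ⊠ᵣ C₂ ⊠ᵣ B₃ ⊠ᵣ C₃ ≫ₑ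
          (B₁ ⊠ B₂) ⊠ₗ (C₁ ⊠ₗ β C₂ B₃ ⊠ᵣ C₃ ≫ₑ β C₁ B₃ ⊠ᵣ C₂ ⊠ᵣ C₃) ≫ₑ
          mB ⊠ᵣ (B₃ ⊠ C₁ ⊠ C₂ ⊠ C₃))
        (inter mB' (mC ⊠ᵣ C₃))
        (B₁₃ ⊠ₗ mC') ⊚
      cw (B₁ ⊠ₗ β C₁ B₂ ⊠ᵣ C₂ ⊠ᵣ B₃ ⊠ᵣ C₃ ≫ₑ
          (B₁ ⊠ B₂) ⊠ₗ (C₁ ⊠ₗ β C₂ B₃ ⊠ᵣ C₃ ≫ₑ β C₁ B₃ ⊠ᵣ C₂ ⊠ᵣ C₃))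
        (rI (αB) (C₁ ⊠ C₂ ⊠ C₃))
        (B₁₃ ⊠ₗ mC ⊠ᵣ C₃ ≫ₑ B₁₃ ⊠ₗ mC') ⊚
      cwl (B₁ ⊠ₗ β C₁ B₂ ⊠ᵣ C₂ ⊠ᵣ B₃ ⊠ᵣ C₃ ≫ₑ
          (B₁ ⊠ B₂) ⊠ₗ (C₁ ⊠ₗ β C₂ B₃ ⊠ᵣ C₃ ≫ₑ β C₁ B₃ ⊠ᵣ C₂ ⊠ᵣ C₃) ≫ₑ
          B₁ ⊠ₗ nB ⊠ᵣ (C₁ ⊠ C₂ ⊠ C₃) ≫ₑ nB' ⊠ᵣ (C₁ ⊠ C₂ ⊠ C₃))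
        (lI B₁₃ (αC)) ⊚
      cwr (inter (B₁ ⊠ₗ β C₁ B₂) (β C₂ B₃ ⊠ᵣ C₃)).symm
        (B₁ ⊠ₗ B₂ ⊠ₗ β C₁ B₃ ⊠ᵣ C₂ ⊠ᵣ C₃ ≫ₑ
          B₁ ⊠ₗ nB ⊠ᵣ (C₁ ⊠ C₂ ⊠ C₃) ≫ₑ nB' ⊠ᵣ (C₁ ⊠ C₂ ⊠ C₃) ≫ₑ
          B₁₃ ⊠ₗ C₁ ⊠ₗ nC ≫ₑ B₁₃ ⊠ₗ nC') ⊚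
      cw ((B₁ ⊠ C₁ ⊠ B₂) ⊠ₗ β C₂ B₃ ⊠ᵣ C₃)
        (lI B₁ (rI (brRR C₁ B₂ B₃).symm (C₂ ⊠ C₃)))
        (B₁ ⊠ₗ nB ⊠ᵣ (C₁ ⊠ C₂ ⊠ C₃) ≫ₑ nB' ⊠ᵣ (C₁ ⊠ C₂ ⊠ C₃) ≫ₑ
          B₁₃ ⊠ₗ C₁ ⊠ₗ nC ≫ₑ B₁₃ ⊠ₗ nC') ⊚
      cw ((B₁ ⊠ C₁ ⊠ B₂) ⊠ₗ β C₂ B₃ ⊠ᵣ C₃)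
        (lI B₁ (rI (brR C₁ nB).symm (C₂ ⊠ C₃)))
        (nB' ⊠ᵣ (C₁ ⊠ C₂ ⊠ C₃) ≫ₑ B₁₃ ⊠ₗ C₁ ⊠ₗ nC ≫ₑ B₁₃ ⊠ₗ nC') ⊚
      cw ((B₁ ⊠ C₁ ⊠ B₂) ⊠ₗ β C₂ B₃ ⊠ᵣ C₃ ≫ₑ
          (B₁ ⊠ C₁) ⊠ₗ nB ⊠ᵣ (C₂ ⊠ C₃) ≫ₑ B₁ ⊠ₗ β C₁ B₂₃ ⊠ᵣ (C₂ ⊠ C₃))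
        (inter nB' (C₁ ⊠ₗ nC)).symm (B₁₃ ⊠ₗ nC') ⊚
      cw ((B₁ ⊠ C₁ ⊠ B₂) ⊠ₗ β C₂ B₃ ⊠ᵣ C₃ ≫ₑ (B₁ ⊠ C₁) ⊠ₗ nB ⊠ᵣ (C₂ ⊠ C₃))
        (inter (B₁ ⊠ₗ β C₁ B₂₃) nC).symm
        (nB' ⊠ᵣ (C₁ ⊠ C₂₃) ≫ₑ B₁₃ ⊠ₗ nC'))
    (h := by simp [ccomp, tensorM]) (h' := by simp [ccomp, tensorM])

def tensorLun [Braiding V] {B₀ B₁ C₀ C₁ : V} {uB : 𝕀 ⟶ B₀} {mB : B₀ ⊠ B₁ ⟶ B₁}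
    {uC : 𝕀 ⟶ C₀} {mC : C₀ ⊠ C₁ ⟶ C₁} (lB : 𝟙 B₁ ≫ₑ uB ⊠ᵣ B₁ ≫ₑ mB ≅ 𝟙 B₁)
    (lC : 𝟙 C₁ ≫ₑ uC ⊠ᵣ C₁ ≫ₑ mC ≅ 𝟙 C₁) :
    𝟙 (B₁ ⊠ C₁) ≫ₑ (𝟙 𝕀 ≫ₑ uB ⊠ᵣ 𝕀 ≫ₑ B₀ ⊠ₗ uC) ⊠ᵣ (B₁ ⊠ C₁) ≫ₑ tensorM mB mC ≅
      𝟙 (B₁ ⊠ C₁) :=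
  icast (
    cw (uB ⊠ᵣ B₁ ⊠ᵣ C₁) (lI B₀ (rI (brL uC B₁) C₁)) (mB ⊠ᵣ (C₀ ⊠ C₁) ≫ₑ B₁ ⊠ₗ mC) ⊚
    cw (uB ⊠ᵣ B₁ ⊠ᵣ C₁) (inter mB (uC ⊠ᵣ C₁)) (B₁ ⊠ₗ mC) ⊚
    cwr (rI lB C₁) (B₁ ⊠ₗ uC ⊠ᵣ C₁ ≫ₑ B₁ ⊠ₗ mC) ⊚
    cw₀ (lI B₁ lC))
    (h := by simp [ccomp, tensorM])

def tensorRun [Braiding V] {B₀ B₁ C₀ C₁ : V} {uB : 𝕀 ⟶ B₀} {mB : B₁ ⊠ B₀ ⟶ B₁}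
    {uC : 𝕀 ⟶ C₀} {mC : C₁ ⊠ C₀ ⟶ C₁} (rB : 𝟙 B₁ ≫ₑ B₁ ⊠ₗ uB ≫ₑ mB ≅ 𝟙 B₁)
    (rC : 𝟙 C₁ ≫ₑ C₁ ⊠ₗ uC ≫ₑ mC ≅ 𝟙 C₁) :
    𝟙 (B₁ ⊠ C₁) ≫ₑ (B₁ ⊠ C₁) ⊠ₗ (𝟙 𝕀 ≫ₑ uB ⊠ᵣ 𝕀 ≫ₑ B₀ ⊠ₗ uC) ≫ₑ tensorM mB mC ≅
      𝟙 (B₁ ⊠ C₁) :=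
  icast (
    cw ((B₁ ⊠ C₁) ⊠ₗ uB) (inter (B₁ ⊠ₗ β C₁ B₀) uC) (mB ⊠ᵣ (C₁ ⊠ C₀) ≫ₑ B₁ ⊠ₗ mC) ⊚
    cwr (lI B₁ (brR C₁ uB)) ((B₁ ⊠ B₀ ⊠ C₁) ⊠ₗ uC ≫ₑ mB ⊠ᵣ (C₁ ⊠ C₀) ≫ₑ B₁ ⊠ₗ mC) ⊚
    cw (B₁ ⊠ₗ uB ⊠ᵣ C₁) (inter mB (C₁ ⊠ₗ uC)) (B₁ ⊠ₗ mC) ⊚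
    cwr (rI rB C₁) (B₁ ⊠ₗ C₁ ⊠ₗ uC ≫ₑ B₁ ⊠ₗ mC) ⊚
    cw₀ (lI B₁ rC))
    (h := by simp [ccomp, tensorM])

/-- The tensor product of two `V`-bicategories: `(B ⊗ C)((b, c), (b', c')) = B(b, b') ⊗ C(c, c')`,
with composition `(1 ⊗ β ⊗ 1) ≫ (m ⊗ m)` and unit `u ⊗ u`. -/
def VBicatData.tensor [Braiding V] (B : VBicatData.{w, v, u, u₁} V)
    (C : VBicatData.{w, v, u, u₂} V) : VBicatData.{w, v, u, max u₁ u₂} V where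
  Obj := B.Obj × C.Obj
  Hom x y := B.Hom x.1 y.1 ⊠ C.Hom x.2 y.2
  m x y z := tensorM (B.m x.1 y.1 z.1) (C.m x.2 y.2 z.2)
  u x := 𝟙 𝕀 ≫ₑ B.u x.1 ⊠ᵣ 𝕀 ≫ₑ B.Hom x.1 x.1 ⊠ₗ C.u x.2
  assoc x y z t := tensorAssoc (B.assoc x.1 y.1 z.1 t.1) (C.assoc x.2 y.2 z.2 t.2)
  lun x y := tensorLun (B.lun x.1 y.1) (C.lun x.2 y.2)
  run x y := tensorRun (B.run x.1 y.1) (C.run x.2 y.2)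

/-- A right closed Gray monoid as a `V`-bicategory, with hom-objects `[A, B]`. -/
def selfEnriched (V : Type u) [Bicategory.{w, v} V] [Bicategory.Strict V] [GrayMonoid V]
    [RightClosedData V] : VBicatData.{w, v, u, u} V where
  Obj := V
  Hom A B := iho A B
  m A B C := icomp A B C
  u A := iunit A
  assoc A B C D := ofUncurry (icast (
    cwl (icomp B C D ⊠ᵣ iho A B ⊠ᵣ A) (icompEv A B D) ⊚
    cwr (inter (icomp B C D) (ev A B)).symm (ev B D) ⊚
    cwl ((iho C D ⊠ iho B C) ⊠ₗ ev A B) (icompEv B C D) ⊚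
    cwr (lI (iho C D) (icompEv A B C)).symm (ev C D) ⊚
    cwl (iho C D ⊠ₗ icomp A B C ⊠ᵣ A) (icompEv A C D).symm))
  lun A B := ofUncurry (icast (
    cwl (iunit B ⊠ᵣ iho A B ⊠ᵣ A) (icompEv A B B) ⊚
    cwr (inter (iunit B) (ev A B)).symm (ev B B) ⊚
    cwl (ev A B) (iunitEv B)))
  run A B := ofUncurry (icast (
    cwl (iho A B ⊠ₗ iunit A ⊠ᵣ A) (icompEv A A B) ⊚
    cwr (lI (iho A B) (iunitEv A)) (ev A B)))

end Constructions

section PartialFunctors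

variable {V : Type u} [Bicategory.{w, v} V] [Bicategory.Strict V] [GrayMonoid V] [Braiding V]

/-- Restrictions of a 1-cell `X ⊗ Y ⟶ D` along units of `Y` and of `X`. -/
def pleft {X Y D : V} (u : 𝕀 ⟶ Y) (F : X ⊠ Y ⟶ D) : X ⟶ D := 𝟙 X ≫ₑ X ⊠ₗ u ≫ₑ F
def pright {X Y D : V} (u : 𝕀 ⟶ X) (F : X ⊠ Y ⟶ D) : Y ⟶ D := 𝟙 Y ≫ₑ u ⊠ᵣ Y ≫ₑ F

def pleftUnit {X Y D : V} {uX : 𝕀 ⟶ X} {uY : 𝕀 ⟶ Y} {uD : 𝕀 ⟶ D} {F : X ⊠ Y ⟶ D}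
    (P₀ : uD ≅ (𝟙 𝕀 ≫ₑ uX ⊠ᵣ 𝕀 ≫ₑ X ⊠ₗ uY) ≫ F) : uD ≅ uX ≫ pleft uY F :=
  icast P₀ (h' := by simp [ccomp, pleft])

def prightUnit {X Y D : V} {uX : 𝕀 ⟶ X} {uY : 𝕀 ⟶ Y} {uD : 𝕀 ⟶ D} {F : X ⊠ Y ⟶ D}
    (P₀ : uD ≅ (𝟙 𝕀 ≫ₑ uX ⊠ᵣ 𝕀 ≫ₑ X ⊠ₗ uY) ≫ F) : uD ≅ uY ≫ pright uX F :=
  icast (P₀ ⊚ cwr (inter uX uY).symm F) (h' := by simp [ccomp, pright])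

def pleftMult {X₁ X₂ X₁₂ Y₀ D₁ D₂ D₁₂ : V} {F₁ : X₁ ⊠ Y₀ ⟶ D₁} {F₂ : X₂ ⊠ Y₀ ⟶ D₂}
    {F₁₂ : X₁₂ ⊠ Y₀ ⟶ D₁₂} {mX : X₂ ⊠ X₁ ⟶ X₁₂} {mY : Y₀ ⊠ Y₀ ⟶ Y₀} {mD : D₂ ⊠ D₁ ⟶ D₁₂}
    {uY : 𝕀 ⟶ Y₀}
    (P₂ : F₂ ⊠ᵣ (X₁ ⊠ Y₀) ≫ D₂ ⊠ₗ F₁ ≫ mD ≅ tensorM mX mY ≫ F₁₂)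
    (lY : 𝟙 Y₀ ≫ₑ uY ⊠ᵣ Y₀ ≫ₑ mY ≅ 𝟙 Y₀) :
    pleft uY F₂ ⊠ᵣ X₁ ≫ D₂ ⊠ₗ pleft uY F₁ ≫ mD ≅ mX ≫ pleft uY F₁₂ :=
  icast (
    cw (X₂ ⊠ₗ uY ⊠ᵣ X₁) (inter F₂ (X₁ ⊠ₗ uY)).symm (D₂ ⊠ₗ F₁ ≫ₑ mD) ⊚
    cwl (X₂ ⊠ₗ uY ⊠ᵣ X₁ ≫ₑ (X₂ ⊠ Y₀) ⊠ₗ X₁ ⊠ₗ uY) P₂ ⊚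
    cwr (inter (X₂ ⊠ₗ uY ⊠ᵣ X₁) uY).symm (tensorM mX mY ≫ₑ F₁₂) ⊚
    cw ((X₂ ⊠ X₁) ⊠ₗ uY) (lI X₂ (rI (brL uY X₁) Y₀)) (mX ⊠ᵣ (Y₀ ⊠ Y₀) ≫ₑ X₁₂ ⊠ₗ mY ≫ₑ F₁₂) ⊚
    cwr (inter mX (uY ≫ₑ uY ⊠ᵣ Y₀)) (X₁₂ ⊠ₗ mY ≫ₑ F₁₂) ⊚
    cw (mX ≫ₑ X₁₂ ⊠ₗ uY) (lI X₁₂ lY) F₁₂)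
    (h := by simp [ccomp, pleft]) (h' := by simp [ccomp, pleft])

def prightMult {Y₁ Y₂ Y₁₂ X₀ D₁ D₂ D₁₂ : V} {F₁ : X₀ ⊠ Y₁ ⟶ D₁} {F₂ : X₀ ⊠ Y₂ ⟶ D₂}
    {F₁₂ : X₀ ⊠ Y₁₂ ⟶ D₁₂} {mX : X₀ ⊠ X₀ ⟶ X₀} {mY : Y₂ ⊠ Y₁ ⟶ Y₁₂} {mD : D₂ ⊠ D₁ ⟶ D₁₂}
    {uX : 𝕀 ⟶ X₀}
    (P₂ : F₂ ⊠ᵣ (X₀ ⊠ Y₁) ≫ D₂ ⊠ₗ F₁ ≫ mD ≅ tensorM mX mY ≫ F₁₂)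
    (rX : 𝟙 X₀ ≫ₑ X₀ ⊠ₗ uX ≫ₑ mX ≅ 𝟙 X₀) :
    pright uX F₂ ⊠ᵣ Y₁ ≫ D₂ ⊠ₗ pright uX F₁ ≫ mD ≅ mY ≫ pright uX F₁₂ :=
  icast (
    cw (uX ⊠ᵣ Y₂ ⊠ᵣ Y₁) (inter F₂ (uX ⊠ᵣ Y₁)).symm (D₂ ⊠ₗ F₁ ≫ₑ mD) ⊚
    cwl (uX ⊠ᵣ Y₂ ⊠ᵣ Y₁ ≫ₑ (X₀ ⊠ Y₂) ⊠ₗ uX ⊠ᵣ Y₁) P₂ ⊚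
    cw (uX ⊠ᵣ Y₂ ⊠ᵣ Y₁) (lI X₀ (rI (brR Y₂ uX) Y₁)) (mX ⊠ᵣ (Y₂ ⊠ Y₁) ≫ₑ X₀ ⊠ₗ mY ≫ₑ F₁₂) ⊚
    cw (uX ⊠ᵣ (Y₂ ⊠ Y₁)) (rI rX (Y₂ ⊠ Y₁)) (X₀ ⊠ₗ mY ≫ₑ F₁₂) ⊚
    cwr (inter uX mY).symm F₁₂)
    (h := by simp [ccomp, pright]) (h' := by simp [ccomp, pright])

/-- `P ≅ P_{-q'} ∘ P_{p-}`, read from right to left. -/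
def pnu {X X' Y Y' D D' D'' : V} {F : X ⊠ Y ⟶ D} {F' : X ⊠ Y' ⟶ D'} {F'' : X' ⊠ Y ⟶ D''}
    {mX : X ⊠ X' ⟶ X} {mY : Y' ⊠ Y ⟶ Y} {mD : D' ⊠ D'' ⟶ D} {uX : 𝕀 ⟶ X'} {uY : 𝕀 ⟶ Y'}
    (P₂ : F' ⊠ᵣ (X' ⊠ Y) ≫ D' ⊠ₗ F'' ≫ mD ≅ tensorM mX mY ≫ F)
    (rX : 𝟙 X ≫ₑ X ⊠ₗ uX ≫ₑ mX ≅ 𝟙 X) (lY : 𝟙 Y ≫ₑ uY ⊠ᵣ Y ≫ₑ mY ≅ 𝟙 Y) :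
    pleft uY F' ⊠ᵣ Y ≫ D' ⊠ₗ pright uX F'' ≫ mD ≅ F :=
  icast (
    cw (X ⊠ₗ uY ⊠ᵣ Y) (inter F' (uX ⊠ᵣ Y)).symm (D' ⊠ₗ F'' ≫ₑ mD) ⊚
    cwl (X ⊠ₗ uY ⊠ᵣ Y ≫ₑ (X ⊠ Y') ⊠ₗ uX ⊠ᵣ Y) P₂ ⊚
    cw (X ⊠ₗ uY ⊠ᵣ Y) (lI X (rI (brR Y' uX) Y)) (mX ⊠ᵣ (Y' ⊠ Y) ≫ₑ X ⊠ₗ mY ≫ₑ F) ⊚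
    cwr (lI X (rI (inter uX uY) Y)) (mX ⊠ᵣ (Y' ⊠ Y) ≫ₑ X ⊠ₗ mY ≫ₑ F) ⊚
    cw (X ⊠ₗ uX ⊠ᵣ Y) (inter mX (uY ⊠ᵣ Y)) (X ⊠ₗ mY ≫ₑ F) ⊚
    cwr (rI rX Y) (X ⊠ₗ uY ⊠ᵣ Y ≫ₑ X ⊠ₗ mY ≫ₑ F) ⊚
    cwr (lI X lY) F)
    (h := by simp [ccomp, pleft, pright])

/-- `P_{p'-} ∘ P_{-q} ≅ β ≫ P`. -/
def pmu {X X' Y Y' D D₁ D₂ : V} {F : X ⊠ Y ⟶ D} {F₁ : X' ⊠ Y ⟶ D₁} {F₂ : X ⊠ Y' ⟶ D₂}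
    {mX : X' ⊠ X ⟶ X} {mY : Y ⊠ Y' ⟶ Y} {mD : D₁ ⊠ D₂ ⟶ D} {uX : 𝕀 ⟶ X'} {uY : 𝕀 ⟶ Y'}
    (P₂ : F₁ ⊠ᵣ (X ⊠ Y') ≫ D₁ ⊠ₗ F₂ ≫ mD ≅ tensorM mX mY ≫ F)
    (lX : 𝟙 X ≫ₑ uX ⊠ᵣ X ≫ₑ mX ≅ 𝟙 X) (rY : 𝟙 Y ≫ₑ Y ⊠ₗ uY ≫ₑ mY ≅ 𝟙 Y) :
    pright uX F₁ ⊠ᵣ X ≫ D₁ ⊠ₗ pleft uY F₂ ≫ mD ≅ β Y X ≫ F :=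
  icast (
    cw (uX ⊠ᵣ Y ⊠ᵣ X) (inter F₁ (X ⊠ₗ uY)).symm (D₁ ⊠ₗ F₂ ≫ₑ mD) ⊚
    cwl (uX ⊠ᵣ Y ⊠ᵣ X ≫ₑ (X' ⊠ Y) ⊠ₗ X ⊠ₗ uY) P₂ ⊚
    cw (uX ⊠ᵣ Y ⊠ᵣ X) (inter (X' ⊠ₗ β Y X) uY) (mX ⊠ᵣ (Y ⊠ Y') ≫ₑ X ⊠ₗ mY ≫ₑ F) ⊚
    cwr (inter uX (β Y X)).symm ((X' ⊠ X ⊠ Y) ⊠ₗ uY ≫ₑ mX ⊠ᵣ (Y ⊠ Y') ≫ₑ X ⊠ₗ mY ≫ₑ F) ⊚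
    cw (β Y X ≫ₑ uX ⊠ᵣ X ⊠ᵣ Y) (inter mX (Y ⊠ₗ uY)) (X ⊠ₗ mY ≫ₑ F) ⊚
    cw (β Y X) (rI lX Y) (X ⊠ₗ Y ⊠ₗ uY ≫ₑ X ⊠ₗ mY ≫ₑ F) ⊚
    cw (β Y X) (lI X rY) F)
    (h := by simp [ccomp, pleft, pright])

namespace VPsfData

variable {X : VBicatData.{w, v, u, u₁} V} {Y : VBicatData.{w, v, u, u₂} V}
  {D : VBicatData.{w, v, u, u₃} V} (P : VPsfData (X.tensor Y) D)

/-- The action of the partial functor `P_{-q}` on `X(p, p')`, and of `P_{p-}` on `Y(q, q')`. -/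
def left (p p' : X.Obj) (q : Y.Obj) : X.Hom p p' ⟶ D.Hom (P.obj (p, q)) (P.obj (p', q)) :=
  pleft (Y.u q) (P.map (p, q) (p', q))
def right (p : X.Obj) (q q' : Y.Obj) : Y.Hom q q' ⟶ D.Hom (P.obj (p, q)) (P.obj (p, q')) :=
  pright (X.u p) (P.map (p, q) (p, q'))

/-- The unit cells of the partial functors. -/
def leftUnit (p : X.Obj) (q : Y.Obj) : D.u (P.obj (p, q)) ≅ X.u p ≫ P.left p p q :=
  pleftUnit (P.map₀ (p, q))
def rightUnit (p : X.Obj) (q : Y.Obj) : D.u (P.obj (p, q)) ≅ Y.u q ≫ P.right p q q :=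
  prightUnit (P.map₀ (p, q))

/-- The multiplication cells of the partial functors. -/
def leftMult (p p' p'' : X.Obj) (q : Y.Obj) :
    P.left p' p'' q ⊠ᵣ X.Hom p p' ≫ D.Hom (P.obj (p', q)) (P.obj (p'', q)) ⊠ₗ P.left p p' q ≫
      D.m (P.obj (p, q)) (P.obj (p', q)) (P.obj (p'', q)) ≅ X.m p p' p'' ≫ P.left p p'' q :=
  pleftMult (P.map₂ (p, q) (p', q) (p'', q)) (Y.lun q q)
def rightMult (p : X.Obj) (q q' q'' : Y.Obj) :
    P.right p q' q'' ⊠ᵣ Y.Hom q q' ≫ D.Hom (P.obj (p, q')) (P.obj (p, q'')) ⊠ₗ P.right p q q' ≫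
      D.m (P.obj (p, q)) (P.obj (p, q')) (P.obj (p, q'')) ≅ Y.m q q' q'' ≫ P.right p q q'' :=
  prightMult (P.map₂ (p, q) (p, q') (p, q'')) (X.run p p)

/-- The exchange cell `P_{p'-} ∘ P_{-q} ≅ β ≫ (P_{-q'} ∘ P_{p-})`. -/
def exch (p p' : X.Obj) (q q' : Y.Obj) :
    P.right p' q q' ⊠ᵣ X.Hom p p' ≫ D.Hom (P.obj (p', q)) (P.obj (p', q')) ⊠ₗ P.left p p' q ≫
      D.m (P.obj (p, q)) (P.obj (p', q)) (P.obj (p', q')) ≅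
    β (Y.Hom q q') (X.Hom p p') ≫
      P.left p p' q' ⊠ᵣ Y.Hom q q' ≫ D.Hom (P.obj (p, q')) (P.obj (p', q')) ⊠ₗ P.right p q q' ≫
      D.m (P.obj (p, q)) (P.obj (p, q')) (P.obj (p', q')) :=
  pmu (P.map₂ (p, q) (p', q) (p', q')) (X.lun p p') (Y.run q q') ≪≫
    whiskerLeftIso (β (Y.Hom q q') (X.Hom p p'))
      (pnu (P.map₂ (p, q) (p, q') (p', q')) (X.run p p') (Y.lun q q')).symm

end VPsfData

end PartialFunctors

section CatValued

/-- A pseudofunctor to `Cat` from its action on objects, 1-cells and 2-cells, with the coherence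
conditions expressed in components. -/
def mkCatPseudofunctor {V : Type u} [Bicategory.{w, v} V] (E : V → Type u₂)
    [∀ x, Category.{u₁} (E x)] (act : ∀ {x y : V}, (x ⟶ y) → E x ⥤ E y)
    (act₂ : ∀ {x y : V} {k l : x ⟶ y}, (k ⟶ l) → (act k ⟶ act l))
    (actId : ∀ x : V, act (𝟙 x) ≅ 𝟭 (E x))
    (actComp : ∀ {x y z : V} (k : x ⟶ y) (l : y ⟶ z), act (k ≫ l) ≅ act k ⋙ act l)
    (id : ∀ {x y : V} (k : x ⟶ y) (i : E x), (act₂ (𝟙 k)).app i = 𝟙 _)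
    (comp : ∀ {x y : V} {k l m : x ⟶ y} (θ : k ⟶ l) (κ : l ⟶ m) (i : E x),
      (act₂ (θ ≫ κ)).app i = (act₂ θ).app i ≫ (act₂ κ).app i)
    (wl : ∀ {x y z : V} (k : x ⟶ y) {l l' : y ⟶ z} (θ : l ⟶ l') (i : E x),
      (act₂ (k ◁ θ)).app i = (actComp k l).hom.app i ≫ (act₂ θ).app ((act k).obj i) ≫
        (actComp k l').inv.app i)
    (wr : ∀ {x y z : V} {k k' : x ⟶ y} (θ : k ⟶ k') (l : y ⟶ z) (i : E x),
      (act₂ (θ ▷ l)).app i = (actComp k l).hom.app i ≫ (act l).map ((act₂ θ).app i) ≫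
        (actComp k' l).inv.app i)
    (as : ∀ {x y z t : V} (k : x ⟶ y) (l : y ⟶ z) (m : z ⟶ t) (i : E x),
      (act₂ (α_ k l m).hom).app i = (actComp (k ≫ l) m).hom.app i ≫
        (act m).map ((actComp k l).hom.app i) ≫ (actComp l m).inv.app ((act k).obj i) ≫
        (actComp k (l ≫ m)).inv.app i)
    (lu : ∀ {x y : V} (k : x ⟶ y) (i : E x), (act₂ (λ_ k).hom).app i =
      (actComp (𝟙 x) k).hom.app i ≫ (act k).map ((actId x).hom.app i))
    (ru : ∀ {x y : V} (k : x ⟶ y) (i : E x), (act₂ (ρ_ k).hom).app i =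
      (actComp k (𝟙 y)).hom.app i ≫ (actId y).hom.app ((act k).obj i)) :
    V ⥤ᵖ Cat.{u₁, u₂} where
  obj x := Cat.of (E x)
  map k := (act k).toCatHom
  map₂ θ := (act₂ θ).toCatHom₂
  map₂_id k := by
    apply Cat.Hom₂.ext; ext i; exact id k i
  map₂_comp θ κ := by
    apply Cat.Hom₂.ext; ext i; exact comp θ κ i
  mapId x := Cat.Hom.isoMk (actId x)
  mapComp k l := Cat.Hom.isoMk (actComp k l)
  map₂_whisker_left k _ _ θ := by
    apply Cat.Hom₂.ext; ext i; exact wl k θ i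
  map₂_whisker_right θ l := by
    apply Cat.Hom₂.ext; ext i; exact wr θ l i
  map₂_associator k l m := by
    apply Cat.Hom₂.ext; ext i
    refine (as k l m i).trans ?_
    change _ = (actComp (k ≫ l) m).hom.app i ≫ (act m).map ((actComp k l).hom.app i) ≫
      𝟙 _ ≫ (actComp l m).inv.app ((act k).obj i) ≫ (actComp k (l ≫ m)).inv.app i
    rw [Category.id_comp]
  map₂_left_unitor k := by
    apply Cat.Hom₂.ext; ext i
    refine (lu k i).trans ?_
    change _ = (actComp (𝟙 _) k).hom.app i ≫ (act k).map ((actId _).hom.app i) ≫ 𝟙 _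
    rw [Category.comp_id]
  map₂_right_unitor k := by
    apply Cat.Hom₂.ext; ext i
    refine (ru k i).trans ?_
    change _ = (actComp k (𝟙 _)).hom.app i ≫ (actId _).hom.app ((act k).obj i) ≫ 𝟙 _
    rw [Category.comp_id]

variable {V : Type u} [Bicategory.{w, v} V]

/-- The category `V(c, x)`, in a possibly larger universe. -/
structure HomTo (c x : V) : Type (max u₃ v) where
  hom : c ⟶ x

@[ext] structure HomTo.Cell {c x : V} (f g : HomTo.{w, v, u, u₃} c x) : Type (max u₃ w) where
  cell : f.hom ⟶ g.hom

instance (c x : V) : Category.{max u₃ w} (HomTo.{w, v, u, u₃} c x) where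
  Hom f g := HomTo.Cell f g
  id f := ⟨𝟙 f.hom⟩
  comp θ κ := ⟨θ.cell ≫ κ.cell⟩

@[ext] theorem HomTo.hom_ext {c x : V} {f g : HomTo.{w, v, u, u₃} c x} {θ κ : f ⟶ g}
    (h : HomTo.Cell.cell θ = HomTo.Cell.cell κ) : θ = κ := HomTo.Cell.ext h

@[simp] theorem HomTo.id_cell {c x : V} (f : HomTo.{w, v, u, u₃} c x) :
    HomTo.Cell.cell (𝟙 f) = 𝟙 f.hom := rfl

@[simp] theorem HomTo.comp_cell {c x : V} {f g h : HomTo.{w, v, u, u₃} c x} (θ : f ⟶ g)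
    (κ : g ⟶ h) : HomTo.Cell.cell (θ ≫ κ) = HomTo.Cell.cell θ ≫ HomTo.Cell.cell κ := rfl

/-- The representable pseudofunctor `x ↦ V(c, x)`. -/
def repTo (c : V) : V ⥤ᵖ Cat.{max u₃ w, max u₃ v} :=
  mkCatPseudofunctor (fun x => HomTo.{w, v, u, u₃} c x)
    (act := fun k => { obj := fun f => ⟨f.hom ≫ k⟩, map := fun θ => ⟨θ.cell ▷ k⟩ })
    (act₂ := fun θ =>
      { app := fun f => ⟨f.hom ◁ θ⟩
        naturality := fun _ _ κ => HomTo.hom_ext (whisker_exchange κ.cell θ).symm })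
    (actId := fun x => NatIso.ofComponents (fun f =>
      { hom := ⟨(ρ_ f.hom).hom⟩, inv := ⟨(ρ_ f.hom).inv⟩ }))
    (actComp := fun k l => NatIso.ofComponents (fun f =>
      { hom := ⟨(α_ f.hom k l).inv⟩, inv := ⟨(α_ f.hom k l).hom⟩ }))
    (id := by intros; apply HomTo.hom_ext; simp)
    (comp := by intros; apply HomTo.hom_ext; simp)
    (wl := by intros; apply HomTo.hom_ext; simp)
    (wr := by intros; apply HomTo.hom_ext; simp)
    (as := by intros; apply HomTo.hom_ext; simp)
    (lu := by intros; apply HomTo.hom_ext; simp)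
    (ru := by intros; apply HomTo.hom_ext; simp)

/-- The representable pseudofunctor `x ↦ V(x, c)`. -/
def repFrom (c : V) : Vᵒᵖ ⥤ᵖ Cat.{max u₃ w, max u₃ v} :=
  mkCatPseudofunctor (fun x => HomTo.{w, v, u, u₃} (unop x) c)
    (act := fun k => { obj := fun f => ⟨k.unop ≫ f.hom⟩, map := fun θ => ⟨k.unop ◁ θ.cell⟩ })
    (act₂ := fun θ =>
      { app := fun f => ⟨θ.unop2 ▷ f.hom⟩
        naturality := fun _ _ κ => HomTo.hom_ext (whisker_exchange θ.unop2 κ.cell) })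
    (actId := fun x => NatIso.ofComponents (fun f =>
      { hom := ⟨(λ_ f.hom).hom⟩, inv := ⟨(λ_ f.hom).inv⟩ }))
    (actComp := fun k l => NatIso.ofComponents (fun f =>
      { hom := ⟨(α_ l.unop k.unop f.hom).hom⟩, inv := ⟨(α_ l.unop k.unop f.hom).inv⟩ }))
    (id := by intros; apply HomTo.hom_ext; simp)
    (comp := by intros; apply HomTo.hom_ext; simp)
    (wl := by intros; apply HomTo.hom_ext; simp)
    (wr := by intros; apply HomTo.hom_ext; simp)
    (as := by intros; apply HomTo.hom_ext; simp)
    (lu := by intros; apply HomTo.hom_ext; simp)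
    (ru := by intros; apply HomTo.hom_ext; simp)

end CatValued

section ExtraTo

variable {V : Type u} [Bicategory.{w, v} V] [Bicategory.Strict V] [GrayMonoid V] [Braiding V]
  [RightClosedData V] {B : VBicatData.{w, v, u, u₁} V}

namespace Coend

variable (P : VPsfData (B.op.tensor B) (selfEnriched V))

/-- The object `P(a, b)` of `V`, for a `V`-pseudofunctor `P : B^op ⊗ B ⟶ V`. -/
def ob (a b : B.Obj) : V := P.obj (a, b)

/-- The partial functors `P_{-c} : B(a, b) ⟶ [P(b, c), P(a, c)]` and
`P_{a-} : B(b, c) ⟶ [P(a, b), P(a, c)]`, with their unit, multiplication and exchange cells. -/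
def L (a b c : B.Obj) : B.Hom a b ⟶ iho (ob P b c) (ob P a c) := P.left b a c
def R (a b c : B.Obj) : B.Hom b c ⟶ iho (ob P a b) (ob P a c) := P.right a b c

def LUnit (b c : B.Obj) : iunit (ob P b c) ≅ B.u b ≫ L P b b c := P.leftUnit b c
def RUnit (a b : B.Obj) : iunit (ob P a b) ≅ B.u b ≫ R P a b b := P.rightUnit a b

def LMult (a b c d : B.Obj) :
    L P a b d ⊠ᵣ B.Hom b c ≫ iho (ob P b d) (ob P a d) ⊠ₗ L P b c d ≫
      icomp (ob P c d) (ob P b d) (ob P a d) ≅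
    (β (B.Hom a b) (B.Hom b c) ≫ B.m a b c) ≫ L P a c d := P.leftMult c b a d
def RMult (a b c d : B.Obj) :
    R P a c d ⊠ᵣ B.Hom b c ≫ iho (ob P a c) (ob P a d) ⊠ₗ R P a b c ≫
      icomp (ob P a b) (ob P a c) (ob P a d) ≅
    B.m b c d ≫ R P a b d := P.rightMult a b c d

def Exch (a b c d : B.Obj) :
    R P c a b ⊠ᵣ B.Hom c d ≫ iho (ob P c a) (ob P c b) ⊠ₗ L P c d a ≫
      icomp (ob P d a) (ob P c a) (ob P c b) ≅
    β (B.Hom a b) (B.Hom c d) ≫ L P c d b ⊠ᵣ B.Hom a b ≫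
      iho (ob P d b) (ob P c b) ⊠ₗ R P d a b ≫ icomp (ob P d a) (ob P d b) (ob P c b) :=
  P.exch d c a b

end Coend

open Coend

/-- The data of an extra-pseudonatural transformation `P ⇒ x`: 1-cells `P(b, b) ⟶ x` and invertible
2-cells `P_{-a} ≫ (i_a)_* ≅ P_{b-} ≫ (i_b)_*` between 1-cells `B(a, b) ⟶ [P(b, a), x]`, where
`f_* = [-, f]`. -/
structure ExtraToData (P : VPsfData (B.op.tensor B) (selfEnriched V)) (x : V) where
  app (b : B.Obj) : ob P b b ⟶ x
  cell (a b : B.Obj) : L P a b a ≫ ihm (ob P b a) (app a) ≅ R P b a b ≫ ihm (ob P b a) (app b)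

namespace ExtraToData

variable {P : VPsfData (B.op.tensor B) (selfEnriched V)} {x y : V}

/-- The unit and functoriality axioms of an extra-pseudonatural transformation. -/
structure IsExtra (i : ExtraToData P x) : Prop where
  unit (b : B.Obj) :
    Iso.refl (iunit (ob P b b) ≫ ihm (ob P b b) (i.app b)) =
    icast (cwr (LUnit P b b) (ihm (ob P b b) (i.app b)) ⊚ cwl (B.u b) (i.cell b b) ⊚
      cwr (RUnit P b b).symm (ihm (ob P b b) (i.app b)))
  functoriality (a b c : B.Obj) :
    Iso.refl (L P a b a ⊠ᵣ B.Hom b c ≫ iho (ob P b a) (ob P a a) ⊠ₗ L P b c a ≫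
        icomp (ob P c a) (ob P b a) (ob P a a) ≫ ihm (ob P c a) (i.app a)) ⊚
      cwr (LMult P a b c a) (ihm (ob P c a) (i.app a)) ⊚
      cwl (β (B.Hom a b) (B.Hom b c) ≫ B.m a b c) (i.cell a c) ⊚
      cw (β (B.Hom a b) (B.Hom b c)) (RMult P c a b c).symm (ihm (ob P c a) (i.app c)) =
    icast (
      Iso.refl (L P a b a ⊠ᵣ B.Hom b c ≫ iho (ob P b a) (ob P a a) ⊠ₗ L P b c a ≫
        icomp (ob P c a) (ob P b a) (ob P a a) ≫ ihm (ob P c a) (i.app a)) ⊚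
      cwl (L P a b a ⊠ᵣ B.Hom b c ≫ₑ iho (ob P b a) (ob P a a) ⊠ₗ L P b c a)
        (icompPost (ob P c a) (ob P b a) (i.app a)) ⊚
      cw (L P a b a ⊠ᵣ B.Hom b c) (inter (ihm (ob P b a) (i.app a)) (L P b c a))
        (icomp (ob P c a) (ob P b a) x) ⊚
      cwr (rI (i.cell a b) (B.Hom b c))
        (iho (ob P b a) x ⊠ₗ L P b c a ≫ₑ icomp (ob P c a) (ob P b a) x) ⊚
      cw (R P b a b ⊠ᵣ B.Hom b c) (inter (ihm (ob P b a) (i.app b)) (L P b c a)).symm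
        (icomp (ob P c a) (ob P b a) x) ⊚
      cwl (R P b a b ⊠ᵣ B.Hom b c ≫ₑ iho (ob P b a) (ob P b b) ⊠ₗ L P b c a)
        (icompPost (ob P c a) (ob P b a) (i.app b)).symm ⊚
      cwr (Exch P a b b c) (ihm (ob P c a) (i.app b)) ⊚
      cwl (β (B.Hom a b) (B.Hom b c) ≫ₑ L P b c b ⊠ᵣ B.Hom a b ≫ₑ
          iho (ob P c b) (ob P b b) ⊠ₗ R P c a b)
        (icompPost (ob P c a) (ob P c b) (i.app b)) ⊚
      cw (β (B.Hom a b) (B.Hom b c) ≫ₑ L P b c b ⊠ᵣ B.Hom a b)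
        (inter (ihm (ob P c b) (i.app b)) (R P c a b)) (icomp (ob P c a) (ob P c b) x) ⊚
      cw (β (B.Hom a b) (B.Hom b c)) (rI (i.cell b c) (B.Hom a b))
        (iho (ob P c b) x ⊠ₗ R P c a b ≫ₑ icomp (ob P c a) (ob P c b) x) ⊚
      cw (β (B.Hom a b) (B.Hom b c) ≫ₑ R P c b c ⊠ᵣ B.Hom a b)
        (inter (ihm (ob P c b) (i.app c)) (R P c a b)).symm (icomp (ob P c a) (ob P c b) x) ⊚
      cwl (β (B.Hom a b) (B.Hom b c) ≫ₑ R P c b c ⊠ᵣ B.Hom a b ≫ₑ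
          iho (ob P c b) (ob P c c) ⊠ₗ R P c a b)
        (icompPost (ob P c a) (ob P c b) (i.app c)).symm)

/-- A family of 2-cells `i_b ⟶ j_b` is a morphism of extra-pseudonatural transformations. -/
def IsMod (i j : ExtraToData P x) (Γ : ∀ b, i.app b ⟶ j.app b) : Prop :=
  ∀ a b, (i.cell a b).hom ≫ R P b a b ◁ ihm₂ (ob P b a) (Γ b) =
    L P a b a ◁ ihm₂ (ob P b a) (Γ a) ≫ (j.cell a b).hom

theorem IsMod.id (i : ExtraToData P x) : IsMod i i (fun b => 𝟙 (i.app b)) := by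
  intro a b; simp

theorem IsMod.comp {i j k : ExtraToData P x} {Γ : ∀ b, i.app b ⟶ j.app b}
    {Θ : ∀ b, j.app b ⟶ k.app b} (hΓ : IsMod i j Γ) (hΘ : IsMod j k Θ) :
    IsMod i k (fun b => Γ b ≫ Θ b) := by
  intro a b
  simp only [ihm₂_comp, Bicategory.whiskerLeft_comp, Category.assoc]
  rw [← hΘ a b, reassoc_of% (hΓ a b)]

theorem IsMod.inv {i j : ExtraToData P x} {Γ : ∀ b, i.app b ≅ j.app b}
    (hΓ : IsMod i j (fun b => (Γ b).hom)) : IsMod j i (fun b => (Γ b).inv) := by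
  intro a b
  have h := hΓ a b
  have e (a b : B.Obj) : ihm₂ (ob P b a) (Γ b).hom ≫ ihm₂ (ob P b a) (Γ b).inv = 𝟙 _ := by
    rw [← ihm₂_comp]; simp
  have e' (a b : B.Obj) : ihm₂ (ob P b a) (Γ a).inv ≫ ihm₂ (ob P b a) (Γ a).hom = 𝟙 _ := by
    rw [← ihm₂_comp]; simp
  calc _ = (L P a b a ◁ ihm₂ (ob P b a) (Γ a).inv ≫ L P a b a ◁ ihm₂ (ob P b a) (Γ a).hom) ≫
        (j.cell a b).hom ≫ R P b a b ◁ ihm₂ (ob P b a) (Γ b).inv := by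
        rw [← Bicategory.whiskerLeft_comp, e']; simp
    _ = L P a b a ◁ ihm₂ (ob P b a) (Γ a).inv ≫ (i.cell a b).hom ≫
        (R P b a b ◁ ihm₂ (ob P b a) (Γ b).hom ≫ R P b a b ◁ ihm₂ (ob P b a) (Γ b).inv) := by
        rw [Category.assoc, ← reassoc_of% h]
    _ = _ := by rw [← Bicategory.whiskerLeft_comp, e]; simp

/-- The composite `k ∘ i` of `i : P ⇒ x` with a 1-cell `k : x ⟶ y`. -/
def whisker (i : ExtraToData P x) (k : x ⟶ y) : ExtraToData P y where
  app b := i.app b ≫ k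
  cell a b := whiskerLeftIso (L P a b a) (ihComp (ob P b a) (i.app a) k) ⊚
    cwr (i.cell a b) (ihm (ob P b a) k) ⊚
    whiskerLeftIso (R P b a b) (ihComp (ob P b a) (i.app b) k).symm

end ExtraToData

/-- Extra-pseudonatural transformations `P ⇒ x`; they form the category `V-PsNat^e(P, x)`. -/
structure ExtraTo (P : VPsfData (B.op.tensor B) (selfEnriched V)) (x : V)
    extends ExtraToData P x where
  isExtra : toExtraToData.IsExtra

namespace ExtraTo

variable {P : VPsfData (B.op.tensor B) (selfEnriched V)} {x y : V}

/-- Morphisms of extra-pseudonatural transformations. -/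
@[ext] structure Hom (i j : ExtraTo P x) where
  app (b : B.Obj) : i.app b ⟶ j.app b
  isMod : i.IsMod j.toExtraToData app

instance : Category (ExtraTo P x) where
  Hom i j := Hom i j
  id i := ⟨fun b => 𝟙 (i.app b), .id _⟩
  comp Γ Θ := ⟨fun b => Γ.app b ≫ Θ.app b, Γ.isMod.comp Θ.isMod⟩
  id_comp _ := Hom.ext (by simp)
  comp_id _ := Hom.ext (by simp)
  assoc _ _ _ := Hom.ext (by simp)

@[ext] theorem hom_ext {i j : ExtraTo P x} {Γ Θ : i ⟶ j} (h : ∀ b, Hom.app Γ b = Hom.app Θ b) :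
    Γ = Θ := Hom.ext (funext h)

@[simp] theorem id_app (i : ExtraTo P x) (b : B.Obj) : Hom.app (𝟙 i) b = 𝟙 (i.app b) := rfl

@[simp] theorem comp_app {i j k : ExtraTo P x} (Γ : i ⟶ j) (Θ : j ⟶ k) (b : B.Obj) :
    Hom.app (Γ ≫ Θ) b = Hom.app Γ b ≫ Hom.app Θ b := rfl

/-- The closure properties needed for `x ↦ V-PsNat^e(P, x)` to be a pseudofunctor: `k ∘ i` is again
extra-pseudonatural, and whiskerings of 2-cells and the coherence 2-cells of `V` are morphisms. -/
structure WhiskerLaws (P : VPsfData (B.op.tensor B) (selfEnriched V)) : Prop where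
  isExtra {x y : V} (i : ExtraTo P x) (k : x ⟶ y) : (i.whisker k).IsExtra
  map {x y : V} (k : x ⟶ y) {i j : ExtraTo P x} (Γ : i ⟶ j) :
    (i.whisker k).IsMod (j.whisker k) (fun b => Hom.app Γ b ▷ k)
  map₂ {x y : V} {k l : x ⟶ y} (θ : k ⟶ l) (i : ExtraTo P x) :
    (i.whisker k).IsMod (i.whisker l) (fun b => i.app b ◁ θ)
  mapId {x : V} (i : ExtraTo P x) :
    (i.whisker (𝟙 x)).IsMod i.toExtraToData (fun b => (ρ_ (i.app b)).hom)
  mapComp {x y z : V} (k : x ⟶ y) (l : y ⟶ z) (i : ExtraTo P x) :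
    (i.whisker (k ≫ l)).IsMod ((i.whisker k).whisker l) (fun b => (α_ (i.app b) k l).inv)

variable (h : WhiskerLaws P)

/-- Postcomposition with `k : x ⟶ y`, as a functor `V-PsNat^e(P, x) ⥤ V-PsNat^e(P, y)`. -/
def post (k : x ⟶ y) : ExtraTo P x ⥤ ExtraTo P y where
  obj i := ⟨i.whisker k, h.isExtra i k⟩
  map Γ := ⟨fun b => Hom.app Γ b ▷ k, h.map k Γ⟩
  map_id _ := hom_ext fun _ => Bicategory.id_whiskerRight _ _
  map_comp _ _ := hom_ext fun _ => Bicategory.comp_whiskerRight _ _ _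

/-- An isomorphism of extra-pseudonatural transformations from an invertible morphism. -/
def isoMk {i j : ExtraTo P x} (Γ : ∀ b, i.app b ≅ j.app b)
    (hΓ : i.IsMod j.toExtraToData (fun b => (Γ b).hom)) : i ≅ j where
  hom := ⟨fun b => (Γ b).hom, hΓ⟩
  inv := ⟨fun b => (Γ b).inv, hΓ.inv⟩
  hom_inv_id := hom_ext fun b => by simp
  inv_hom_id := hom_ext fun b => by simp

/-- The pseudofunctor `x ↦ V-PsNat^e(P, x)`, acting by postcomposition. -/
def pseudofunctor : V ⥤ᵖ Cat.{max u₁ w, max u₁ v w} :=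
  mkCatPseudofunctor (fun x => ExtraTo P x)
    (act := fun k => post h k)
    (act₂ := fun θ =>
      { app := fun i => ⟨fun b => i.app b ◁ θ, h.map₂ θ i⟩
        naturality := fun _ _ Γ => hom_ext fun b => (whisker_exchange (Hom.app Γ b) θ).symm })
    (actId := fun x => NatIso.ofComponents
      (fun i => isoMk (fun b => ρ_ (i.app b)) (h.mapId i))
      (fun Γ => hom_ext fun b => rightUnitor_naturality (Hom.app Γ b)))
    (actComp := fun k l => NatIso.ofComponents
      (fun i => isoMk (fun b => (α_ (i.app b) k l).symm) (h.mapComp k l i))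
      (fun Γ => hom_ext fun b => associator_inv_naturality_left (Hom.app Γ b) k l))
    (id := fun k i => hom_ext fun b => Bicategory.whiskerLeft_id (i.app b) k)
    (comp := fun θ κ i => hom_ext fun b => Bicategory.whiskerLeft_comp (i.app b) θ κ)
    (wl := fun k l l' θ i => hom_ext fun b => (by simp : i.app b ◁ (k ◁ θ) =
      (α_ (i.app b) k l).inv ≫ (i.app b ≫ k) ◁ θ ≫ (α_ (i.app b) k l').hom))
    (wr := fun {_ _ _ k k'} θ l i => hom_ext fun b => (by simp : i.app b ◁ (θ ▷ l) =
      (α_ (i.app b) k l).inv ≫ (i.app b ◁ θ) ▷ l ≫ (α_ (i.app b) k' l).hom))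
    (as := fun k l m i => hom_ext fun b => (by simp : i.app b ◁ (α_ k l m).hom =
      (α_ (i.app b) (k ≫ l) m).inv ≫ (α_ (i.app b) k l).inv ▷ m ≫ (α_ (i.app b ≫ k) l m).hom ≫
        (α_ (i.app b) k (l ≫ m)).hom))
    (lu := fun {x _} k i => hom_ext fun b => (by simp : i.app b ◁ (λ_ k).hom =
      (α_ (i.app b) (𝟙 x) k).inv ≫ (ρ_ (i.app b)).hom ▷ k))
    (ru := fun {_ y} k i => hom_ext fun b => (by simp : i.app b ◁ (ρ_ k).hom =
      (α_ (i.app b) k (𝟙 y)).inv ≫ (ρ_ (i.app b ≫ k)).hom))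

end ExtraTo

/-- `(c, i)` is a bicoend of `P`. -/
structure IsBicoend {P : VPsfData (B.op.tensor B) (selfEnriched V)} {c : V}
    (i : ExtraTo P c) : Prop where
  exists_factor {x : V} (j : ExtraTo P x) :
    ∃ (k : c ⟶ x) (J : ∀ b, i.app b ≫ k ≅ j.app b),
      (i.whisker k).IsMod j.toExtraToData (fun b => (J b).hom)
  existsUnique_cell {x : V} (k l : c ⟶ x) (Γ : ∀ b, i.app b ≫ k ⟶ i.app b ≫ l)
    (hΓ : (i.whisker k).IsMod (i.whisker l) Γ) : ∃! γ : k ⟶ l, ∀ b, Γ b = i.app b ◁ γ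

end ExtraTo

/-- A syllepsis: an invertible modification `σ A B : β_{A,B} ≫ β_{B,A} ≅ 1`, compatible with the
two hexagon modifications of the braiding. -/
class Syllepsis (V : Type u) [Bicategory.{w, v} V] [Bicategory.Strict V] [GrayMonoid V]
    [Braiding V] where
  σ (A B : V) : β A B ≫ β B A ≅ 𝟙 (A ⊠ B)
  σ_naturality₁ {A A' : V} (f : A ⟶ A') (B : V) :
    Iso.refl (f ⊠ᵣ B ≫ β A' B ≫ β B A') ⊚ cwr (brL f B) (β B A') ⊚ cwl (β A B) (brR B f) ⊚
      cwr (σ A B) (f ⊠ᵣ B) =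
    icast (Iso.refl (f ⊠ᵣ B ≫ β A' B ≫ β B A') ⊚ cwl (f ⊠ᵣ B) (σ A' B))
  σ_naturality₂ (A : V) {B B' : V} (g : B ⟶ B') :
    Iso.refl (A ⊠ₗ g ≫ β A B' ≫ β B' A) ⊚ cwr (brR A g) (β B' A) ⊚ cwl (β A B) (brL g A) ⊚
      cwr (σ A B) (A ⊠ₗ g) =
    icast (Iso.refl (A ⊠ₗ g ≫ β A B' ≫ β B' A) ⊚ cwl (A ⊠ₗ g) (σ A B'))
  σ_brRR (A B C : V) :
    σ A (B ⊠ C) =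
    icast (cwr (brRR A B C) (β (B ⊠ C) A) ⊚ cwl (β A B ⊠ᵣ C ≫ₑ B ⊠ₗ β A C) (brSS B C A) ⊚
      cw (β A B ⊠ᵣ C) (lI B (σ A C)) (β B A ⊠ᵣ C) ⊚ cw₀ (rI (σ A B) C))
  σ_brSS (A B C : V) :
    σ (A ⊠ B) C =
    icast (cwr (brSS A B C) (β C (A ⊠ B)) ⊚ cwl (A ⊠ₗ β B C ≫ₑ β A C ⊠ᵣ B) (brRR C A B) ⊚
      cw (A ⊠ₗ β B C) (rI (σ A C) B) (A ⊠ₗ β C B) ⊚ cw₀ (lI A (σ B C)))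

/-- Inverting an exchange cell by means of the syllepsis. -/
def exchInv {V : Type u} [Bicategory.{w, v} V] [Bicategory.Strict V] [GrayMonoid V] [Braiding V]
    [Syllepsis V] {S T Z : V} {F : S ⊠ T ⟶ Z} {G : T ⊠ S ⟶ Z} (e : G ≅ β T S ≫ F) :
    F ≅ β S T ≫ G :=
  (λ_ F).symm ≪≫ whiskerRightIso (Syllepsis.σ S T).symm F ≪≫ α_ (β S T) (β T S) F ≪≫
    whiskerLeftIso (β S T) e.symm

section ExtraFrom

variable {V : Type u} [Bicategory.{w, v} V] [Bicategory.Strict V] [GrayMonoid V] [Braiding V]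
  [RightClosedData V] {B : VBicatData.{w, v, u, u₁} V}

/-- The partial functors of a `V`-valued functor of a covariant variable `a` and a contravariant
variable `b` in `B`, with value `ob a b`, acting as `L : B(a, b) ⟶ [ob a c, ob b c]` and
`R : B(a, b) ⟶ [ob c b, ob c a]`, with their unit, multiplication and exchange cells. -/
structure Partials (B : VBicatData.{w, v, u, u₁} V) where
  ob (a b : B.Obj) : V
  L (a b c : B.Obj) : B.Hom a b ⟶ iho (ob a c) (ob b c)
  R (a b c : B.Obj) : B.Hom a b ⟶ iho (ob c b) (ob c a)
  LUnit (a b : B.Obj) : iunit (ob a b) ≅ B.u a ≫ L a a b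
  RUnit (a b : B.Obj) : iunit (ob a b) ≅ B.u b ≫ R b b a
  LMult (a b c d : B.Obj) :
    L b c d ⊠ᵣ B.Hom a b ≫ iho (ob b d) (ob c d) ⊠ₗ L a b d ≫ icomp (ob a d) (ob b d) (ob c d) ≅
      B.m a b c ≫ L a c d
  RMult (a b c d : B.Obj) :
    R a b d ⊠ᵣ B.Hom b c ≫ iho (ob d b) (ob d a) ⊠ₗ R b c d ≫ icomp (ob d c) (ob d b) (ob d a) ≅
      (β (B.Hom a b) (B.Hom b c) ≫ B.m a b c) ≫ R a c d
  Exch (a b c d : B.Obj) :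
    R a b d ⊠ᵣ B.Hom c d ≫ iho (ob d b) (ob d a) ⊠ₗ L c d b ≫ icomp (ob c b) (ob d b) (ob d a) ≅
      β (B.Hom a b) (B.Hom c d) ≫ L c d a ⊠ᵣ B.Hom a b ≫
        iho (ob c a) (ob d a) ⊠ₗ R a b c ≫ icomp (ob c b) (ob c a) (ob d a)

/-- The partial functors of a `V`-pseudofunctor `B ⊗ B^op ⟶ V`. -/
def VPsfData.partials (P : VPsfData (B.tensor B.op) (selfEnriched V)) : Partials B where
  ob a b := P.obj (a, b)
  L a b c := P.left a b c
  R a b c := P.right c b a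
  LUnit a b := P.leftUnit a b
  RUnit a b := P.rightUnit a b
  LMult a b c d := P.leftMult a b c d
  RMult a b c d := P.rightMult d c b a
  Exch a b c d := P.exch c d b a

/-- The partial functors of a `V`-pseudofunctor `B^op ⊗ B ⟶ V`; here the contravariant variable
comes first, so that the exchange cell involves the syllepsis. -/
def VPsfData.partialsOp [Syllepsis V] (P : VPsfData (B.op.tensor B) (selfEnriched V)) :
    Partials B where
  ob a b := P.obj (b, a)
  L a b c := P.right c a b
  R a b c := P.left b a c
  LUnit a b := P.rightUnit b a
  RUnit a b := P.leftUnit b a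
  LMult a b c d := P.rightMult d a b c
  RMult a b c d := P.leftMult c b a d
  Exch a b c d := exchInv (P.exch b a c d)

open Partials

/-- The data of an extra-pseudonatural transformation `x ⇒ P`: 1-cells `i_b : x ⟶ ob b b` and
invertible 2-cells `R ≫ (i_b)^* ≅ L ≫ (i_a)^*` between 1-cells `B(a, b) ⟶ [x, ob b a]`, where
`f^* = [f, -]`. -/
structure ExtraFromData (x : V) (P : Partials B) where
  app (b : B.Obj) : x ⟶ ob P b b
  cell (a b : B.Obj) : R P a b b ≫ ipre (app b) (ob P b a) ≅ L P a b a ≫ ipre (app a) (ob P b a)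

namespace ExtraFromData

variable {P : Partials B} {x y : V}

/-- The unit and functoriality axioms of an extra-pseudonatural transformation. -/
structure IsExtra (i : ExtraFromData x P) : Prop where
  unit (b : B.Obj) :
    Iso.refl (iunit (ob P b b) ≫ ipre (i.app b) (ob P b b)) =
    icast (cwr (RUnit P b b) (ipre (i.app b) (ob P b b)) ⊚ cwl (B.u b) (i.cell b b) ⊚
      cwr (LUnit P b b).symm (ipre (i.app b) (ob P b b)))
  functoriality (a b c : B.Obj) :
    Iso.refl (R P a b c ⊠ᵣ B.Hom b c ≫ iho (ob P c b) (ob P c a) ⊠ₗ R P b c c ≫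
        icomp (ob P c c) (ob P c b) (ob P c a) ≫ ipre (i.app c) (ob P c a)) ⊚
      cwr (RMult P a b c c) (ipre (i.app c) (ob P c a)) ⊚
      cwl (β (B.Hom a b) (B.Hom b c) ≫ B.m a b c) (i.cell a c) ⊚
      cw (β (B.Hom a b) (B.Hom b c)) (LMult P a b c a).symm (ipre (i.app a) (ob P c a)) =
    icast (
      Iso.refl (R P a b c ⊠ᵣ B.Hom b c ≫ iho (ob P c b) (ob P c a) ⊠ₗ R P b c c ≫
        icomp (ob P c c) (ob P c b) (ob P c a) ≫ ipre (i.app c) (ob P c a)) ⊚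
      cwl (R P a b c ⊠ᵣ B.Hom b c ≫ₑ iho (ob P c b) (ob P c a) ⊠ₗ R P b c c)
        (icompPre (i.app c) (ob P c b) (ob P c a)) ⊚
      cw (R P a b c ⊠ᵣ B.Hom b c) (lI (iho (ob P c b) (ob P c a)) (i.cell b c))
        (icomp x (ob P c b) (ob P c a)) ⊚
      cwl (R P a b c ⊠ᵣ B.Hom b c ≫ₑ iho (ob P c b) (ob P c a) ⊠ₗ L P b c b)
        (icompPre (i.app b) (ob P c b) (ob P c a)).symm ⊚
      cwr (Exch P a b b c) (ipre (i.app b) (ob P c a)) ⊚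
      cwl (β (B.Hom a b) (B.Hom b c) ≫ₑ L P b c a ⊠ᵣ B.Hom a b ≫ₑ
          iho (ob P b a) (ob P c a) ⊠ₗ R P a b b)
        (icompPre (i.app b) (ob P b a) (ob P c a)) ⊚
      cw (β (B.Hom a b) (B.Hom b c) ≫ₑ L P b c a ⊠ᵣ B.Hom a b)
        (lI (iho (ob P b a) (ob P c a)) (i.cell a b)) (icomp x (ob P b a) (ob P c a)) ⊚
      cwl (β (B.Hom a b) (B.Hom b c) ≫ₑ L P b c a ⊠ᵣ B.Hom a b ≫ₑ
          iho (ob P b a) (ob P c a) ⊠ₗ L P a b a)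
        (icompPre (i.app a) (ob P b a) (ob P c a)).symm)

/-- A family of 2-cells `i_b ⟶ j_b` is a morphism of extra-pseudonatural transformations. -/
def IsMod (i j : ExtraFromData x P) (Γ : ∀ b, i.app b ⟶ j.app b) : Prop :=
  ∀ a b, (i.cell a b).hom ≫ L P a b a ◁ ipre₂ (Γ a) (ob P b a) =
    R P a b b ◁ ipre₂ (Γ b) (ob P b a) ≫ (j.cell a b).hom

theorem IsMod.id (i : ExtraFromData x P) : IsMod i i (fun b => 𝟙 (i.app b)) := by
  intro a b; simp

theorem IsMod.comp {i j k : ExtraFromData x P} {Γ : ∀ b, i.app b ⟶ j.app b}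
    {Θ : ∀ b, j.app b ⟶ k.app b} (hΓ : IsMod i j Γ) (hΘ : IsMod j k Θ) :
    IsMod i k (fun b => Γ b ≫ Θ b) := by
  intro a b
  simp only [ipre₂_comp, Bicategory.whiskerLeft_comp, Category.assoc]
  rw [← hΘ a b, reassoc_of% (hΓ a b)]

theorem IsMod.inv {i j : ExtraFromData x P} {Γ : ∀ b, i.app b ≅ j.app b}
    (hΓ : IsMod i j (fun b => (Γ b).hom)) : IsMod j i (fun b => (Γ b).inv) := by
  intro a b
  have h := hΓ a b
  have e (a b c : B.Obj) : ipre₂ (Γ a).hom (ob P b c) ≫ ipre₂ (Γ a).inv (ob P b c) = 𝟙 _ := by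
    rw [← ipre₂_comp]; simp
  have e' (a b c : B.Obj) : ipre₂ (Γ a).inv (ob P b c) ≫ ipre₂ (Γ a).hom (ob P b c) = 𝟙 _ := by
    rw [← ipre₂_comp]; simp
  calc _ = (R P a b b ◁ ipre₂ (Γ b).inv (ob P b a) ≫ R P a b b ◁ ipre₂ (Γ b).hom (ob P b a)) ≫
        (j.cell a b).hom ≫ L P a b a ◁ ipre₂ (Γ a).inv (ob P b a) := by
        rw [← Bicategory.whiskerLeft_comp, e']; simp
    _ = R P a b b ◁ ipre₂ (Γ b).inv (ob P b a) ≫ (i.cell a b).hom ≫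
        (L P a b a ◁ ipre₂ (Γ a).hom (ob P b a) ≫ L P a b a ◁ ipre₂ (Γ a).inv (ob P b a)) := by
        rw [Category.assoc, ← reassoc_of% h]
    _ = _ := by rw [← Bicategory.whiskerLeft_comp, e]; simp

/-- The composite `i ∘ k` of a 1-cell `k : y ⟶ x` with `i : x ⇒ P`. -/
def whisker (i : ExtraFromData x P) (k : y ⟶ x) : ExtraFromData y P where
  app b := k ≫ i.app b
  cell a b := whiskerLeftIso (R P a b b) (ipreComp k (i.app b) (ob P b a)) ⊚
    cwr (i.cell a b) (ipre k (ob P b a)) ⊚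
    whiskerLeftIso (L P a b a) (ipreComp k (i.app a) (ob P b a)).symm

end ExtraFromData

/-- Extra-pseudonatural transformations `x ⇒ P`; they form the category `V-PsNat^e(x, P)`. -/
structure ExtraFrom (x : V) (P : Partials B)
    extends ExtraFromData x P where
  isExtra : toExtraFromData.IsExtra

namespace ExtraFrom

variable {P : Partials B} {x y : V}

/-- Morphisms of extra-pseudonatural transformations. -/
@[ext] structure Hom (i j : ExtraFrom x P) where
  app (b : B.Obj) : i.app b ⟶ j.app b
  isMod : i.IsMod j.toExtraFromData app

instance : Category (ExtraFrom x P) where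
  Hom i j := Hom i j
  id i := ⟨fun b => 𝟙 (i.app b), .id _⟩
  comp Γ Θ := ⟨fun b => Γ.app b ≫ Θ.app b, Γ.isMod.comp Θ.isMod⟩
  id_comp _ := Hom.ext (by simp)
  comp_id _ := Hom.ext (by simp)
  assoc _ _ _ := Hom.ext (by simp)

@[ext] theorem hom_ext {i j : ExtraFrom x P} {Γ Θ : i ⟶ j} (h : ∀ b, Hom.app Γ b = Hom.app Θ b) :
    Γ = Θ := Hom.ext (funext h)

@[simp] theorem id_app (i : ExtraFrom x P) (b : B.Obj) : Hom.app (𝟙 i) b = 𝟙 (i.app b) := rfl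

@[simp] theorem comp_app {i j k : ExtraFrom x P} (Γ : i ⟶ j) (Θ : j ⟶ k) (b : B.Obj) :
    Hom.app (Γ ≫ Θ) b = Hom.app Γ b ≫ Hom.app Θ b := rfl

/-- The closure properties needed for `x ↦ V-PsNat^e(x, P)` to be a pseudofunctor: `i ∘ k` is again
extra-pseudonatural, and whiskerings of 2-cells and the coherence 2-cells of `V` are morphisms. -/
structure WhiskerLaws (P : Partials B) : Prop where
  isExtra {x y : V} (i : ExtraFrom x P) (k : y ⟶ x) : (i.whisker k).IsExtra
  map {x y : V} (k : y ⟶ x) {i j : ExtraFrom x P} (Γ : i ⟶ j) :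
    (i.whisker k).IsMod (j.whisker k) (fun b => k ◁ Hom.app Γ b)
  map₂ {x y : V} {k l : y ⟶ x} (θ : k ⟶ l) (i : ExtraFrom x P) :
    (i.whisker k).IsMod (i.whisker l) (fun b => θ ▷ i.app b)
  mapId {x : V} (i : ExtraFrom x P) :
    (i.whisker (𝟙 x)).IsMod i.toExtraFromData (fun b => (λ_ (i.app b)).hom)
  mapComp {x y z : V} (l : z ⟶ y) (k : y ⟶ x) (i : ExtraFrom x P) :
    (i.whisker (l ≫ k)).IsMod ((i.whisker k).whisker l) (fun b => (α_ l k (i.app b)).hom)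

variable (h : WhiskerLaws P)

/-- Precomposition with `k : y ⟶ x`, as a functor `V-PsNat^e(x, P) ⥤ V-PsNat^e(y, P)`. -/
def pre (k : y ⟶ x) : ExtraFrom x P ⥤ ExtraFrom y P where
  obj i := ⟨i.whisker k, h.isExtra i k⟩
  map Γ := ⟨fun b => k ◁ Hom.app Γ b, h.map k Γ⟩
  map_id _ := hom_ext fun _ => Bicategory.whiskerLeft_id _ _
  map_comp _ _ := hom_ext fun _ => Bicategory.whiskerLeft_comp _ _ _

/-- An isomorphism of extra-pseudonatural transformations from an invertible morphism. -/
def isoMk {i j : ExtraFrom x P} (Γ : ∀ b, i.app b ≅ j.app b)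
    (hΓ : i.IsMod j.toExtraFromData (fun b => (Γ b).hom)) : i ≅ j where
  hom := ⟨fun b => (Γ b).hom, hΓ⟩
  inv := ⟨fun b => (Γ b).inv, hΓ.inv⟩
  hom_inv_id := hom_ext fun b => by simp
  inv_hom_id := hom_ext fun b => by simp

/-- The pseudofunctor `x ↦ V-PsNat^e(x, P)`, acting by precomposition. -/
def pseudofunctor : Vᵒᵖ ⥤ᵖ Cat.{max u₁ w, max u₁ v w} :=
  mkCatPseudofunctor (fun x => ExtraFrom (unop x) P)
    (act := fun k => pre h k.unop)
    (act₂ := fun θ =>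
      { app := fun i => ⟨fun b => θ.unop2 ▷ i.app b, h.map₂ θ.unop2 i⟩
        naturality := fun _ _ Γ => hom_ext fun b => (whisker_exchange θ.unop2 (Hom.app Γ b)) })
    (actId := fun x => NatIso.ofComponents
      (fun i => isoMk (fun b => λ_ (i.app b)) (h.mapId i))
      (fun Γ => hom_ext fun b => leftUnitor_naturality (Hom.app Γ b)))
    (actComp := fun k l => NatIso.ofComponents
      (fun i => isoMk (fun b => α_ l.unop k.unop (i.app b)) (h.mapComp l.unop k.unop i))
      (fun Γ => hom_ext fun b => associator_naturality_right l.unop k.unop (Hom.app Γ b)))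
    (id := fun k i => hom_ext fun b => Bicategory.id_whiskerRight k.unop (i.app b))
    (comp := fun θ κ i => hom_ext fun b =>
      Bicategory.comp_whiskerRight θ.unop2 κ.unop2 (i.app b))
    (wl := fun k l l' θ i => hom_ext fun b => (by simp : (θ.unop2 ▷ k.unop) ▷ i.app b =
      (α_ l.unop k.unop (i.app b)).hom ≫ θ.unop2 ▷ (k.unop ≫ i.app b) ≫
        (α_ l'.unop k.unop (i.app b)).inv))
    (wr := fun {_ _ _ k k'} θ l i => hom_ext fun b => (by simp : (l.unop ◁ θ.unop2) ▷ i.app b =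
      (α_ l.unop k.unop (i.app b)).hom ≫ l.unop ◁ (θ.unop2 ▷ i.app b) ≫
        (α_ l.unop k'.unop (i.app b)).inv))
    (as := fun k l m i => hom_ext fun b => (by simp :
      (α_ m.unop l.unop k.unop).inv ▷ i.app b =
      (α_ m.unop (l.unop ≫ k.unop) (i.app b)).hom ≫ m.unop ◁ (α_ l.unop k.unop (i.app b)).hom ≫
        (α_ m.unop l.unop (k.unop ≫ i.app b)).inv ≫ (α_ (m.unop ≫ l.unop) k.unop (i.app b)).inv))
    (lu := fun {x _} k i => hom_ext fun b => (by simp : (ρ_ k.unop).hom ▷ i.app b =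
      (α_ k.unop (𝟙 (unop x)) (i.app b)).hom ≫ k.unop ◁ (λ_ (i.app b)).hom))
    (ru := fun {_ y} k i => hom_ext fun b => (by simp : (λ_ k.unop).hom ▷ i.app b =
      (α_ (𝟙 (unop y)) k.unop (i.app b)).hom ≫ (λ_ (k.unop ≫ i.app b)).hom))

end ExtraFrom

/-- `(e, i)` is a biend of `P`. -/
structure IsBiend {P : Partials B} {e : V}
    (i : ExtraFrom e P) : Prop where
  exists_factor {x : V} (j : ExtraFrom x P) :
    ∃ (k : x ⟶ e) (J : ∀ b, k ≫ i.app b ≅ j.app b),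
      (i.whisker k).IsMod j.toExtraFromData (fun b => (J b).hom)
  existsUnique_cell {x : V} (k l : x ⟶ e) (Γ : ∀ b, k ≫ i.app b ⟶ l ≫ i.app b)
    (hΓ : (i.whisker k).IsMod (i.whisker l) Γ) : ∃! γ : k ⟶ l, ∀ b, Γ b = γ ▷ i.app b

end ExtraFrom

section Representing

variable {V : Type u} [Bicategory.{w, v} V] [Bicategory.Strict V] [GrayMonoid V] [Braiding V]
  [RightClosedData V] {B : VBicatData.{w, v, u, u₁} V}

/-- Precomposition with `i : P ⇒ c`, as a functor `V(c, x) ⥤ V-PsNat^e(P, x)`: `k ↦ k ∘ i` on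
1-cells and `γ ↦ (i_b ◁ γ)_b` on 2-cells. -/
def ExtraTo.precompFunctor {P : VPsfData (B.op.tensor B) (selfEnriched V)}
    (h : ExtraTo.WhiskerLaws P) {c : V} (i : ExtraTo P c) (x : V) :
    HomTo.{w, v, u, max u₁ w} c x ⥤ ExtraTo P x where
  obj k := ⟨i.whisker k.hom, h.isExtra i k.hom⟩
  map γ := ⟨fun b => i.app b ◁ HomTo.Cell.cell γ, h.map₂ (HomTo.Cell.cell γ) i⟩
  map_id k := hom_ext fun b => Bicategory.whiskerLeft_id (i.app b) k.hom
  map_comp _ _ := hom_ext fun b => Bicategory.whiskerLeft_comp (i.app b) _ _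

/-- Precomposition with `i : P ⇒ c` is pseudonatural in `x`. -/
def ExtraTo.precomp {P : VPsfData (B.op.tensor B) (selfEnriched V)} (h : ExtraTo.WhiskerLaws P)
    {c : V} (i : ExtraTo P c) :
    Pseudofunctor.StrongTrans (repTo.{w, v, u, max u₁ w} c) (ExtraTo.pseudofunctor h) where
  app x := (precompFunctor h i x).toCatHom
  naturality {x y} k := Cat.Hom.isoMk
    (F := (((repTo.{w, v, u, max u₁ w} c).map k).toFunctor ⋙ precompFunctor h i y))
    (G := (precompFunctor h i x ⋙ post h k))
    (NatIso.ofComponents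
      (fun f => isoMk (fun b => (α_ (i.app b) f.hom k).symm) (h.mapComp f.hom k i))
      (fun γ => hom_ext fun b => (by simp : i.app b ◁ (HomTo.Cell.cell γ ▷ k) ≫
        (α_ (i.app b) _ k).inv = (α_ (i.app b) _ k).inv ≫ (i.app b ◁ HomTo.Cell.cell γ) ▷ k)))
  naturality_naturality {x y k l} θ := by
    apply Cat.Hom₂.ext; ext f; apply hom_ext; intro b
    exact (by simp : i.app b ◁ (f.hom ◁ θ) ≫ (α_ (i.app b) f.hom l).inv =
      (α_ (i.app b) f.hom k).inv ≫ (i.app b ≫ f.hom) ◁ θ)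
  naturality_id x := by
    apply Cat.Hom₂.ext; ext f; apply hom_ext; intro b
    exact (by simp : (α_ (i.app b) f.hom (𝟙 x)).inv ≫ (ρ_ (i.app b ≫ f.hom)).hom =
      i.app b ◁ (ρ_ f.hom).hom ≫ 𝟙 _ ≫ 𝟙 _)
  naturality_comp {x y z} k l := by
    apply Cat.Hom₂.ext; ext f; apply hom_ext; intro b
    exact (by simp : (α_ (i.app b) f.hom (k ≫ l)).inv ≫ (α_ (i.app b ≫ f.hom) k l).inv =
      i.app b ◁ (α_ f.hom k l).inv ≫ 𝟙 _ ≫ (α_ (i.app b) (f.hom ≫ k) l).inv ≫ 𝟙 _ ≫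
        (α_ (i.app b) f.hom k).inv ▷ l ≫ 𝟙 _)

/-- Composition with `i : e ⇒ P`, as a functor
`V(x, e) ⥤ V-PsNat^e(x, P)`: `k ↦ i ∘ k` on 1-cells and `γ ↦ (γ ▷ i_b)_b` on 2-cells. -/
def ExtraFrom.postcompFunctor {P : Partials B}
    (h : ExtraFrom.WhiskerLaws P) {e : V} (i : ExtraFrom e P) (x : V) :
    HomTo.{w, v, u, max u₁ w} x e ⥤ ExtraFrom x P where
  obj k := ⟨i.whisker k.hom, h.isExtra i k.hom⟩
  map γ := ⟨fun b => HomTo.Cell.cell γ ▷ i.app b, h.map₂ (HomTo.Cell.cell γ) i⟩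
  map_id k := hom_ext fun b => Bicategory.id_whiskerRight k.hom (i.app b)
  map_comp _ _ := hom_ext fun b => Bicategory.comp_whiskerRight _ _ (i.app b)

/-- Composition with `i : e ⇒ P` is pseudonatural in `x`. -/
def ExtraFrom.postcomp {P : Partials B}
    (h : ExtraFrom.WhiskerLaws P) {e : V} (i : ExtraFrom e P) :
    Pseudofunctor.StrongTrans (repFrom.{w, v, u, max u₁ w} e) (ExtraFrom.pseudofunctor h) where
  app x := (postcompFunctor h i (unop x)).toCatHom
  naturality {x y} k := Cat.Hom.isoMk
    (F := (((repFrom.{w, v, u, max u₁ w} e).map k).toFunctor ⋙ postcompFunctor h i (unop y)))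
    (G := (postcompFunctor h i (unop x) ⋙ pre h k.unop))
    (NatIso.ofComponents
      (fun f => isoMk (fun b => α_ k.unop f.hom (i.app b)) (h.mapComp k.unop f.hom i))
      (fun γ => hom_ext fun b => (by simp : (k.unop ◁ HomTo.Cell.cell γ) ▷ i.app b ≫
        (α_ k.unop _ (i.app b)).hom =
        (α_ k.unop _ (i.app b)).hom ≫ k.unop ◁ (HomTo.Cell.cell γ ▷ i.app b))))
  naturality_naturality {x y k l} θ := by
    apply Cat.Hom₂.ext; ext f; apply hom_ext; intro b
    exact (by simp : (θ.unop2 ▷ f.hom) ▷ i.app b ≫ (α_ l.unop f.hom (i.app b)).hom =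
      (α_ k.unop f.hom (i.app b)).hom ≫ θ.unop2 ▷ (f.hom ≫ i.app b))
  naturality_id x := by
    apply Cat.Hom₂.ext; ext f; apply hom_ext; intro b
    exact (by simp : (α_ (𝟙 (unop x)) f.hom (i.app b)).hom ≫ (λ_ (f.hom ≫ i.app b)).hom =
      (λ_ f.hom).hom ▷ i.app b ≫ 𝟙 _ ≫ 𝟙 _)
  naturality_comp {x y z} k l := by
    apply Cat.Hom₂.ext; ext f; apply hom_ext; intro b
    exact (by simp : (α_ (l.unop ≫ k.unop) f.hom (i.app b)).hom ≫
        (α_ l.unop k.unop (f.hom ≫ i.app b)).hom =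
      (α_ l.unop k.unop f.hom).hom ▷ i.app b ≫ 𝟙 _ ≫ (α_ l.unop (k.unop ≫ f.hom) (i.app b)).hom ≫
        𝟙 _ ≫ l.unop ◁ (α_ k.unop f.hom (i.app b)).hom ≫ 𝟙 _)

/-- The extra-pseudonatural transformation `Φ_c(𝟙 c) : P ⇒ c` that corresponds to a pseudonatural
transformation `Φ : V(c, -) ⇒ V-PsNat^e(P, -)`. -/
def ExtraTo.ofRep {P : VPsfData (B.op.tensor B) (selfEnriched V)} {h : ExtraTo.WhiskerLaws P}
    {c : V} (Φ : Pseudofunctor.StrongTrans (repTo.{w, v, u, max u₁ w} c)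
      (ExtraTo.pseudofunctor h)) : ExtraTo P c :=
  (Φ.app c).toFunctor.obj (show HomTo.{w, v, u, max u₁ w} c c from ⟨𝟙 c⟩)

/-- The extra-pseudonatural transformation `Φ_e(𝟙 e) : e ⇒ P` that corresponds to a pseudonatural
transformation `Φ : V(-, e) ⇒ V-PsNat^e(-, P)`. -/
def ExtraFrom.ofRep {P : Partials B}
    {h : ExtraFrom.WhiskerLaws P} {e : V}
    (Φ : Pseudofunctor.StrongTrans (repFrom.{w, v, u, max u₁ w} e)
      (ExtraFrom.pseudofunctor h)) : ExtraFrom e P :=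
  (Φ.app (op e)).toFunctor.obj (show HomTo.{w, v, u, max u₁ w} e e from ⟨𝟙 e⟩)

end Representing

end

/-! The passage between bicoends and representability is formal. (BC1) says that `k ↦ k ∘ i` is
essentially surjective and (BC2) that it is full and faithful, so `(c, i)` is a bicoend exactly when
precomposition with `i` is an equivalence for every `x` (`ExtraTo.isBicoend_iff`). For an arbitrary
pseudonatural `Φ`, the bicategorical Yoneda lemma gives `k ∘ Φ_c(1) ≅ Φ_x(1 ≫ k) ≅ Φ_x(k)`
(`ExtraTo.ofRepIso`), and being an equivalence is invariant under isomorphism of functors.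

The substance lies in `ExtraTo.whiskerLaws`: composition with 1-cells must preserve the axioms of
extra-pseudonaturality. The structure cell of `k ∘ i` is the cell of `i` whiskered with `[A, k]` and
conjugated by `[A, p ≫ k] ≅ [A, p] ≫ [A, k]` (`postCell`). In the unit axiom the two conjugating
cells slide past the unit cells and cancel. The functoriality axiom also carries cells through
enriched composition, by means of `icompPost` and an interchanger. The key fact is therefore that
`icompPost` for `f ≫ k` is the pasting of those for `f` and for `k` (`icompPost_comp`). Given this,
the axiom for `k ∘ i` is the axiom for `i` whiskered with `[A, k]`, all comparison cells in the
interior cancelling.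

Biends use `[-, C]` in place of `[A, -]`. Its pseudofunctoriality is not part of the closed
structure and has to be proved from the definition by transposition (`ipreComp_assoc`,
`ipreComp_id_left` and the two naturalities of `ipreComp`); `icompPre_comp` then plays the role of
`icompPost_comp`.

All these identities are between 2-cells into an internal hom. Such a 2-cell `γ` is determined by
its transpose `(γ ⊗ A) ▷ ev` (`transpose_injective`), and a 2-cell defined by its transpose does
have that transpose (`transpose_ofTranspose`, which rests on a swallowtail identity). After
transposition only naturality, interchange and cancellation remain. -/

noncomputable section

open GrayMonoid Braiding Coend Partials

attribute [-simp] eqToHom_refl eqToHom_naturality eqToHom_naturality_assoc uncurry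

/-! Normal form for 2-cells of a strict bicategory: associators and unitors become `eqToHom`s,
which are kept apart from the whiskerings and merged with one another. -/

section StrictCalculus

/-- Same content as `eqToHom_refl`, but deliberately not proved by `rfl`, so that `simp` uses it as
a propositional rewrite and not as a definitional one. -/
theorem eqToHom_refl_eq {C : Type u} [Category.{v} C] {X : C} (h : X = X) : eqToHom h = 𝟙 X :=
  eq_of_heq (by rw [eqToHom_refl])

attribute [simp] eqToHom_refl_eq

attribute [simp] Bicategory.Strict.associator_eqToIso Bicategory.Strict.leftUnitor_eqToIso
  Bicategory.Strict.rightUnitor_eqToIso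

variable {V : Type u} [Bicategory.{w, v} V] [Bicategory.Strict V]

/-- Replacing the whiskering 1-cell changes the type of the 2-cell, so the change is recorded by
`eqToHom`s on the boundary. The later rules that expand a whiskering by a composite or by a tensored
1-cell are instances of this one or of its mirror image. -/
theorem whiskerLeft_congr {X Y Z : V} {f f' : X ⟶ Y} (h : f = f') {g g' : Y ⟶ Z} (η : g ⟶ g') :
    f ◁ η = eqToHom (by rw [h]) ≫ f' ◁ η ≫ eqToHom (by rw [h]) := by
  subst h; simp

theorem whiskerRight_congr {X Y Z : V} {f f' : X ⟶ Y} (η : f ⟶ f') {g g' : Y ⟶ Z} (h : g = g') :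
    η ▷ g = eqToHom (by rw [h]) ≫ η ▷ g' ≫ eqToHom (by rw [h]) := by
  subst h; simp

@[simp] theorem eqToHom_refl_whiskerLeft {X Y : V} (h : X = X) {g g' : X ⟶ Y} (η : g ⟶ g') :
    eqToHom h ◁ η = eqToHom (by simp) ≫ η ≫ eqToHom (by simp) := by
  rw [whiskerLeft_congr (eqToHom_refl X h)]; simp

@[simp] theorem whiskerRight_eqToHom_refl {X Y : V} {g g' : X ⟶ Y} (η : g ⟶ g') (h : Y = Y) :
    η ▷ eqToHom h = eqToHom (by simp) ≫ η ≫ eqToHom (by simp) := by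
  rw [whiskerRight_congr η (eqToHom_refl Y h)]; simp

@[simp] theorem icast_hom {X Y : V} {f f' g g' : X ⟶ Y} (η : f' ≅ g') (h : f = f') (h' : g' = g) :
    (icast η h h').hom = eqToHom h ≫ η.hom ≫ eqToHom h' := by simp [icast]

@[simp] theorem icast_inv {X Y : V} {f f' g g' : X ⟶ Y} (η : f' ≅ g') (h : f = f') (h' : g' = g) :
    (icast η h h').inv = eqToHom h'.symm ≫ η.inv ≫ eqToHom h.symm := by simp [icast]

@[simp] theorem vcat_hom {X Y : V} {f g g' k : X ⟶ Y} (η : f ≅ g) (θ : g' ≅ k) (h : g = g') :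
    (vcat η θ h).hom = η.hom ≫ eqToHom h ≫ θ.hom := by simp [vcat]

@[simp] theorem vcat_inv {X Y : V} {f g g' k : X ⟶ Y} (η : f ≅ g) (θ : g' ≅ k) (h : g = g') :
    (vcat η θ h).inv = θ.inv ≫ eqToHom h.symm ≫ η.inv := by simp [vcat]

section

variable {X₀ X Y Y' Z Z' W W₀ : V} (h : X ⟶ Y) {f g : Y' ⟶ Z} (η : f ≅ g) (k : Z' ⟶ W)
    (e₀ : X₀ = X) (e : Y = Y') (e' : Z = Z') (e₁ : W = W₀) (l₀ : X₀ = Y') (r₀ : Z = W₀)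

@[simp] theorem cw_hom : (cw h η k e₀ e e' e₁).hom =
    (eqToHom e₀ ≫ h ≫ eqToHom e) ◁ η.hom ▷ (eqToHom e' ≫ k ≫ eqToHom e₁) := rfl

@[simp] theorem cw_inv : (cw h η k e₀ e e' e₁).inv =
    (eqToHom e₀ ≫ h ≫ eqToHom e) ◁ η.inv ▷ (eqToHom e' ≫ k ≫ eqToHom e₁) := rfl

@[simp] theorem cwl_hom : (cwl h η e₀ e r₀).hom =
    (eqToHom e₀ ≫ h ≫ eqToHom e) ◁ η.hom ▷ eqToHom r₀ := rfl

@[simp] theorem cwl_inv : (cwl h η e₀ e r₀).inv =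
    (eqToHom e₀ ≫ h ≫ eqToHom e) ◁ η.inv ▷ eqToHom r₀ := rfl

@[simp] theorem cwr_hom : (cwr η k l₀ e' e₁).hom =
    eqToHom l₀ ◁ η.hom ▷ (eqToHom e' ≫ k ≫ eqToHom e₁) := rfl

@[simp] theorem cwr_inv : (cwr η k l₀ e' e₁).inv =
    eqToHom l₀ ◁ η.inv ▷ (eqToHom e' ≫ k ≫ eqToHom e₁) := rfl

@[simp] theorem cw₀_hom : (cw₀ η l₀ r₀).hom = eqToHom l₀ ◁ η.hom ▷ eqToHom r₀ := rfl

end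

variable [GrayMonoid V]

@[simp] theorem whiskerLeft_lmap_comp (A : V) {X Y Z W : V} (f : X ⟶ Y) (g : Y ⟶ Z)
    {k k' : A ⊠ Z ⟶ W} (η : k ⟶ k') :
    (A ⊠ₗ (f ≫ g)) ◁ η = eqToHom (by simp) ≫ (A ⊠ₗ f) ◁ (A ⊠ₗ g) ◁ η ≫ eqToHom (by simp) := by
  rw [whiskerLeft_congr (lmap_comp A f g)]; simp

@[simp] theorem whiskerLeft_rmap_comp (A : V) {X Y Z W : V} (f : X ⟶ Y) (g : Y ⟶ Z)
    {k k' : Z ⊠ A ⟶ W} (η : k ⟶ k') :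
    ((f ≫ g) ⊠ᵣ A) ◁ η = eqToHom (by simp) ≫ (f ⊠ᵣ A) ◁ (g ⊠ᵣ A) ◁ η ≫ eqToHom (by simp) := by
  rw [whiskerLeft_congr (rmap_comp f g A)]; simp

@[simp] theorem whiskerLeft_lmap_id (A : V) {X W : V} {k k' : A ⊠ X ⟶ W} (η : k ⟶ k') :
    (A ⊠ₗ 𝟙 X) ◁ η = eqToHom (by simp) ≫ η ≫ eqToHom (by simp) := by
  rw [whiskerLeft_congr (lmap_id A X)]; simp

attribute [simp] lmap₂_whiskerLeft lmap₂_whiskerRight rmap₂_whiskerLeft rmap₂_whiskerRight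

end StrictCalculus

/-! ### Transposition of 2-cells along the pseudoadjunction. -/

section Transpose

variable {V : Type u} [Bicategory.{w, v} V] [Bicategory.Strict V] [GrayMonoid V] [RightClosedData V]

@[simp] theorem ihI_hom (A : V) {B B' : V} {f g : B ⟶ B'} (θ : f ≅ g) :
    (ihI A θ).hom = ihm₂ A θ.hom := rfl

@[simp] theorem ihm₂_eqToHom (A : V) {B B' : V} {f g : B ⟶ B'} (h : f = g) :
    ihm₂ A (eqToHom h) = eqToHom (congrArg (ihm A) h) := by
  subst h; simp

theorem evN_naturality (A : V) {B B' : V} {f f' : B ⟶ B'} (θ : f ⟶ f') :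
    (ihm₂ A θ ⊠ᵣ₂ A) ▷ ev A B' ≫ (evN A f').hom = (evN A f).hom ≫ ev A B ◁ θ :=
  (RightClosedData.evT A).naturality_naturality θ

theorem coevN_naturality (A : V) {B B' : V} {f f' : B ⟶ B'} (θ : f ⟶ f') :
    θ ▷ coev A B' ≫ (coevN A f').hom = (coevN A f).hom ≫ coev A B ◁ ihm₂ A (θ ⊠ᵣ₂ A) :=
  (RightClosedData.coevT A).naturality_naturality θ

theorem evN_comp (A : V) {B B' B'' : V} (f : B ⟶ B') (g : B' ⟶ B'') :
    (evN A (f ≫ g)).hom =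
      ((ihComp A f g).hom ⊠ᵣ₂ A) ▷ ev A B'' ≫ eqToHom (by simp) ≫
        (ihm A f ⊠ᵣ A) ◁ (evN A g).hom ≫ eqToHom (by simp) ≫
        (evN A f).hom ▷ g ≫ eqToHom (by simp) := by
  have h : (evN A (f ≫ g)).hom ≫ ev A B ◁ 𝟙 (f ≫ g) =
      (((ihComp A f g).hom ⊠ᵣ₂ A) ≫ eqToHom (rmap_comp _ _ _)) ▷ ev A B'' ≫ (α_ _ _ _).hom ≫
        (ihm A f ⊠ᵣ A) ◁ (evN A g).hom ≫ (α_ _ _ _).inv ≫ (evN A f).hom ▷ g ≫ (α_ _ _ _).hom :=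
    (RightClosedData.evT A).naturality_comp f g
  simpa using h

theorem ihComp_naturality_left (A : V) {B B' B'' : V} {f f' : B ⟶ B'} (θ : f ⟶ f') (g : B' ⟶ B'') :
    ihm₂ A (θ ▷ g) ≫ (ihComp A f' g).hom = (ihComp A f g).hom ≫ ihm₂ A θ ▷ ihm A g := by
  have h : ihm₂ A (θ ▷ g) = (ihComp A f g).hom ≫ ihm₂ A θ ▷ ihm A g ≫ (ihComp A f' g).inv :=
    (RightClosedData.ihom A).map₂_whisker_right θ g
  simp [h]

theorem ihComp_naturality_right (A : V) {B B' B'' : V} (f : B ⟶ B') {g g' : B' ⟶ B''} (θ : g ⟶ g') :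
    ihm₂ A (f ◁ θ) ≫ (ihComp A f g').hom = (ihComp A f g).hom ≫ ihm A f ◁ ihm₂ A θ := by
  have h : ihm₂ A (f ◁ θ) = (ihComp A f g).hom ≫ ihm A f ◁ ihm₂ A θ ≫ (ihComp A f g').inv :=
    (RightClosedData.ihom A).map₂_whisker_left f θ
  simp [h]

theorem ihComp_assoc (A : V) {B B' B'' B''' : V} (f : B ⟶ B') (g : B' ⟶ B'') (h : B'' ⟶ B''') :
    (ihComp A (f ≫ g) h).hom ≫ (ihComp A f g).hom ▷ ihm A h =
      eqToHom (by simp) ≫ (ihComp A f (g ≫ h)).hom ≫ ihm A f ◁ (ihComp A g h).hom ≫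
      eqToHom (by simp) := by
  have h : (ihComp A (f ≫ g) h).hom ≫ (ihComp A f g).hom ▷ ihm A h =
      ihm₂ A (α_ f g h).hom ≫ (ihComp A f (g ≫ h)).hom ≫ ihm A f ◁ (ihComp A g h).hom ≫
      (α_ _ _ _).inv :=
    (RightClosedData.ihom A).mapComp_assoc_left_hom f g h
  simpa using h

theorem ihComp_id_right (A : V) {B B' : V} (f : B ⟶ B') :
    (ihComp A f (𝟙 B')).hom = eqToHom (by simp) ≫ ihm A f ◁ (ihId A B').inv := by
  have h : (ihComp A f (𝟙 B')).hom = ihm₂ A (ρ_ f).hom ≫ (ρ_ _).inv ≫ ihm A f ◁ (ihId A B').inv :=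
    (RightClosedData.ihom A).mapComp_id_right_hom f
  simpa using h

/-- The 2-cell underlying `uncurryCurry`. -/
def transposeCounit (A : V) {X B : V} (f : X ⊠ A ⟶ B) :
    (coev A X ≫ ihm A f) ⊠ᵣ A ≫ ev A B ≅ f := uncurryCurry A f

theorem transposeCounit_hom (A : V) {X B : V} (f : X ⊠ A ⟶ B) :
    (transposeCounit A f).hom = eqToHom (by simp) ≫ (coev A X ⊠ᵣ A) ◁ (evN A f).hom ≫
      eqToHom (by simp) ≫ (triS A X).inv ▷ f ≫ eqToHom (by simp) := by
  -- Unfolding `curry` and `uncurry` holds by definition; displaying the pasting over the expanded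
  -- boundary makes it accessible to the cast calculus.
  have e : transposeCounit A f =
      icast (Iso.refl (coev A X ⊠ᵣ A ≫ ihm A f ⊠ᵣ A ≫ ev A B) ⊚ cwl (coev A X ⊠ᵣ A) (evN A f) ⊚
        cwr (triS A X).symm f) (by simp) (by simp) := rfl
  simp [e]

/-- The 2-cell underlying `curryUncurry`. -/
def transposeUnit (A : V) {X B : V} (g : X ⟶ iho A B) :
    g ≅ coev A X ≫ ihm A (g ⊠ᵣ A ≫ ev A B) := curryUncurry A g

theorem transposeUnit_hom (A : V) {X B : V} (g : X ⟶ iho A B) :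
    (transposeUnit A g).hom = eqToHom (by simp) ≫ g ◁ (triT A B).inv ≫ eqToHom (by simp) ≫
      (coevN A g).hom ▷ ihm A (ev A B) ≫ eqToHom (by simp) ≫
      coev A X ◁ (ihComp A (g ⊠ᵣ A) (ev A B)).inv := by
  have e : transposeUnit A g =
      icast (cwl g (triT A B).symm ⊚ cwr (coevN A g) (ihm A (ev A B)) ⊚
        cwl (coev A X) (ihComp A (g ⊠ᵣ A) (ev A B)).symm) (by simp) (by simp) := rfl
  simp [e]

theorem ihComp_inv_naturality_left (A : V) {B B' B'' : V} {f f' : B ⟶ B'} (θ : f ⟶ f')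
    (g : B' ⟶ B'') :
    ihm₂ A θ ▷ ihm A g ≫ (ihComp A f' g).inv = (ihComp A f g).inv ≫ ihm₂ A (θ ▷ g) := by
  rw [Iso.comp_inv_eq, Category.assoc, Iso.eq_inv_comp, ihComp_naturality_left]

theorem ihComp_inv_naturality_right (A : V) {B B' B'' : V} (f : B ⟶ B') {g g' : B' ⟶ B''}
    (θ : g ⟶ g') :
    ihm A f ◁ ihm₂ A θ ≫ (ihComp A f g').inv = (ihComp A f g).inv ≫ ihm₂ A (f ◁ θ) := by
  rw [Iso.comp_inv_eq, Category.assoc, Iso.eq_inv_comp, ihComp_naturality_right]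

/-- The counit is built from `evN` and the inverse triangle cell. The 2-cell `θ` passes the first by
naturality of evaluation, and the second by interchange because the two act on different factors of
a composite. -/
theorem transposeCounit_naturality (A : V) {X B : V} {f f' : X ⊠ A ⟶ B} (θ : f ⟶ f') :
    ((coev A X ◁ ihm₂ A θ) ⊠ᵣ₂ A) ▷ ev A B ≫ (transposeCounit A f').hom =
      (transposeCounit A f).hom ≫ θ := by
  have h := congrArg (fun t => (coev A X ⊠ᵣ A) ◁ t) (evN_naturality A θ)
  have h' := whisker_exchange (triS A X).inv θ
  simp only [Bicategory.whiskerLeft_comp] at h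
  simp [eqToHom_comp_iff] at h'
  simp only [transposeCounit_hom]
  simp [reassoc_of% h, reassoc_of% h']

/-- Here `γ` passes the three constituents of the unit in turn: the inverse of `triT` by
interchange, `coevN` by naturality of coevaluation, and the inverse of `ihComp` by its naturality.
-/
theorem transposeUnit_naturality (A : V) {X B : V} {g g' : X ⟶ iho A B} (γ : g ⟶ g') :
    γ ≫ (transposeUnit A g').hom =
      (transposeUnit A g).hom ≫ coev A X ◁ ihm₂ A ((γ ⊠ᵣ₂ A) ▷ ev A B) := by
  have h := congrArg (fun t => t ▷ ihm A (ev A B)) (coevN_naturality A γ)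
  have h' := (whisker_exchange γ (triT A B).inv).symm
  have h'' := congrArg (fun t => coev A X ◁ t) (ihComp_inv_naturality_left A (γ ⊠ᵣ₂ A) (ev A B))
  simp at h
  simp [eqToHom_comp_iff] at h'
  simp only [Bicategory.whiskerLeft_comp] at h''
  have h₃ : γ ≫ eqToHom (Category.comp_id g').symm ≫ g' ◁ (triT A B).inv =
      eqToHom (Category.comp_id g).symm ≫ (g ◁ (triT A B).inv) ≫ eqToHom (by simp) ≫
        γ ▷ coev A (iho A B) ▷ ihm A (ev A B) ≫ eqToHom (by simp) := by
    simp [← h']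
  simp only [transposeUnit_hom]
  simp [reassoc_of% h₃, reassoc_of% h, h'']

/-- Transposition is faithful on 2-cells. -/
theorem transpose_injective (A : V) {X B : V} {g g' : X ⟶ iho A B} {γ γ' : g ⟶ g'}
    (h : (γ ⊠ᵣ₂ A) ▷ ev A B = (γ' ⊠ᵣ₂ A) ▷ ev A B) : γ = γ' := by
  -- Since the unit is invertible, its naturality expresses `γ` through the transpose of `γ` alone.
  rw [← cancel_mono (transposeUnit A g').hom, transposeUnit_naturality, h,
    transposeUnit_naturality]

/-- The 2-isomorphism with a given transpose. -/
def ofTranspose {A X B : V} {g g' : X ⟶ iho A B} (θ : g ⊠ᵣ A ≫ ev A B ≅ g' ⊠ᵣ A ≫ ev A B) :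
    g ≅ g' := ofUncurry θ

variable [RightClosed V]

/-- The modification axiom for `triS`, solved for the inverse triangle cells, which are the ones
that occur in the counit. -/
theorem triS_inv_naturality (A : V) {B B' : V} (f : B ⟶ B') :
    ((coevN A f).hom ⊠ᵣ₂ A) ▷ ev A (B' ⊠ A) ≫ eqToHom (by simp) ≫
      (coev A B ⊠ᵣ A) ◁ (evN A (f ⊠ᵣ A)).hom ≫ eqToHom (by simp) ≫ (triS A B).inv ▷ (f ⊠ᵣ A) =
    eqToHom (by simp) ≫ (f ⊠ᵣ A) ◁ (triS A B').inv ≫ eqToHom (by simp) := by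
  have h := congrArg Iso.hom (RightClosed.triS_naturality A f)
  simp [eqToHom_comp_iff] at h
  simp only [← Category.assoc, comp_eqToHom_iff] at h
  simp only [Category.assoc, eqToHom_trans] at h
  rw [← cancel_epi ((f ⊠ᵣ A) ◁ (triS A B').hom ≫ eqToHom (by simp))]
  simp only [Category.assoc, eqToHom_trans_assoc]
  rw [reassoc_of% h]
  simp

theorem swallowtail_ev_inv (A B : V) :
    ((triT A B).inv ⊠ᵣ₂ A) ▷ ev A B ≫ eqToHom (by simp) ≫
      (coev A (iho A B) ⊠ᵣ A) ◁ (evN A (ev A B)).hom ≫ eqToHom (by simp) ≫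
      (triS A (iho A B)).inv ▷ ev A B = eqToHom (by simp) := by
  have h := congrArg Iso.inv (RightClosed.swallowtail_ev A B)
  simp [eqToHom_comp_iff] at h
  simp only [← Category.assoc, comp_eqToHom_iff] at h
  simpa using h

/-- Expanding `evN` on the composite `g ⊠ᵣ A ≫ ev A B` produces an `ihComp` that cancels the one in
the unit (`h₄`). After exchanging the coevaluation cell of `g` with the evaluation cell of `ev`
(`h₁`), naturality of `triS` at `g` removes `g` from the pasting (`h₂`), and what remains is the
swallowtail identity for `ev` (`h₃`). -/
theorem transpose_triangle (A : V) {X B : V} (g : X ⟶ iho A B) :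
    ((transposeUnit A g).hom ⊠ᵣ₂ A) ▷ ev A B ≫ (transposeCounit A (g ⊠ᵣ A ≫ ev A B)).hom =
      𝟙 _ := by
  have h₁ := (whisker_exchange ((coevN A g).hom ⊠ᵣ₂ A) (evN A (ev A B)).hom).symm
  have h₂ := congrArg (fun t => t ▷ ev A B) (triS_inv_naturality A g)
  have h₃ := congrArg (fun t => (g ⊠ᵣ A) ◁ t) (swallowtail_ev_inv A B)
  have h₄ : (coev A X ⊠ᵣ A) ◁ ((ihComp A (g ⊠ᵣ A) (ev A B)).inv ⊠ᵣ₂ A) ▷ ev A B ≫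
      (coev A X ⊠ᵣ A) ◁ ((ihComp A (g ⊠ᵣ A) (ev A B)).hom ⊠ᵣ₂ A) ▷ ev A B = 𝟙 _ := by
    rw [← Bicategory.whiskerLeft_comp, ← Bicategory.comp_whiskerRight, ← rmap₂_comp]; simp
  simp only [transposeUnit_hom, transposeCounit_hom, evN_comp]
  simp [eqToHom_comp_iff] at h₁ h₂ h₃
  simp only [← Category.assoc, comp_eqToHom_iff] at h₁
  simp only [Category.assoc, eqToHom_trans] at h₁
  simp [reassoc_of% h₄, reassoc_of% h₁, reassoc_of% h₂, reassoc_of% h₃]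

/-- This is what makes cells defined through `ofUncurry` computable: their transposes are the
pastings they were defined from. -/
theorem transpose_ofTranspose {A X B : V} {g g' : X ⟶ iho A B}
    (θ : g ⊠ᵣ A ≫ ev A B ≅ g' ⊠ᵣ A ≫ ev A B) :
    ((ofTranspose θ).hom ⊠ᵣ₂ A) ▷ ev A B = θ.hom := by
  have e : (ofTranspose θ).hom = (transposeUnit A g).hom ≫ coev A X ◁ ihm₂ A θ.hom ≫
      (transposeUnit A g').inv := rfl
  -- By the triangle identity the transpose of the inverse unit is the counit. Naturality of the
  -- counit then brings `θ` out, and a second use of the triangle removes the unit and counit.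
  have h (g : X ⟶ iho A B) : ((transposeUnit A g).inv ⊠ᵣ₂ A) ▷ ev A B =
      (transposeCounit A (g ⊠ᵣ A ≫ ev A B)).hom := by
    let e := whiskerRightIso (rI (transposeUnit A g) A) (ev A B)
    change e.inv = _
    rw [← cancel_epi e.hom, e.hom_inv_id]
    exact (transpose_triangle A g).symm
  rw [e, rmap₂_comp, rmap₂_comp, Bicategory.comp_whiskerRight, Bicategory.comp_whiskerRight, h,
    transposeCounit_naturality, reassoc_of% transpose_triangle]

end Transpose

/-! ### Pseudofunctoriality of `[-, C]`. -/

section Contravariant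

variable {V : Type u} [Bicategory.{w, v} V] [Bicategory.Strict V] [GrayMonoid V] [RightClosedData V]

/-- The evaluation of `ipre f C`. -/
def ipreEval {A A' : V} (f : A ⟶ A') (C : V) :
    ipre f C ⊠ᵣ A ≫ ev A C ≅ iho A' C ⊠ₗ f ≫ ev A' C := ipreEv f C

/-- `ipre₂ γ C` is by definition coevaluation whiskered with `[A, -]` of a 2-cell, so this is an
instance of naturality of the counit. -/
theorem ipreEval_naturality {A A' : V} {f f' : A ⟶ A'} (γ : f ⟶ f') (C : V) :
    (ipre₂ γ C ⊠ᵣ₂ A) ▷ ev A C ≫ (ipreEval f' C).hom =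
      (ipreEval f C).hom ≫ (iho A' C ⊠ₗ₂ γ) ▷ ev A' C :=
  transposeCounit_naturality A _

theorem ipreEval_inv_naturality {A A' : V} {f f' : A ⟶ A'} (γ : f ⟶ f') (C : V) :
    (iho A' C ⊠ₗ₂ γ) ▷ ev A' C ≫ (ipreEval f' C).inv =
      (ipreEval f C).inv ≫ (ipre₂ γ C ⊠ᵣ₂ A) ▷ ev A C := by
  rw [Iso.comp_inv_eq, Category.assoc, Iso.eq_inv_comp, ipreEval_naturality]

@[simp] theorem ipre₂_eqToHom {A A' : V} {f g : A ⟶ A'} (h : f = g) (C : V) :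
    ipre₂ (eqToHom h) C = eqToHom (congrArg (ipre · C) h) := by
  subst h; simp

theorem ipreEval_congr {A A' : V} {f g : A ⟶ A'} (h : f = g) (C : V) :
    (ipreEval f C).hom = eqToHom (by rw [h]) ≫ (ipreEval g C).hom ≫ eqToHom (by rw [h]) := by
  subst h; simp

variable [RightClosed V]

theorem transpose_ipreComp {A A' A'' : V} (f : A ⟶ A') (g : A' ⟶ A'') (C : V) :
    ((ipreComp f g C).hom ⊠ᵣ₂ A) ▷ ev A C =
      (ipreEval (f ≫ g) C).hom ≫ eqToHom (by simp) ≫ (iho A'' C ⊠ₗ f) ◁ (ipreEval g C).inv ≫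
        eqToHom (by simp) ≫ (inter (ipre g C) f).hom ▷ ev A' C ≫ eqToHom (by simp) ≫
        (ipre g C ⊠ᵣ A) ◁ (ipreEval f C).inv ≫ eqToHom (by simp) := by
  have e : ipreComp f g C = ofTranspose (icast (ipreEval (f ≫ g) C ⊚
      cwl (iho A'' C ⊠ₗ f) (ipreEval g C).symm ⊚ cwr (inter (ipre g C) f) (ev A' C) ⊚
      cwl (ipre g C ⊠ᵣ A) (ipreEval f C).symm) rfl (by simp)) := rfl
  rw [e, transpose_ofTranspose]
  simp

/-- On transposes, `γ` slides through the evaluation of the composite, the inverse evaluation of `g`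
(`h₁`), the interchanger (`h₂`) and the inverse evaluation at `f` (`h₃`). -/
theorem ipreComp_naturality_left {A A' A'' : V} {f f' : A ⟶ A'} (γ : f ⟶ f') (g : A' ⟶ A'')
    (C : V) :
    ipre₂ (γ ▷ g) C ≫ (ipreComp f' g C).hom = (ipreComp f g C).hom ≫ ipre g C ◁ ipre₂ γ C := by
  apply transpose_injective
  have h₁ := (whisker_exchange (iho A'' C ⊠ₗ₂ γ) (ipreEval g C).inv).symm
  have h₂ := congrArg (fun t => t ▷ ev A' C) (inter_naturality_right (ipre g C) γ)
  have h₃ := congrArg (fun t => (ipre g C ⊠ᵣ A) ◁ t) (ipreEval_inv_naturality γ C)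
  simp [eqToHom_comp_iff] at h₁ h₂ h₃
  simp [transpose_ipreComp, reassoc_of% ipreEval_naturality]
  simp [reassoc_of% h₁, reassoc_of% h₂, reassoc_of% h₃]

theorem ipreComp_naturality_right {A A' A'' : V} (f : A ⟶ A') {g g' : A' ⟶ A''} (γ : g ⟶ g')
    (C : V) :
    ipre₂ (f ◁ γ) C ≫ (ipreComp f g' C).hom = (ipreComp f g C).hom ≫ ipre₂ γ C ▷ ipre f C := by
  apply transpose_injective
  have h₁ := congrArg (fun t => (iho A'' C ⊠ₗ f) ◁ t) (ipreEval_inv_naturality γ C)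
  have h₂ := congrArg (fun t => t ▷ ev A' C) (inter_naturality_left (ipre₂ γ C) f)
  have h₃ := (whisker_exchange (ipre₂ γ C ⊠ᵣ₂ A) (ipreEval f C).inv).symm
  simp [eqToHom_comp_iff] at h₁ h₂ h₃
  simp only [← Category.assoc] at h₂
  simp only [Category.assoc] at h₂
  simp [transpose_ipreComp, reassoc_of% ipreEval_naturality]
  simp [reassoc_of% h₁, reassoc_of% h₂, reassoc_of% h₃]

/-- Both transposes evaluate the triple composite and then undo the evaluations of `h`, `g` and `f`,
with interchangers in between. The interchangers with composites split, which identifies the two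
pastings once `ipreComp g h C` has been moved past the interchanger and the inverse evaluation of
`f` (`h₂`, `h₃`), and the interchanger of `ipre h C` with `f` past the inverse evaluation of `g`
(`h₅`). -/
theorem ipreComp_assoc {A A' A'' A''' : V} (f : A ⟶ A') (g : A' ⟶ A'') (h : A'' ⟶ A''') (C : V) :
    (ipreComp (f ≫ g) h C).hom ≫ ipre h C ◁ (ipreComp f g C).hom =
      eqToHom (by simp) ≫ (ipreComp f (g ≫ h) C).hom ≫ (ipreComp g h C).hom ▷ ipre f C ≫
      eqToHom (by simp) := by
  apply transpose_injective
  have h₁ := congrArg (fun t => (ipre h C ⊠ᵣ A) ◁ t) (transpose_ipreComp f g C)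
  have h₂ := (whisker_exchange ((ipreComp g h C).hom ⊠ᵣ₂ A) (ipreEval f C).inv)
  have h₃ := congrArg (fun t => t ▷ ev A' C) (inter_naturality_left (ipreComp g h C).hom f).symm
  have h₄ := congrArg (fun t => (iho A''' C ⊠ₗ f) ◁ t) (transpose_ipreComp g h C)
  have h₅ := whisker_exchange (inter (ipre h C) f).hom (ipreEval g C).inv
  simp [inter_comp_left] at h₁ h₂ h₃
  simp [eqToHom_comp_iff] at h₅
  simp only [← Category.assoc, comp_eqToHom_iff] at h₂ h₅
  simp only [Category.assoc, eqToHom_trans] at h₂ h₅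
  simp [transpose_ipreComp, inter_comp_right, ipreEval_congr (Category.assoc f g h),
    reassoc_of% h₂, reassoc_of% h₃, reassoc_of% h₅]

/-- `[-, C]` preserves identities. -/
def ipreId (A C : V) : ipre (𝟙 A) C ≅ 𝟙 (iho A C) :=
  ofTranspose (icast (ipreEval (𝟙 A) C) rfl (by simp))

theorem transpose_ipreId (A C : V) :
    ((ipreId A C).hom ⊠ᵣ₂ A) ▷ ev A C = (ipreEval (𝟙 A) C).hom ≫ eqToHom (by simp) := by
  rw [ipreId, transpose_ofTranspose]
  simp

/-- The interchanger with an identity is a cast, and the remaining evaluations occur in inverse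
pairs. -/
theorem ipreComp_id_left {A A' : V} (f : A ⟶ A') (C : V) :
    (ipreComp (𝟙 A) f C).hom ≫ ipre f C ◁ (ipreId A C).hom = eqToHom (by simp) := by
  apply transpose_injective
  have h₁ := congrArg (fun t => (ipre f C ⊠ᵣ A) ◁ t) (transpose_ipreId A C)
  simp at h₁
  simp [transpose_ipreComp, inter_id_right, ipreEval_congr (Category.id_comp f), reassoc_of% h₁]

end Contravariant

/-! ### The strictness axioms for 2-cells, as equations up to casts. -/

section Casts

variable {V : Type u} [Bicategory.{w, v} V] [Bicategory.Strict V]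

@[simp] theorem eqToHom_whiskerLeft_eqToHom {X Y Z W : V} (h : X = Y) (h' : Y = Z) {g g' : Z ⟶ W}
    (η : g ⟶ g') :
    eqToHom h ◁ eqToHom h' ◁ η =
      eqToHom (by simp) ≫ eqToHom (h.trans h') ◁ η ≫ eqToHom (by simp) := by
  subst h h'; simp

@[simp] theorem whiskerRight_eqToHom_eqToHom {X Y Z W : V} {g g' : W ⟶ X} (η : g ⟶ g')
    (h : X = Y) (h' : Y = Z) :
    η ▷ eqToHom h ▷ eqToHom h' =
      eqToHom (by simp) ≫ η ▷ eqToHom (h.trans h') ≫ eqToHom (by simp) := by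
  subst h h'; simp

/-- The strictness axioms of a Gray monoid are heterogeneous equalities. Whiskering with casts of
the objects and composing with casts of the 1-cells turns those between 2-cells into equations that
can be used for rewriting. -/
theorem eq_of_heq_hom₂ {X Y X' Y' : V} {f g : X ⟶ Y} {f' g' : X' ⟶ Y'} (hX : X = X') (hY : Y = Y')
    (hf : f = eqToHom hX ≫ f' ≫ eqToHom hY.symm) (hg : g = eqToHom hX ≫ g' ≫ eqToHom hY.symm)
    {η : f ⟶ g} {η' : f' ⟶ g'} (h : HEq η η') :
    η = eqToHom hf ≫ eqToHom hX ◁ η' ▷ eqToHom hY.symm ≫ eqToHom hg.symm := by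
  subst hX hY
  obtain rfl : f = f' := by simpa using hf
  obtain rfl : g = g' := by simpa using hg
  simpa using eq_of_heq h

variable [GrayMonoid V]

theorem whiskerLeft_rmap_tensor {X Y Z : V} (f : X ⟶ Y) (A B : V) {k k' : Y ⊠ A ⊠ B ⟶ Z}
    (η : k ⟶ k') :
    (f ⊠ᵣ (A ⊠ B)) ◁ η = eqToHom (by simp) ≫ eqToHom (tensor_assoc X A B).symm ◁
      (f ⊠ᵣ A ⊠ᵣ B) ◁ eqToHom (tensor_assoc Y A B) ◁ η ≫ eqToHom (by simp) := by
  rw [whiskerLeft_congr (rmap_tensor A B f)]; simp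

theorem whiskerLeft_lmap_tensor {X Y Z : V} (A B : V) (f : X ⟶ Y) {k k' : (A ⊠ B) ⊠ Y ⟶ Z}
    (η : k ⟶ k') :
    ((A ⊠ B) ⊠ₗ f) ◁ η = eqToHom (by simp) ≫ eqToHom (tensor_assoc A B X) ◁
      (A ⊠ₗ B ⊠ₗ f) ◁ eqToHom (tensor_assoc A B Y).symm ◁ η ≫ eqToHom (by simp) := by
  rw [whiskerLeft_congr (lmap_tensor A B f)]; simp

theorem whiskerLeft_rmap_lmap {X Y Z : V} (A B : V) (f : X ⟶ Y) {k k' : (A ⊠ Y) ⊠ B ⟶ Z}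
    (η : k ⟶ k') :
    ((A ⊠ₗ f) ⊠ᵣ B) ◁ η = eqToHom (by simp) ≫ eqToHom (tensor_assoc A X B) ◁
      (A ⊠ₗ (f ⊠ᵣ B)) ◁ eqToHom (tensor_assoc A Y B).symm ◁ η ≫ eqToHom (by simp) := by
  rw [whiskerLeft_congr (rmap_lmap_eq A B f)]; simp

theorem rmap₂_tensor {X Y : V} {f g : X ⟶ Y} (θ : f ⟶ g) (A B : V) :
    θ ⊠ᵣ₂ (A ⊠ B) = eqToHom (by simp) ≫ eqToHom (tensor_assoc X A B).symm ◁
      ((θ ⊠ᵣ₂ A) ⊠ᵣ₂ B) ▷ eqToHom (tensor_assoc Y A B) ≫ eqToHom (by simp) :=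
  eq_of_heq_hom₂ _ (tensor_assoc Y A B).symm (by simp) (by simp) (rmap₂_rmap₂ θ A B)

theorem rmap₂_lmap₂_eq {X Y : V} {f g : X ⟶ Y} (A : V) (θ : f ⟶ g) (B : V) :
    (A ⊠ₗ₂ θ) ⊠ᵣ₂ B = eqToHom (by simp) ≫ eqToHom (tensor_assoc A X B) ◁
      (A ⊠ₗ₂ (θ ⊠ᵣ₂ B)) ▷ eqToHom (tensor_assoc A Y B).symm ≫ eqToHom (by simp) :=
  eq_of_heq_hom₂ _ (tensor_assoc A Y B) (by simp) (by simp) (rmap₂_lmap₂ A θ B)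

theorem inter_lmap_eq (X : V) {A A' B B' : V} (f : A ⟶ A') (g : B ⟶ B') :
    (inter (X ⊠ₗ f) g).hom = eqToHom (by simp) ≫ eqToHom (tensor_assoc X A B) ◁
      (X ⊠ₗ₂ (inter f g).hom) ▷ eqToHom (tensor_assoc X A' B').symm ≫ eqToHom (by simp) :=
  eq_of_heq_hom₂ _ (tensor_assoc X A' B') (by simp) (by simp) (inter_lmap X f g)

@[simp] theorem whiskerLeft_rmap_rmap_comp (A B : V) {X Y Z W : V} (f : X ⟶ Y) (g : Y ⟶ Z)
    {k k' : (Z ⊠ A) ⊠ B ⟶ W} (η : k ⟶ k') :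
    ((f ≫ g) ⊠ᵣ A ⊠ᵣ B) ◁ η = eqToHom (by simp) ≫ (f ⊠ᵣ A ⊠ᵣ B) ◁ (g ⊠ᵣ A ⊠ᵣ B) ◁ η ≫ eqToHom (by simp) := by
  rw [whiskerLeft_congr (congrArg (· ⊠ᵣ B) (rmap_comp f g A))]; simp

end Casts

/-! ### Evaluation in the presence of a parameter. -/

section Composition

variable {V : Type u} [Bicategory.{w, v} V] [Bicategory.Strict V] [GrayMonoid V] [RightClosedData V]

/-- Evaluation `(X ⊗ [A, B]) ⊗ A ⟶ X ⊗ B` in the presence of a parameter. -/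
def tensorEv (X A B : V) : (X ⊠ iho A B) ⊠ A ⟶ X ⊠ B :=
  eqToHom (tensor_assoc X (iho A B) A) ≫ X ⊠ₗ ev A B

theorem tensorEv_eq (X A B : V) :
    tensorEv X A B = eqToHom (tensor_assoc X (iho A B) A) ≫ X ⊠ₗ ev A B := by
  rw [tensorEv]

theorem tensorEv_whiskerLeft (X A B : V) {Z : V} {k k' : X ⊠ B ⟶ Z} (η : k ⟶ k') :
    tensorEv X A B ◁ η = eqToHom (by simp [tensorEv_eq]) ≫
      eqToHom (tensor_assoc X (iho A B) A) ◁ (X ⊠ₗ ev A B) ◁ η ≫ eqToHom (by simp [tensorEv_eq]) := by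
  rw [whiskerLeft_congr (tensorEv_eq X A B)]; simp

theorem whiskerRight_tensorEv (X A B : V) {Z : V} {k k' : Z ⟶ (X ⊠ iho A B) ⊠ A} (η : k ⟶ k') :
    η ▷ tensorEv X A B = eqToHom (by simp [tensorEv_eq]) ≫
      η ▷ eqToHom (tensor_assoc X (iho A B) A) ▷ (X ⊠ₗ ev A B) ≫ eqToHom (by simp [tensorEv_eq]) := by
  rw [whiskerRight_congr η (tensorEv_eq X A B)]; simp

/-- `tensorEv X A B` is pseudonatural in `X`. -/
def tensorEvN {X X' : V} (g : X ⟶ X') (A B : V) :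
    tensorEv X A B ≫ g ⊠ᵣ B ≅ g ⊠ᵣ iho A B ⊠ᵣ A ≫ tensorEv X' A B :=
  icast (whiskerLeftIso (eqToHom (tensor_assoc X (iho A B) A)) (inter g (ev A B)))
    (by simp [tensorEv_eq]) (by simp [tensorEv_eq])

theorem tensorEvN_hom {X X' : V} (g : X ⟶ X') (A B : V) : (tensorEvN g A B).hom =
    eqToHom (by simp [tensorEv_eq]) ≫ eqToHom (tensor_assoc X (iho A B) A) ◁ (inter g (ev A B)).hom ≫
      eqToHom (by simp [tensorEv_eq]) := by
  rw [tensorEvN, icast_hom]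
  simp

/-- Up to casts `tensorEvN` is the interchanger of `g` with evaluation, so this is naturality of the
interchanger in its first argument. -/
theorem tensorEvN_naturality {X X' : V} {g g' : X ⟶ X'} (θ : g ⟶ g') (A B : V) :
    tensorEv X A B ◁ (θ ⊠ᵣ₂ B) ≫ (tensorEvN g' A B).hom =
      (tensorEvN g A B).hom ≫ (θ ⊠ᵣ₂ iho A B ⊠ᵣ₂ A) ▷ tensorEv X' A B := by
  have h := congrArg (fun t => eqToHom (tensor_assoc X (iho A B) A) ◁ t)
    (inter_naturality_left θ (ev A B))
  simp [rmap₂_tensor] at h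
  simp [tensorEvN_hom, tensorEv_whiskerLeft, whiskerRight_tensorEv, reassoc_of% h]

theorem tensorEvN_comp {X X' X'' : V} (g : X ⟶ X') (g' : X' ⟶ X'') (A B : V) :
    (tensorEvN (g ≫ g') A B).hom = eqToHom (by simp) ≫ (tensorEvN g A B).hom ▷ (g' ⊠ᵣ B) ≫
      eqToHom (by simp) ≫ (g ⊠ᵣ iho A B ⊠ᵣ A) ◁ (tensorEvN g' A B).hom ≫ eqToHom (by simp) := by
  simp [tensorEvN_hom, inter_comp_left, whiskerLeft_rmap_tensor]

/-- Restriction of `tensorEv X A' B` along `f : A ⟶ A'`. -/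
def tensorEvPre (X : V) {A A' : V} (f : A ⟶ A') (B : V) :
    (X ⊠ iho A' B) ⊠ₗ f ≫ tensorEv X A' B ≅ (X ⊠ₗ ipre f B) ⊠ᵣ A ≫ tensorEv X A B :=
  icast (whiskerLeftIso (eqToHom (tensor_assoc X (iho A' B) A)) (lI X (ipreEval f B).symm))
    (by simp [tensorEv_eq]) (by simp [tensorEv_eq])

theorem tensorEvPre_hom (X : V) {A A' : V} (f : A ⟶ A') (B : V) : (tensorEvPre X f B).hom =
    eqToHom (by simp [tensorEv_eq]) ≫
      eqToHom (tensor_assoc X (iho A' B) A) ◁ (X ⊠ₗ₂ (ipreEval f B).inv) ≫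
      eqToHom (by simp [tensorEv_eq]) := by
  simp [tensorEvPre]

variable [RightClosed V]

/-- Obtained by applying `X ⊗ -` to the description of `ipreComp k f B` by evaluations;
`inter_lmap_eq` identifies the tensored interchanger with the interchanger of the tensored 1-cell.
-/
theorem tensorEvPre_comp (X : V) {A A' A'' : V} (k : A ⟶ A') (f : A' ⟶ A'') (B : V) :
    (tensorEvPre X (k ≫ f) B).hom = eqToHom (by simp) ≫
      ((X ⊠ iho A'' B) ⊠ₗ k) ◁ (tensorEvPre X f B).hom ≫ eqToHom (by simp) ≫
      (inter (X ⊠ₗ ipre f B) k).hom ▷ tensorEv X A' B ≫ eqToHom (by simp) ≫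
      ((X ⊠ₗ ipre f B) ⊠ᵣ A) ◁ (tensorEvPre X k B).hom ≫ eqToHom (by simp) ≫
      ((X ⊠ₗ₂ (ipreComp k f B).inv) ⊠ᵣ₂ A) ▷ tensorEv X A B := by
  -- The transpose formula for `ipreComp k f B`, solved for the inverse evaluation of `k ≫ f`.
  have h : (ipreEval (k ≫ f) B).inv = eqToHom (by simp) ≫
      (iho A'' B ⊠ₗ k) ◁ (ipreEval f B).inv ≫ eqToHom (by simp) ≫
      (inter (ipre f B) k).hom ▷ ev A' B ≫ eqToHom (by simp) ≫
      (ipre f B ⊠ᵣ A) ◁ (ipreEval k B).inv ≫ eqToHom (by simp) ≫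
      ((ipreComp k f B).inv ⊠ᵣ₂ A) ▷ ev A B := by
    have h₁ := transpose_ipreComp k f B =≫ ((ipreComp k f B).inv ⊠ᵣ₂ A) ▷ ev A B
    rw [← Bicategory.comp_whiskerRight, ← rmap₂_comp, Iso.hom_inv_id] at h₁
    rw [← cancel_epi (ipreEval (k ≫ f) B).hom, Iso.hom_inv_id]
    simpa using h₁
  simp [tensorEvPre_hom, inter_lmap_eq, rmap₂_lmap₂_eq, whiskerLeft_lmap_tensor,
    whiskerLeft_rmap_lmap, whiskerRight_tensorEv, h]

end Composition

/-! ### Inverse interchangers of composites. -/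

section Interchangers

variable {V : Type u} [Bicategory.{w, v} V] [Bicategory.Strict V] [GrayMonoid V]

@[simp] theorem whiskerLeft_lmap_comp_rmap (A B : V) {X Y Z W : V} (f : X ⟶ Y) (g : Y ⟶ Z)
    {k k' : (A ⊠ Z) ⊠ B ⟶ W} (η : k ⟶ k') :
    ((A ⊠ₗ (f ≫ g)) ⊠ᵣ B) ◁ η = eqToHom (by simp) ≫ ((A ⊠ₗ f) ⊠ᵣ B) ◁ ((A ⊠ₗ g) ⊠ᵣ B) ◁ η ≫
      eqToHom (by simp) := by
  rw [whiskerLeft_congr (congrArg (· ⊠ᵣ B) (lmap_comp A f g))]; simp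

theorem inter_comp_right_inv {A A' B B' B'' : V} (f : A ⟶ A') (g : B ⟶ B') (g' : B' ⟶ B'') :
    (inter f (g ≫ g')).inv = eqToHom (by simp) ≫ (inter f g).inv ▷ (A' ⊠ₗ g') ≫
      eqToHom (by simp) ≫ (A ⊠ₗ g) ◁ (inter f g').inv ≫ eqToHom (by simp) := by
  rw [← cancel_epi (inter f (g ≫ g')).hom, Iso.hom_inv_id, inter_comp_right]
  simp

theorem inter_comp_left_inv {A A' A'' B B' : V} (f : A ⟶ A') (f' : A' ⟶ A'') (g : B ⟶ B') :
    (inter (f ≫ f') g).inv = eqToHom (by simp) ≫ (f ⊠ᵣ B) ◁ (inter f' g).inv ≫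
      eqToHom (by simp) ≫ (inter f g).inv ▷ (f' ⊠ᵣ B') ≫ eqToHom (by simp) := by
  rw [← cancel_epi (inter (f ≫ f') g).hom, Iso.hom_inv_id, inter_comp_left]
  simp

end Interchangers

/-! ### Enriched composition and its compatibility with `[A, k]` and `[f, C]`. -/

section Composition

variable {V : Type u} [Bicategory.{w, v} V] [Bicategory.Strict V] [GrayMonoid V] [RightClosedData V]

/-- The 2-cell underlying `icompEv`. -/
def icompEv' (A B C : V) : icomp A B C ⊠ᵣ A ≫ ev A C ≅
    𝟙 ((iho B C ⊠ iho A B) ⊠ A) ≫ₑ iho B C ⊠ₗ ev A B ≫ₑ ev B C := icompEv A B C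

/-- The evaluation of `icomp A B C`. -/
def icompEval (A B C : V) : icomp A B C ⊠ᵣ A ≫ ev A C ≅ tensorEv (iho B C) A B ≫ ev B C :=
  icast (icompEv' A B C) rfl (by simp [tensorEv_eq, ccomp])

theorem icompEval_hom (A B C : V) : (icompEval A B C).hom =
    (icompEv' A B C).hom ≫ eqToHom (by simp [tensorEv_eq, ccomp]) := by
  rw [icompEval, icast_hom]
  simp

theorem icompEval_inv (A B C : V) : (icompEval A B C).inv =
    eqToHom (by simp [tensorEv_eq, ccomp]) ≫ (icompEv' A B C).inv := by
  rw [icompEval, icast_inv]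
  simp

theorem evN_comp_inv (A : V) {B B' B'' : V} (f : B ⟶ B') (g : B' ⟶ B'') :
    (evN A (f ≫ g)).inv = eqToHom (by simp) ≫ (evN A f).inv ▷ g ≫ eqToHom (by simp) ≫
      (ihm A f ⊠ᵣ A) ◁ (evN A g).inv ≫ eqToHom (by simp) ≫
      ((ihComp A f g).inv ⊠ᵣ₂ A) ▷ ev A B'' := by
  have h : ((ihComp A f g).hom ⊠ᵣ₂ A) ▷ ev A B'' ≫ ((ihComp A f g).inv ⊠ᵣ₂ A) ▷ ev A B'' =
      𝟙 _ := by
    rw [← Bicategory.comp_whiskerRight, ← rmap₂_comp]; simp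
  rw [← cancel_epi (evN A (f ≫ g)).hom, Iso.hom_inv_id, evN_comp]
  simp [h]

variable [RightClosed V]

/-- The pasting defining `icompPost`, read with `tensorEv` kept as a unit. In this form the
naturality of `tensorEv` in its parameter applies directly. -/
theorem transpose_icompPost (A B : V) {C C' : V} (k : C ⟶ C') :
    ((icompPost A B k).hom ⊠ᵣ₂ A) ▷ ev A C' = eqToHom (by simp) ≫
      (icomp A B C ⊠ᵣ A) ◁ (evN A k).hom ≫ eqToHom (by simp) ≫ (icompEval A B C).hom ▷ k ≫
      eqToHom (by simp) ≫ tensorEv (iho B C) A B ◁ (evN B k).inv ≫ eqToHom (by simp) ≫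
      (tensorEvN (ihm B k) A B).hom ▷ ev B C' ≫ eqToHom (by simp) ≫
      (ihm B k ⊠ᵣ iho A B ⊠ᵣ A) ◁ (icompEval A B C').inv ≫ eqToHom (by simp) := by
  have e : icompPost A B k = ofTranspose (icast (
      cwl (icomp A B C ⊠ᵣ A) (evN A k) ⊚ cwr (icompEv' A B C) k ⊚
      cwl (iho B C ⊠ₗ ev A B) (evN B k).symm ⊚ cwr (inter (ihm B k) (ev A B)) (ev B C') ⊚
      cwl (ihm B k ⊠ᵣ iho A B ⊠ᵣ A) (icompEv' A B C').symm) (by simp) (by simp)) := rfl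
  rw [e, transpose_ofTranspose]
  simp [icompEval_hom, icompEval_inv, tensorEvN_hom, tensorEv_whiskerLeft]

theorem transpose_icompPre {A A' : V} (f : A ⟶ A') (B C : V) :
    ((icompPre f B C).hom ⊠ᵣ₂ A) ▷ ev A C = eqToHom (by simp) ≫
      (icomp A' B C ⊠ᵣ A) ◁ (ipreEval f C).hom ≫ eqToHom (by simp) ≫
      (inter (icomp A' B C) f).inv ▷ ev A' C ≫ eqToHom (by simp) ≫
      ((iho B C ⊠ iho A' B) ⊠ₗ f) ◁ (icompEval A' B C).hom ≫ eqToHom (by simp) ≫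
      (tensorEvPre (iho B C) f B).hom ▷ ev B C ≫ eqToHom (by simp) ≫
      ((iho B C ⊠ₗ ipre f B) ⊠ᵣ A) ◁ (icompEval A B C).inv ≫ eqToHom (by simp) := by
  have e : icompPre f B C = ofTranspose (icast (
    cwl (icomp A' B C ⊠ᵣ A) (ipreEval f C) ⊚
    cwr (inter (icomp A' B C) f).symm (ev A' C) ⊚
    cwl ((iho B C ⊠ iho A' B) ⊠ₗ f) (icompEv' A' B C) ⊚
    cwr (lI (iho B C) (ipreEval f B)).symm (ev B C) ⊚
    cwl (iho B C ⊠ₗ ipre f B ⊠ᵣ A) (icompEv' A B C).symm) (by simp) (by simp)) := rfl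
  rw [e, transpose_ofTranspose]
  simp [icompEval_hom, icompEval_inv, tensorEvPre_hom, whiskerLeft_lmap_tensor,
    whiskerLeft_rmap_lmap]

/-- On transposes both sides evaluate twice and apply `f` and `k`; they differ in the order of
independent cells. Three interchanges (`h₁`, `h₃`, `h₄`) reorder them, and naturality of `tensorEvN`
at the inverse comparison cell (`h₅`) replaces its use on `f ≫ k` by its uses on the two factors. -/
theorem icompPost_comp (A B : V) {C C' C'' : V} (f : C ⟶ C') (k : C' ⟶ C'') :
    (icompPost A B (f ≫ k)).hom = icomp A B C ◁ (ihComp A f k).hom ≫ eqToHom (by simp) ≫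
      (icompPost A B f).hom ▷ ihm A k ≫ eqToHom (by simp) ≫
      (ihm B f ⊠ᵣ iho A B) ◁ (icompPost A B k).hom ≫ eqToHom (by simp) ≫
      ((ihComp B f k).inv ⊠ᵣ₂ iho A B) ▷ icomp A B C'' := by
  apply transpose_injective
  have h₁ := (whisker_exchange ((icompPost A B f).hom ⊠ᵣ₂ A) (evN A k).hom).symm
  have h₃ := (whisker_exchange (tensorEvN (ihm B f) A B).hom (evN B k).inv).symm
  have h₄ := whisker_exchange ((ihComp B f k).inv ⊠ᵣ₂ iho A B ⊠ᵣ₂ A) (icompEval A B C'').inv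
  have h₅ := congrArg (fun t => t ▷ ev B C'') (tensorEvN_naturality (ihComp B f k).inv A B)
  simp [eqToHom_comp_iff, tensorEvN_comp] at h₁ h₃ h₄ h₅
  simp only [← Category.assoc, comp_eqToHom_iff] at h₁ h₃ h₄ h₅
  simp only [Category.assoc, eqToHom_trans] at h₁ h₃ h₄ h₅
  simp [transpose_icompPost, evN_comp, evN_comp_inv, reassoc_of% h₁,
    reassoc_of% h₃, reassoc_of% h₄, reassoc_of% h₅]

/-- The contravariant analogue, with one new feature: the 1-cell `k` must pass the cell `icompPre f
B C` through interchangers. -/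
theorem icompPre_comp {A A' A'' : V} (k : A ⟶ A') (f : A' ⟶ A'') (B C : V) :
    (icompPre (k ≫ f) B C).hom = icomp A'' B C ◁ (ipreComp k f C).hom ≫ eqToHom (by simp) ≫
      (icompPre f B C).hom ▷ ipre k C ≫ eqToHom (by simp) ≫
      (iho B C ⊠ₗ ipre f B) ◁ (icompPre k B C).hom ≫ eqToHom (by simp) ≫
      (iho B C ⊠ₗ₂ (ipreComp k f B).inv) ▷ icomp A B C := by
  apply transpose_injective
  have h₁ := (whisker_exchange ((icompPre f B C).hom ⊠ᵣ₂ A) (ipreEval k C).hom).symm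
  -- Naturality of the interchanger with `k` at `icompPre f B C`, between inverse interchangers
  -- chosen so that those with `icomp A' B C` cancel and the one with `iho B C ⊠ₗ ipre f B`
  -- survives.
  have h₂ := congrArg (fun t => ((inter (icomp A'' B C ≫ ipre f C) k).inv ≫ t ≫
    eqToHom (by simp) ≫ ((iho B C ⊠ₗ ipre f B) ⊠ᵣ A) ◁ (inter (icomp A' B C) k).inv) ▷ ev A' C)
    (inter_naturality_left (icompPre f B C).hom k).symm
  have h₄ := (whisker_exchange (inter (icomp A'' B C) k).inv (ipreEval f C).hom).symm
  have h₅ := whisker_exchange (inter (iho B C ⊠ₗ ipre f B) k).hom (icompEval A' B C).inv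
  have h₆ := whisker_exchange ((iho B C ⊠ₗ₂ (ipreComp k f B).inv) ⊠ᵣ₂ A) (icompEval A B C).inv
  simp only [Category.assoc, inter_comp_left, inter_comp_left_inv] at h₂
  simp [eqToHom_comp_iff] at h₁ h₂ h₄ h₅ h₆
  simp only [← Category.assoc, comp_eqToHom_iff] at h₁ h₂ h₄ h₅ h₆
  simp only [Category.assoc, eqToHom_trans] at h₁ h₂ h₄ h₅ h₆
  simp [transpose_icompPre, inter_comp_right_inv, transpose_ipreComp, tensorEvPre_comp,
    reassoc_of% h₁, reassoc_of% h₂, reassoc_of% h₄, reassoc_of% h₅,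
    reassoc_of% h₆]

end Composition

/-! ### Transport of postcomposition through an enriched composite. -/

section PostTensor

variable {V : Type u} [Bicategory.{w, v} V] [Bicategory.Strict V] [GrayMonoid V] [RightClosedData V]

/-- Postcomposing a composite with `p` amounts to postcomposing its second factor. -/
def postTensor {X Y A M D x : V} (g : X ⟶ iho M D) (h : Y ⟶ iho A M) (p : D ⟶ x) :
    (g ⊠ᵣ Y ≫ iho M D ⊠ₗ h ≫ icomp A M D) ≫ ihm A p ≅
      (g ≫ ihm M p) ⊠ᵣ Y ≫ iho M x ⊠ₗ h ≫ icomp A M x :=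
  icast (cwl (g ⊠ᵣ Y ≫ iho M D ⊠ₗ h) (icompPost A M p) ⊚
    cw (g ⊠ᵣ Y) (inter (ihm M p) h) (icomp A M x)) (by simp) (by simp)

theorem postTensor_hom {X Y A M D x : V} (g : X ⟶ iho M D) (h : Y ⟶ iho A M) (p : D ⟶ x) :
    (postTensor g h p).hom = eqToHom (by simp) ≫ (g ⊠ᵣ Y) ◁ (iho M D ⊠ₗ h) ◁ (icompPost A M p).hom ≫
      eqToHom (by simp) ≫ (g ⊠ᵣ Y) ◁ (inter (ihm M p) h).hom ▷ icomp A M x ≫ eqToHom (by simp) := by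
  simp [postTensor]

theorem postTensor_inv {X Y A M D x : V} (g : X ⟶ iho M D) (h : Y ⟶ iho A M) (p : D ⟶ x) :
    (postTensor g h p).inv = eqToHom (by simp) ≫ (g ⊠ᵣ Y) ◁ (inter (ihm M p) h).inv ▷ icomp A M x ≫
      eqToHom (by simp) ≫ (g ⊠ᵣ Y) ◁ (iho M D ⊠ₗ h) ◁ (icompPost A M p).inv ≫
      eqToHom (by simp) := by
  simp [postTensor]

theorem postTensor_naturality {X Y A M D x : V} {g g' : X ⟶ iho M D} (θ : g ⟶ g') (h : Y ⟶ iho A M)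
    (p : D ⟶ x) :
    (θ ⊠ᵣ₂ Y) ▷ (iho M D ⊠ₗ h ≫ icomp A M D) ▷ ihm A p ≫ (postTensor g' h p).hom =
      (postTensor g h p).hom ≫ ((θ ▷ ihm M p) ⊠ᵣ₂ Y) ▷ (iho M x ⊠ₗ h ≫ icomp A M x) := by
  have h₁ := (whisker_exchange (θ ⊠ᵣ₂ Y) (iho M D ⊠ₗ h ◁ (icompPost A M p).hom)).symm
  have h₂ := (whisker_exchange (θ ⊠ᵣ₂ Y) ((inter (ihm M p) h).hom ▷ icomp A M x)).symm
  simp [eqToHom_comp_iff] at h₁ h₂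
  simp [postTensor_hom, reassoc_of% h₁, reassoc_of% h₂]

/-- The transport of a cell along `postTensor`. -/
def postTensorCell {X Y A M D D' x : V} {g : X ⟶ iho M D} {g' : X ⟶ iho M D'} {p : D ⟶ x}
    {p' : D' ⟶ x} (c : g ≫ ihm M p ≅ g' ≫ ihm M p') (h : Y ⟶ iho A M) :
    (g ⊠ᵣ Y ≫ iho M D ⊠ₗ h ≫ icomp A M D) ≫ ihm A p ≅
      (g' ⊠ᵣ Y ≫ iho M D' ⊠ₗ h ≫ icomp A M D') ≫ ihm A p' :=
  postTensor g h p ≪≫ whiskerRightIso (rI c Y) _ ≪≫ (postTensor g' h p').symm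

theorem postTensorCell_hom {X Y A M D D' x : V} {g : X ⟶ iho M D} {g' : X ⟶ iho M D'} {p : D ⟶ x}
    {p' : D' ⟶ x} (c : g ≫ ihm M p ≅ g' ≫ ihm M p') (h : Y ⟶ iho A M) :
    (postTensorCell c h).hom = (postTensor g h p).hom ≫
      (c.hom ⊠ᵣ₂ Y) ▷ (iho M x ⊠ₗ h ≫ icomp A M x) ≫ (postTensor g' h p').inv := by
  rw [postTensorCell]; rfl

/-- Postcomposition with `k` of a cell between composites with `p` and `p'`. -/
def postCell {X A D D' x y : V} {l : X ⟶ iho A D} {r : X ⟶ iho A D'} {p : D ⟶ x} {p' : D' ⟶ x}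
    (c : l ≫ ihm A p ≅ r ≫ ihm A p') (k : x ⟶ y) : l ≫ ihm A (p ≫ k) ≅ r ≫ ihm A (p' ≫ k) :=
  whiskerLeftIso l (ihComp A p k) ⊚ cwr c (ihm A k) ⊚ whiskerLeftIso r (ihComp A p' k).symm

theorem postCell_hom {X A D D' x y : V} {l : X ⟶ iho A D} {r : X ⟶ iho A D'} {p : D ⟶ x}
    {p' : D' ⟶ x} (c : l ≫ ihm A p ≅ r ≫ ihm A p') (k : x ⟶ y) :
    (postCell c k).hom = l ◁ (ihComp A p k).hom ≫ eqToHom (by simp) ≫ c.hom ▷ ihm A k ≫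
      eqToHom (by simp) ≫ r ◁ (ihComp A p' k).inv := by
  rw [postCell]
  simp

variable [RightClosed V]

/-- `icompPost_comp` splits the first half of `postTensor`. For the interchanger half, naturality
moves the comparison cell `ihComp M p k` across `h` (`h₁`), and the interchanger of `[M, p]` with
`h` commutes with the composition cell of `k` (`h₂`). -/
theorem postTensor_comp {X Y A M D x y : V} (g : X ⟶ iho M D) (h : Y ⟶ iho A M) (p : D ⟶ x)
    (k : x ⟶ y) :
    (postTensor g h (p ≫ k)).hom =
      (g ⊠ᵣ Y ≫ iho M D ⊠ₗ h ≫ icomp A M D) ◁ (ihComp A p k).hom ≫ eqToHom (by simp) ≫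
      (postTensor g h p).hom ▷ ihm A k ≫ eqToHom (by simp) ≫
      (postTensor (g ≫ ihm M p) h k).hom ≫ eqToHom (by simp) ≫
      ((g ◁ (ihComp M p k).inv) ⊠ᵣ₂ Y) ▷ (iho M y ⊠ₗ h ≫ icomp A M y) := by
  have h₁ := congrArg (fun t => (g ⊠ᵣ Y) ◁ t ▷ icomp A M y)
    (inter_naturality_left (ihComp M p k).inv h)
  have h₂ := congrArg (fun t => (g ⊠ᵣ Y) ◁ t)
    (whisker_exchange (inter (ihm M p) h).hom (icompPost A M k).hom)
  simp [eqToHom_comp_iff, inter_comp_left] at h₁ h₂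
  simp only [← Category.assoc, comp_eqToHom_iff] at h₂
  simp only [Category.assoc, eqToHom_trans] at h₂
  simp [postTensor_hom, icompPost_comp, reassoc_of% h₁, reassoc_of% h₂]

theorem postTensor_comp_inv {X Y A M D x y : V} (g : X ⟶ iho M D) (h : Y ⟶ iho A M) (p : D ⟶ x)
    (k : x ⟶ y) :
    (postTensor g h (p ≫ k)).inv =
      ((g ◁ (ihComp M p k).hom) ⊠ᵣ₂ Y) ▷ (iho M y ⊠ₗ h ≫ icomp A M y) ≫ eqToHom (by simp) ≫
      (postTensor (g ≫ ihm M p) h k).inv ≫ eqToHom (by simp) ≫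
      (postTensor g h p).inv ▷ ihm A k ≫ eqToHom (by simp) ≫
      (g ⊠ᵣ Y ≫ iho M D ⊠ₗ h ≫ icomp A M D) ◁ (ihComp A p k).inv := by
  have e : ((g ◁ (ihComp M p k).inv) ⊠ᵣ₂ Y) ▷ (iho M y ⊠ₗ h ≫ icomp A M y) ≫
      ((g ◁ (ihComp M p k).hom) ⊠ᵣ₂ Y) ▷ (iho M y ⊠ₗ h ≫ icomp A M y) = 𝟙 _ := by
    rw [← Bicategory.comp_whiskerRight, ← rmap₂_comp, ← Bicategory.whiskerLeft_comp]; simp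
  rw [← cancel_epi (postTensor g h (p ≫ k)).hom, Iso.hom_inv_id, postTensor_comp]
  simp only [Category.assoc]
  rw [reassoc_of% e]
  simp

/-- Transport commutes with `- ∘ k`: the comparison cells inside the tensor factor cancel (`e`,
`e'`), the two occurrences of `postTensor` for `k` cancel across the cell `c` by naturality (`h₁`),
and only the outer comparison cells remain. -/
theorem postTensorCell_whisker {X Y A M D D' x y : V} {g : X ⟶ iho M D} {g' : X ⟶ iho M D'}
    {p : D ⟶ x} {p' : D' ⟶ x} (c : g ≫ ihm M p ≅ g' ≫ ihm M p') (h : Y ⟶ iho A M) (k : x ⟶ y) :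
    (postTensorCell (postCell c k) h).hom =
    (g ⊠ᵣ Y ≫ iho M D ⊠ₗ h ≫ icomp A M D) ◁ (ihComp A p k).hom ≫ eqToHom (by simp) ≫
      (postTensorCell c h).hom ▷ ihm A k ≫ eqToHom (by simp) ≫
      (g' ⊠ᵣ Y ≫ iho M D' ⊠ₗ h ≫ icomp A M D') ◁ (ihComp A p' k).inv := by
  have e : (g ⊠ᵣ Y) ◁ ((ihComp M p k).inv ⊠ᵣ₂ Y) ▷ (iho M y ⊠ₗ h) ▷ icomp A M y ≫
      (g ⊠ᵣ Y) ◁ ((ihComp M p k).hom ⊠ᵣ₂ Y) ▷ (iho M y ⊠ₗ h) ▷ icomp A M y = 𝟙 _ := by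
    rw [← Bicategory.whiskerLeft_comp, ← Bicategory.comp_whiskerRight,
      ← Bicategory.comp_whiskerRight, ← rmap₂_comp]; simp
  have e' : (g' ⊠ᵣ Y) ◁ ((ihComp M p' k).inv ⊠ᵣ₂ Y) ▷ (iho M y ⊠ₗ h) ▷ icomp A M y ≫
      (g' ⊠ᵣ Y) ◁ ((ihComp M p' k).hom ⊠ᵣ₂ Y) ▷ (iho M y ⊠ₗ h) ▷ icomp A M y = 𝟙 _ := by
    rw [← Bicategory.whiskerLeft_comp, ← Bicategory.comp_whiskerRight,
      ← Bicategory.comp_whiskerRight, ← rmap₂_comp]; simp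
  have h₁ := (postTensor_naturality c.hom h k).symm
  simp at h₁
  simp [postTensorCell_hom, postCell_hom, postTensor_comp, postTensor_comp_inv, reassoc_of% e, reassoc_of% e',
    reassoc_of% h₁]

end PostTensor

section Composites

variable {V : Type u} [Bicategory.{w, v} V] [Bicategory.Strict V]

theorem ccomp_refl {X Y Z : V} (f : X ⟶ Y) (g : Y ⟶ Z) (e : Y = Y) : ccomp f g e = f ≫ g := by
  simp [ccomp]

theorem ccomp_whiskerLeft {X Y Z W : V} (f : X ⟶ Y) (g : Y ⟶ Z) (e : Y = Y) {k k' : Z ⟶ W}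
    (η : k ⟶ k') : ccomp f g e ◁ η =
      eqToHom (by simp [ccomp_refl]) ≫ f ◁ g ◁ η ≫ eqToHom (by simp [ccomp_refl]) := by
  rw [whiskerLeft_congr (ccomp_refl f g e)]; simp

theorem whiskerRight_ccomp {X Y Z W : V} {k k' : W ⟶ X} (η : k ⟶ k') (f : X ⟶ Y) (g : Y ⟶ Z)
    (e : Y = Y) : η ▷ ccomp f g e =
      eqToHom (by simp [ccomp_refl]) ≫ η ▷ f ▷ g ≫ eqToHom (by simp [ccomp_refl]) := by
  rw [whiskerRight_congr η (ccomp_refl f g e)]; simp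

end Composites

/-! ### The functoriality axiom for transformations to an object. -/

section PostFunctoriality

variable {V : Type u} [Bicategory.{w, v} V] [Bicategory.Strict V] [GrayMonoid V] [RightClosedData V]
  {X Y Z A M N Da Db Dc x y : V} {l₁ : X ⟶ iho M Da} {r₁ : X ⟶ iho M Db} {l₂ : Y ⟶ iho A M}
  {r₂ : X ⟶ iho A N} {l₃ : Y ⟶ iho N Db} {r₃ : Y ⟶ iho N Dc} {l : Z ⟶ iho A Da}
  {r : Z ⟶ iho A Dc} {pa : Da ⟶ x} {pb : Db ⟶ x} {pc : Dc ⟶ x}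
  {b : X ⊠ Y ⟶ Y ⊠ X} {m : Y ⊠ X ⟶ Z}
  (lm : l₁ ⊠ᵣ Y ≫ iho M Da ⊠ₗ l₂ ≫ icomp A M Da ≅ (b ≫ m) ≫ l)
  (rm : r₃ ⊠ᵣ X ≫ iho N Dc ⊠ₗ r₂ ≫ icomp A N Dc ≅ m ≫ r)
  (ex : r₁ ⊠ᵣ Y ≫ iho M Db ⊠ₗ l₂ ≫ icomp A M Db ≅
    b ≫ l₃ ⊠ᵣ X ≫ iho N Db ⊠ₗ r₂ ≫ icomp A N Db)
  (c₁ : l₁ ≫ ihm M pa ≅ r₁ ≫ ihm M pb) (c₃ : l₃ ≫ ihm N pb ≅ r₃ ≫ ihm N pc)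
  (c : l ≫ ihm A pa ≅ r ≫ ihm A pc)

/-- The functoriality axiom of an extra-pseudonatural transformation to an object. -/
def PostFunctoriality : Prop :=
  lm.hom ▷ ihm A pa ≫ eqToHom (by simp) ≫ b ◁ m ◁ c.hom ≫ eqToHom (by simp) ≫
    b ◁ rm.inv ▷ ihm A pc =
  (postTensorCell c₁ l₂).hom ≫ ex.hom ▷ ihm A pb ≫ eqToHom (by simp) ≫
    b ◁ (postTensorCell c₃ r₂).hom

/-- The hypothesis whiskered with `[A, k]` is the goal up to comparison cells. Those at `pa` and
`pc` slide past the multiplication cells to the two ends (`h₁`, `h₂`); the inverse pair at `pb` is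
separated only by `ex` and cancels after an interchange (`h₃`). -/
theorem PostFunctoriality.whisker [RightClosed V] (H : PostFunctoriality lm rm ex c₁ c₃ c)
    (k : x ⟶ y) :
    PostFunctoriality lm rm ex (postCell c₁ k) (postCell c₃ k) (postCell c k) := by
  rw [PostFunctoriality] at H ⊢
  have h := congrArg (fun t => t ▷ ihm A k) H
  have h₁ := (whisker_exchange lm.hom (ihComp A pa k).hom).symm
  have h₂ := congrArg (fun t => b ◁ t) (whisker_exchange rm.inv (ihComp A pc k).inv)
  have h₃ := whisker_exchange ex.hom (ihComp A pb k).inv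
  simp [eqToHom_comp_iff] at h h₁ h₂ h₃
  simp only [← Category.assoc, comp_eqToHom_iff] at h h₁ h₂ h₃
  simp only [Category.assoc, eqToHom_trans] at h h₁ h₂ h₃
  simp [postTensorCell_whisker, postCell_hom, reassoc_of% h, reassoc_of% h₁, h₂, reassoc_of% h₃]

end PostFunctoriality

namespace ExtraToData

variable {V : Type u} [Bicategory.{w, v} V] [Bicategory.Strict V] [GrayMonoid V] [Braiding V]
  [RightClosedData V] {B : VBicatData.{w, v, u, u₁} V}
  {P : VPsfData (B.op.tensor B) (selfEnriched V)} {x y : V}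

/-- The composition cells and interchangers around each structure cell in the axiom assemble into
`postTensorCell`, which reduces the axiom to a statement about three cells and the partial functors.
-/
theorem functoriality_iff (i : ExtraToData P x) (a b c : B.Obj) : (
    Iso.refl (L P a b a ⊠ᵣ B.Hom b c ≫ iho (ob P b a) (ob P a a) ⊠ₗ L P b c a ≫
        icomp (ob P c a) (ob P b a) (ob P a a) ≫ ihm (ob P c a) (i.app a)) ⊚
      cwr (LMult P a b c a) (ihm (ob P c a) (i.app a)) ⊚
      cwl (β (B.Hom a b) (B.Hom b c) ≫ B.m a b c) (i.cell a c) ⊚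
      cw (β (B.Hom a b) (B.Hom b c)) (RMult P c a b c).symm (ihm (ob P c a) (i.app c)) =
    icast (
      Iso.refl (L P a b a ⊠ᵣ B.Hom b c ≫ iho (ob P b a) (ob P a a) ⊠ₗ L P b c a ≫
        icomp (ob P c a) (ob P b a) (ob P a a) ≫ ihm (ob P c a) (i.app a)) ⊚
      cwl (L P a b a ⊠ᵣ B.Hom b c ≫ₑ iho (ob P b a) (ob P a a) ⊠ₗ L P b c a)
        (icompPost (ob P c a) (ob P b a) (i.app a)) ⊚
      cw (L P a b a ⊠ᵣ B.Hom b c) (inter (ihm (ob P b a) (i.app a)) (L P b c a))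
        (icomp (ob P c a) (ob P b a) x) ⊚
      cwr (rI (i.cell a b) (B.Hom b c))
        (iho (ob P b a) x ⊠ₗ L P b c a ≫ₑ icomp (ob P c a) (ob P b a) x) ⊚
      cw (R P b a b ⊠ᵣ B.Hom b c) (inter (ihm (ob P b a) (i.app b)) (L P b c a)).symm
        (icomp (ob P c a) (ob P b a) x) ⊚
      cwl (R P b a b ⊠ᵣ B.Hom b c ≫ₑ iho (ob P b a) (ob P b b) ⊠ₗ L P b c a)
        (icompPost (ob P c a) (ob P b a) (i.app b)).symm ⊚
      cwr (Exch P a b b c) (ihm (ob P c a) (i.app b)) ⊚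
      cwl (β (B.Hom a b) (B.Hom b c) ≫ₑ L P b c b ⊠ᵣ B.Hom a b ≫ₑ
          iho (ob P c b) (ob P b b) ⊠ₗ R P c a b)
        (icompPost (ob P c a) (ob P c b) (i.app b)) ⊚
      cw (β (B.Hom a b) (B.Hom b c) ≫ₑ L P b c b ⊠ᵣ B.Hom a b)
        (inter (ihm (ob P c b) (i.app b)) (R P c a b)) (icomp (ob P c a) (ob P c b) x) ⊚
      cw (β (B.Hom a b) (B.Hom b c)) (rI (i.cell b c) (B.Hom a b))
        (iho (ob P c b) x ⊠ₗ R P c a b ≫ₑ icomp (ob P c a) (ob P c b) x) ⊚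
      cw (β (B.Hom a b) (B.Hom b c) ≫ₑ R P c b c ⊠ᵣ B.Hom a b)
        (inter (ihm (ob P c b) (i.app c)) (R P c a b)).symm (icomp (ob P c a) (ob P c b) x) ⊚
      cwl (β (B.Hom a b) (B.Hom b c) ≫ₑ R P c b c ⊠ᵣ B.Hom a b ≫ₑ
          iho (ob P c b) (ob P c c) ⊠ₗ R P c a b)
        (icompPost (ob P c a) (ob P c b) (i.app c)).symm)) ↔
    PostFunctoriality (LMult P a b c a) (RMult P c a b c) (Exch P a b b c) (i.cell a b)
      (i.cell b c) (i.cell a c) := by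
  rw [PostFunctoriality, Iso.ext_iff]
  simp [postTensorCell_hom, postTensor_hom, postTensor_inv, ccomp_whiskerLeft, whiskerRight_ccomp,
    eqToHom_comp_iff]
  simp only [← Category.assoc, comp_eqToHom_iff]
  simp only [Category.assoc, eqToHom_trans]

end ExtraToData

/-! ### Morphisms and coherence cells under postcomposition. -/

section PostCell

variable {V : Type u} [Bicategory.{w, v} V] [Bicategory.Strict V] [GrayMonoid V] [RightClosedData V]
  {X A D D' x y z : V} {l : X ⟶ iho A D} {r : X ⟶ iho A D'} {p q : D ⟶ x} {p' q' : D' ⟶ x}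

theorem postCell_naturality (c : l ≫ ihm A p ≅ r ≫ ihm A p') (d : l ≫ ihm A q ≅ r ≫ ihm A q')
    (γ : p ⟶ q) (γ' : p' ⟶ q') (h : c.hom ≫ r ◁ ihm₂ A γ' = l ◁ ihm₂ A γ ≫ d.hom) (k : x ⟶ y) :
    (postCell c k).hom ≫ r ◁ ihm₂ A (γ' ▷ k) = l ◁ ihm₂ A (γ ▷ k) ≫ (postCell d k).hom := by
  have h := congrArg (fun t => t ▷ ihm A k) h
  have h₁ := congrArg (fun t => r ◁ t) (ihComp_inv_naturality_left A γ' k).symm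
  have h₂ := congrArg (fun t => l ◁ t) (ihComp_naturality_left A γ k)
  simp at h h₁ h₂
  simp only [← Category.assoc, comp_eqToHom_iff] at h
  simp only [Category.assoc] at h
  simp [postCell_hom, h₁, reassoc_of% h, reassoc_of% h₂]

theorem postCell_whiskerLeft (c : l ≫ ihm A p ≅ r ≫ ihm A p') {k k' : x ⟶ y} (θ : k ⟶ k') :
    (postCell c k).hom ≫ r ◁ ihm₂ A (p' ◁ θ) = l ◁ ihm₂ A (p ◁ θ) ≫ (postCell c k').hom := by
  have h := whisker_exchange c.hom (ihm₂ A θ)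
  have h₁ := congrArg (fun t => r ◁ t) (ihComp_inv_naturality_right A p' θ).symm
  have h₂ := congrArg (fun t => l ◁ t) (ihComp_naturality_right A p θ)
  simp [eqToHom_comp_iff] at h h₁ h₂
  simp [postCell_hom, h₁, reassoc_of% h, reassoc_of% h₂]

theorem postCell_id (c : l ≫ ihm A p ≅ r ≫ ihm A p') :
    (postCell c (𝟙 x)).hom ≫ r ◁ ihm₂ A (ρ_ p').hom = l ◁ ihm₂ A (ρ_ p).hom ≫ c.hom := by
  have h := whisker_exchange c.hom (ihId A x).inv
  -- The unit law of the pseudofunctor `[A, -]`, for the inverse comparison cell at the far end of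
  -- `postCell`.
  have e : (ihComp A p' (𝟙 x)).inv = ihm A p' ◁ (ihId A x).hom ≫ eqToHom (by simp) := by
    rw [← cancel_epi (ihComp A p' (𝟙 x)).hom, Iso.hom_inv_id, ihComp_id_right]
    simp
  simp [eqToHom_comp_iff] at h
  simp [postCell_hom, ihComp_id_right, e, reassoc_of% h]

theorem postCell_comp (c : l ≫ ihm A p ≅ r ≫ ihm A p') (k : x ⟶ y) (k' : y ⟶ z) :
    (postCell c (k ≫ k')).hom ≫ r ◁ ihm₂ A (α_ p' k k').inv =
      l ◁ ihm₂ A (α_ p k k').inv ≫ (postCell (postCell c k) k').hom := by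
  -- The associativity law `ihComp_assoc` for inverse cells, obtained by cancelling the forward
  -- composite.
  have e : (ihComp A p' k).inv ▷ ihm A k' ≫ (ihComp A (p' ≫ k) k').inv = eqToHom (by simp) ≫
      ihm A p' ◁ (ihComp A k k').inv ≫ (ihComp A p' (k ≫ k')).inv ≫ eqToHom (by simp) := by
    rw [← cancel_epi ((ihComp A (p' ≫ k) k').hom ≫ (ihComp A p' k).hom ▷ ihm A k')]
    nth_rw 2 [ihComp_assoc]
    simp
  have h₁ := congrArg (fun t => l ◁ t) (ihComp_assoc A p k k')
  have h₂ := congrArg (fun t => r ◁ t) e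
  have h₃ := whisker_exchange c.hom (ihComp A k k').hom
  simp [eqToHom_comp_iff] at h₁ h₂ h₃
  simp only [← Category.assoc, comp_eqToHom_iff] at h₃
  simp only [Category.assoc, eqToHom_trans] at h₃
  simp [postCell_hom, reassoc_of% h₁, h₂, reassoc_of% h₃]

end PostCell

/-! ### The unit axiom for transformations to an object. -/

section PostUnit

variable {V : Type u} [Bicategory.{w, v} V] [Bicategory.Strict V] [GrayMonoid V] [RightClosedData V]
  {X Y A D x y : V} {j : X ⟶ iho A D} {u : X ⟶ Y} {l r : Y ⟶ iho A D} {p : D ⟶ x}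
  (lu : j ≅ u ≫ l) (ru : j ≅ u ≫ r) (c : l ≫ ihm A p ≅ r ≫ ihm A p)

/-- The unit axiom of an extra-pseudonatural transformation to an object. -/
def PostUnit : Prop :=
  lu.hom ▷ ihm A p ≫ eqToHom (by simp) ≫ u ◁ c.hom ≫ eqToHom (by simp) ≫ ru.inv ▷ ihm A p =
    eqToHom rfl

/-- Both comparison cells concern the same 1-cell `p`, so after sliding past `lu` and `ru` they meet
and cancel around the whiskered hypothesis. -/
theorem PostUnit.whisker (H : PostUnit lu ru c) (k : x ⟶ y) :
    PostUnit lu ru (postCell c k) := by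
  rw [PostUnit] at H ⊢
  have h := congrArg (fun t => t ▷ ihm A k) H
  have h₁ := (whisker_exchange lu.hom (ihComp A p k).hom).symm
  have h₂ := whisker_exchange ru.inv (ihComp A p k).inv
  simp [eqToHom_comp_iff] at h h₁ h₂
  simp only [← Category.assoc, comp_eqToHom_iff] at h h₁ h₂
  simp only [Category.assoc, eqToHom_trans] at h h₁ h₂
  simp [postCell_hom, reassoc_of% h, reassoc_of% h₁, h₂]

end PostUnit

namespace ExtraToData

variable {V : Type u} [Bicategory.{w, v} V] [Bicategory.Strict V] [GrayMonoid V] [Braiding V]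
  [RightClosedData V] {B : VBicatData.{w, v, u, u₁} V}
  {P : VPsfData (B.op.tensor B) (selfEnriched V)} {x y : V}

theorem unit_iff (i : ExtraToData P x) (b : B.Obj) :
    Iso.refl (iunit (ob P b b) ≫ ihm (ob P b b) (i.app b)) =
      icast (cwr (LUnit P b b) (ihm (ob P b b) (i.app b)) ⊚ cwl (B.u b) (i.cell b b) ⊚
        cwr (RUnit P b b).symm (ihm (ob P b b) (i.app b))) ↔
    PostUnit (LUnit P b b) (RUnit P b b) (i.cell b b) := by
  rw [PostUnit, Iso.ext_iff]
  simp [eq_comm]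

/-- The structure cells of `i.whisker k` are by definition the `postCell`s of those of `i`, so the
abstract whiskering lemmas apply without any conversion. -/
theorem isExtra_whisker [RightClosed V] {i : ExtraToData P x} (h : i.IsExtra) (k : x ⟶ y) :
    (i.whisker k).IsExtra where
  unit b := (unit_iff _ b).2 (((unit_iff i b).1 (h.unit b)).whisker _ _ _ k)
  functoriality a b c := (functoriality_iff _ a b c).2
    (((functoriality_iff i a b c).1 (h.functoriality a b c)).whisker _ _ _ _ _ _ k)

end ExtraToData

theorem ExtraTo.whiskerLaws {V : Type u} [Bicategory.{w, v} V] [Bicategory.Strict V] [GrayMonoid V]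
    [Braiding V] [RightClosedData V] [RightClosed V] {B : VBicatData.{w, v, u, u₁} V}
    (P : VPsfData (B.op.tensor B) (selfEnriched V)) : ExtraTo.WhiskerLaws P where
  isExtra i k := ExtraToData.isExtra_whisker i.isExtra k
  map k _ _ Γ a b := postCell_naturality _ _ _ _ (Γ.isMod a b) k
  map₂ θ i a b := postCell_whiskerLeft (i.cell a b) θ
  mapId i a b := postCell_id (i.cell a b)
  mapComp k l i a b := postCell_comp (i.cell a b) k l

/-! ### Transport of precomposition through an enriched composite. -/

section PreTensor

variable {V : Type u} [Bicategory.{w, v} V] [Bicategory.Strict V] [GrayMonoid V] [RightClosedData V]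

/-- Precomposing a composite with `p` amounts to precomposing its first factor. -/
def preTensor {X Y A A' M D : V} (g : X ⟶ iho M D) (h : Y ⟶ iho A' M) (p : A ⟶ A') :
    (g ⊠ᵣ Y ≫ iho M D ⊠ₗ h ≫ icomp A' M D) ≫ ipre p D ≅
      g ⊠ᵣ Y ≫ iho M D ⊠ₗ (h ≫ ipre p M) ≫ icomp A M D :=
  icast (cwl (g ⊠ᵣ Y ≫ iho M D ⊠ₗ h) (icompPre p M D)) (by simp) (by simp)

theorem preTensor_hom {X Y A A' M D : V} (g : X ⟶ iho M D) (h : Y ⟶ iho A' M) (p : A ⟶ A') :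
    (preTensor g h p).hom = eqToHom (by simp) ≫
      (g ⊠ᵣ Y) ◁ (iho M D ⊠ₗ h) ◁ (icompPre p M D).hom ≫ eqToHom (by simp) := by
  simp [preTensor]

theorem preTensor_inv {X Y A A' M D : V} (g : X ⟶ iho M D) (h : Y ⟶ iho A' M) (p : A ⟶ A') :
    (preTensor g h p).inv = eqToHom (by simp) ≫
      (g ⊠ᵣ Y) ◁ (iho M D ⊠ₗ h) ◁ (icompPre p M D).inv ≫ eqToHom (by simp) := by
  simp [preTensor]

theorem preTensor_naturality {X Y A A' M D : V} (g : X ⟶ iho M D) {h h' : Y ⟶ iho A' M}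
    (θ : h ⟶ h') (p : A ⟶ A') :
    ((g ⊠ᵣ Y) ◁ (iho M D ⊠ₗ₂ θ) ▷ icomp A' M D) ▷ ipre p D ≫ (preTensor g h' p).hom =
      (preTensor g h p).hom ≫ (g ⊠ᵣ Y) ◁ (iho M D ⊠ₗ₂ (θ ▷ ipre p M)) ▷ icomp A M D := by
  have h₁ := congrArg (fun t => (g ⊠ᵣ Y) ◁ t)
    (whisker_exchange (iho M D ⊠ₗ₂ θ) (icompPre p M D).hom).symm
  simp [eqToHom_comp_iff] at h₁
  simp [preTensor_hom, reassoc_of% h₁]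

/-- The transport of a cell along `preTensor`. -/
def preTensorCell {X Y A A' A'' M D : V} (g : X ⟶ iho M D) {h : Y ⟶ iho A' M} {h' : Y ⟶ iho A'' M}
    {p : A ⟶ A'} {p' : A ⟶ A''} (c : h ≫ ipre p M ≅ h' ≫ ipre p' M) :
    (g ⊠ᵣ Y ≫ iho M D ⊠ₗ h ≫ icomp A' M D) ≫ ipre p D ≅
      (g ⊠ᵣ Y ≫ iho M D ⊠ₗ h' ≫ icomp A'' M D) ≫ ipre p' D :=
  preTensor g h p ≪≫ whiskerLeftIso (g ⊠ᵣ Y) (whiskerRightIso (lI (iho M D) c) _) ≪≫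
    (preTensor g h' p').symm

theorem preTensorCell_hom {X Y A A' A'' M D : V} (g : X ⟶ iho M D) {h : Y ⟶ iho A' M}
    {h' : Y ⟶ iho A'' M} {p : A ⟶ A'} {p' : A ⟶ A''} (c : h ≫ ipre p M ≅ h' ≫ ipre p' M) :
    (preTensorCell g c).hom = (preTensor g h p).hom ≫
      (g ⊠ᵣ Y) ◁ (iho M D ⊠ₗ₂ c.hom) ▷ icomp A M D ≫ (preTensor g h' p').inv := by
  rw [preTensorCell]; rfl

/-- Precomposition with `k` of a cell between composites with `p` and `p'`. -/
def preCell {X A A' D x y : V} {l : X ⟶ iho A D} {r : X ⟶ iho A' D} {p : x ⟶ A} {p' : x ⟶ A'}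
    (c : l ≫ ipre p D ≅ r ≫ ipre p' D) (k : y ⟶ x) : l ≫ ipre (k ≫ p) D ≅ r ≫ ipre (k ≫ p') D :=
  whiskerLeftIso l (ipreComp k p D) ⊚ cwr c (ipre k D) ⊚ whiskerLeftIso r (ipreComp k p' D).symm

theorem preCell_hom {X A A' D x y : V} {l : X ⟶ iho A D} {r : X ⟶ iho A' D} {p : x ⟶ A}
    {p' : x ⟶ A'} (c : l ≫ ipre p D ≅ r ≫ ipre p' D) (k : y ⟶ x) :
    (preCell c k).hom = l ◁ (ipreComp k p D).hom ≫ eqToHom (by simp) ≫ c.hom ▷ ipre k D ≫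
      eqToHom (by simp) ≫ r ◁ (ipreComp k p' D).inv := by
  rw [preCell]
  simp

variable [RightClosed V]

/-- Immediate from `icompPre_comp`: precomposition acts on the factor that carries `h`, so no
interchanger occurs, in contrast with `postTensor_comp`. -/
theorem preTensor_comp {X Y A A' M D y : V} (g : X ⟶ iho M D) (h : Y ⟶ iho A' M) (p : A ⟶ A')
    (k : y ⟶ A) :
    (preTensor g h (k ≫ p)).hom =
      (g ⊠ᵣ Y ≫ iho M D ⊠ₗ h ≫ icomp A' M D) ◁ (ipreComp k p D).hom ≫ eqToHom (by simp) ≫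
      (preTensor g h p).hom ▷ ipre k D ≫ eqToHom (by simp) ≫
      (preTensor g (h ≫ ipre p M) k).hom ≫ eqToHom (by simp) ≫
      (g ⊠ᵣ Y) ◁ (iho M D ⊠ₗ₂ (h ◁ (ipreComp k p M).inv)) ▷ icomp y M D := by
  simp [preTensor_hom, icompPre_comp]

theorem preTensor_comp_inv {X Y A A' M D y : V} (g : X ⟶ iho M D) (h : Y ⟶ iho A' M) (p : A ⟶ A')
    (k : y ⟶ A) :
    (preTensor g h (k ≫ p)).inv =
      (g ⊠ᵣ Y) ◁ (iho M D ⊠ₗ₂ (h ◁ (ipreComp k p M).hom)) ▷ icomp y M D ≫ eqToHom (by simp) ≫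
      (preTensor g (h ≫ ipre p M) k).inv ≫ eqToHom (by simp) ≫
      (preTensor g h p).inv ▷ ipre k D ≫ eqToHom (by simp) ≫
      (g ⊠ᵣ Y ≫ iho M D ⊠ₗ h ≫ icomp A' M D) ◁ (ipreComp k p D).inv := by
  have e : (g ⊠ᵣ Y) ◁ (iho M D ⊠ₗ₂ (h ◁ (ipreComp k p M).inv)) ▷ icomp y M D ≫
      (g ⊠ᵣ Y) ◁ (iho M D ⊠ₗ₂ (h ◁ (ipreComp k p M).hom)) ▷ icomp y M D = 𝟙 _ := by
    rw [← Bicategory.whiskerLeft_comp, ← Bicategory.comp_whiskerRight, ← lmap₂_comp,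
      ← Bicategory.whiskerLeft_comp]; simp
  rw [← cancel_epi (preTensor g h (k ≫ p)).hom, Iso.hom_inv_id, preTensor_comp]
  simp only [Category.assoc]
  rw [reassoc_of% e]
  simp

theorem preTensorCell_whisker {X Y A A' A'' M D y : V} (g : X ⟶ iho M D) {h : Y ⟶ iho A' M}
    {h' : Y ⟶ iho A'' M} {p : A ⟶ A'} {p' : A ⟶ A''} (c : h ≫ ipre p M ≅ h' ≫ ipre p' M)
    (k : y ⟶ A) :
    (preTensorCell g (preCell c k)).hom =
      (g ⊠ᵣ Y ≫ iho M D ⊠ₗ h ≫ icomp A' M D) ◁ (ipreComp k p D).hom ≫ eqToHom (by simp) ≫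
      (preTensorCell g c).hom ▷ ipre k D ≫ eqToHom (by simp) ≫
      (g ⊠ᵣ Y ≫ iho M D ⊠ₗ h' ≫ icomp A'' M D) ◁ (ipreComp k p' D).inv := by
  have e {B : V} (q : A ⟶ B) (f : Y ⟶ iho B M) :
      (g ⊠ᵣ Y) ◁ (iho M D ⊠ₗ f) ◁ (iho M D ⊠ₗ₂ (ipreComp k q M).inv) ▷ icomp y M D ≫
      (g ⊠ᵣ Y) ◁ (iho M D ⊠ₗ f) ◁ (iho M D ⊠ₗ₂ (ipreComp k q M).hom) ▷ icomp y M D = 𝟙 _ := by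
    rw [← Bicategory.whiskerLeft_comp, ← Bicategory.whiskerLeft_comp,
      ← Bicategory.comp_whiskerRight, ← lmap₂_comp]; simp
  have h₁ := (preTensor_naturality g c.hom k).symm
  simp at h₁
  simp [preTensorCell_hom, preCell_hom, preTensor_comp, preTensor_comp_inv, reassoc_of% e,
    reassoc_of% h₁]

end PreTensor

/-! ### The functoriality axiom for transformations from an object. -/

section PreFunctoriality

variable {V : Type u} [Bicategory.{w, v} V] [Bicategory.Strict V] [GrayMonoid V] [RightClosedData V]
  {X Y Z M N O A' B' C' x y : V} {r₁ : X ⟶ iho N O} {r₂ : Y ⟶ iho C' N} {l₂ : Y ⟶ iho B' N}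
  {l₃ : Y ⟶ iho M O} {r₃ : X ⟶ iho B' M} {l₄ : X ⟶ iho A' M} {r : Z ⟶ iho C' O}
  {l : Z ⟶ iho A' O} {pa : x ⟶ A'} {pb : x ⟶ B'} {pc : x ⟶ C'}
  {b : X ⊠ Y ⟶ Y ⊠ X} {m : Y ⊠ X ⟶ Z}
  (rm : r₁ ⊠ᵣ Y ≫ iho N O ⊠ₗ r₂ ≫ icomp C' N O ≅ (b ≫ m) ≫ r)
  (lm : l₃ ⊠ᵣ X ≫ iho M O ⊠ₗ l₄ ≫ icomp A' M O ≅ m ≫ l)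
  (ex : r₁ ⊠ᵣ Y ≫ iho N O ⊠ₗ l₂ ≫ icomp B' N O ≅
    b ≫ l₃ ⊠ᵣ X ≫ iho M O ⊠ₗ r₃ ≫ icomp B' M O)
  (c₁ : r₂ ≫ ipre pc N ≅ l₂ ≫ ipre pb N) (c₃ : r₃ ≫ ipre pb M ≅ l₄ ≫ ipre pa M)
  (c : r ≫ ipre pc O ≅ l ≫ ipre pa O)

/-- The functoriality axiom of an extra-pseudonatural transformation from an object. -/
def PreFunctoriality : Prop :=
  rm.hom ▷ ipre pc O ≫ eqToHom (by simp) ≫ b ◁ m ◁ c.hom ≫ eqToHom (by simp) ≫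
    b ◁ lm.inv ▷ ipre pa O =
  (preTensorCell r₁ c₁).hom ≫ ex.hom ▷ ipre pb O ≫ eqToHom (by simp) ≫
    b ◁ (preTensorCell l₃ c₃).hom

/-- The exchange cell `ex` enters only as a 2-cell to be slid past, so its origin, with or without a
syllepsis, is immaterial. -/
theorem PreFunctoriality.whisker [RightClosed V] (H : PreFunctoriality rm lm ex c₁ c₃ c)
    (k : y ⟶ x) :
    PreFunctoriality rm lm ex (preCell c₁ k) (preCell c₃ k) (preCell c k) := by
  rw [PreFunctoriality] at H ⊢
  have h := congrArg (fun t => t ▷ ipre k O) H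
  have h₁ := (whisker_exchange rm.hom (ipreComp k pc O).hom).symm
  have h₂ := congrArg (fun t => b ◁ t) (whisker_exchange lm.inv (ipreComp k pa O).inv)
  have h₃ := whisker_exchange ex.hom (ipreComp k pb O).inv
  simp [eqToHom_comp_iff] at h h₁ h₂ h₃
  simp only [← Category.assoc, comp_eqToHom_iff] at h h₁ h₂ h₃
  simp only [Category.assoc, eqToHom_trans] at h h₁ h₂ h₃
  simp [preTensorCell_whisker, preCell_hom, reassoc_of% h, reassoc_of% h₁, h₂, reassoc_of% h₃]

end PreFunctoriality

/-! ### Morphisms and coherence cells under precomposition. -/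

section PreCell

variable {V : Type u} [Bicategory.{w, v} V] [Bicategory.Strict V] [GrayMonoid V] [RightClosedData V]
  [RightClosed V] {X A A' D x y z : V} {l : X ⟶ iho A D} {r : X ⟶ iho A' D} {p q : x ⟶ A}
  {p' q' : x ⟶ A'}

theorem preCell_naturality (c : l ≫ ipre p D ≅ r ≫ ipre p' D) (d : l ≫ ipre q D ≅ r ≫ ipre q' D)
    (γ : p ⟶ q) (γ' : p' ⟶ q') (h : c.hom ≫ r ◁ ipre₂ γ' D = l ◁ ipre₂ γ D ≫ d.hom) (k : y ⟶ x) :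
    (preCell c k).hom ≫ r ◁ ipre₂ (k ◁ γ') D = l ◁ ipre₂ (k ◁ γ) D ≫ (preCell d k).hom := by
  have e : (ipreComp k p' D).inv ≫ ipre₂ (k ◁ γ') D =
      ipre₂ γ' D ▷ ipre k D ≫ (ipreComp k q' D).inv := by
    rw [Iso.inv_comp_eq, ← Category.assoc, Iso.eq_comp_inv, ipreComp_naturality_right]
  have h := congrArg (fun t => t ▷ ipre k D) h
  have h₁ := congrArg (fun t => r ◁ t) e
  have h₂ := congrArg (fun t => l ◁ t) (ipreComp_naturality_right k γ D)
  simp at h h₁ h₂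
  simp only [← Category.assoc, comp_eqToHom_iff] at h
  simp only [Category.assoc] at h
  simp [preCell_hom, h₁, reassoc_of% h, reassoc_of% h₂]

theorem preCell_whiskerRight (c : l ≫ ipre p D ≅ r ≫ ipre p' D) {k k' : y ⟶ x} (θ : k ⟶ k') :
    (preCell c k).hom ≫ r ◁ ipre₂ (θ ▷ p') D = l ◁ ipre₂ (θ ▷ p) D ≫ (preCell c k').hom := by
  have e : (ipreComp k p' D).inv ≫ ipre₂ (θ ▷ p') D =
      ipre p' D ◁ ipre₂ θ D ≫ (ipreComp k' p' D).inv := by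
    rw [Iso.inv_comp_eq, ← Category.assoc, Iso.eq_comp_inv, ipreComp_naturality_left]
  have h := whisker_exchange c.hom (ipre₂ θ D)
  have h₁ := congrArg (fun t => r ◁ t) e
  have h₂ := congrArg (fun t => l ◁ t) (ipreComp_naturality_left θ p D)
  simp [eqToHom_comp_iff] at h h₁ h₂
  simp [preCell_hom, h₁, reassoc_of% h, reassoc_of% h₂]

theorem preCell_id (c : l ≫ ipre p D ≅ r ≫ ipre p' D) :
    (preCell c (𝟙 x)).hom ≫ r ◁ ipre₂ (λ_ p').hom D = l ◁ ipre₂ (λ_ p).hom D ≫ c.hom := by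
  -- The proved unit law `ipreComp_id_left`, solved for the comparison cell; it replaces the
  -- pseudofunctor axiom used for `[A, -]`.
  have e {B : V} (q : x ⟶ B) : (ipreComp (𝟙 x) q D).hom =
      eqToHom (by simp) ≫ ipre q D ◁ (ipreId x D).inv := by
    rw [← cancel_mono (ipre q D ◁ (ipreId x D).hom), ipreComp_id_left]
    simp
  have e' {B : V} (q : x ⟶ B) : (ipreComp (𝟙 x) q D).inv =
      ipre q D ◁ (ipreId x D).hom ≫ eqToHom (by simp) := by
    rw [← cancel_epi (ipreComp (𝟙 x) q D).hom, Iso.hom_inv_id, e]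
    simp
  have h := whisker_exchange c.hom (ipreId x D).inv
  simp [eqToHom_comp_iff] at h
  simp [preCell_hom, e, e', reassoc_of% h]

theorem preCell_comp (c : l ≫ ipre p D ≅ r ≫ ipre p' D) (k : y ⟶ x) (k' : z ⟶ y) :
    (preCell c (k' ≫ k)).hom ≫ r ◁ ipre₂ (α_ k' k p').hom D =
      l ◁ ipre₂ (α_ k' k p).hom D ≫ (preCell (preCell c k) k').hom := by
  -- `ipreComp_assoc` read backwards, since contravariance reverses the bracketing needed here.
  have a {B : V} (q : x ⟶ B) : (ipreComp k' (k ≫ q) D).hom ≫ (ipreComp k q D).hom ▷ ipre k' D =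
      eqToHom (by simp) ≫ (ipreComp (k' ≫ k) q D).hom ≫ ipre q D ◁ (ipreComp k' k D).hom ≫
      eqToHom (by simp) := by
    rw [reassoc_of% ipreComp_assoc k' k q D]
    simp
  have e : (ipreComp k p' D).inv ▷ ipre k' D ≫ (ipreComp k' (k ≫ p') D).inv = eqToHom (by simp) ≫
      ipre p' D ◁ (ipreComp k' k D).inv ≫ (ipreComp (k' ≫ k) p' D).inv ≫ eqToHom (by simp) := by
    rw [← cancel_epi ((ipreComp k' (k ≫ p') D).hom ≫ (ipreComp k p' D).hom ▷ ipre k' D)]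
    nth_rw 2 [a]
    simp
  have h₁ := congrArg (fun t => l ◁ t) (a p)
  have h₂ := congrArg (fun t => r ◁ t) e
  have h₃ := whisker_exchange c.hom (ipreComp k' k D).hom
  simp [eqToHom_comp_iff] at h₁ h₂ h₃
  simp only [← Category.assoc, comp_eqToHom_iff] at h₃
  simp only [Category.assoc, eqToHom_trans] at h₃
  simp [preCell_hom, reassoc_of% h₁, h₂, reassoc_of% h₃]

end PreCell

/-! ### The unit axiom for transformations from an object, and the resulting laws. -/

section PreUnit

variable {V : Type u} [Bicategory.{w, v} V] [Bicategory.Strict V] [GrayMonoid V] [RightClosedData V]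
  {X Y A D x y : V} {j : X ⟶ iho A D} {u : X ⟶ Y} {l r : Y ⟶ iho A D} {p : x ⟶ A}
  (lu : j ≅ u ≫ l) (ru : j ≅ u ≫ r) (c : l ≫ ipre p D ≅ r ≫ ipre p D)

/-- The unit axiom of an extra-pseudonatural transformation from an object. -/
def PreUnit : Prop :=
  lu.hom ▷ ipre p D ≫ eqToHom (by simp) ≫ u ◁ c.hom ≫ eqToHom (by simp) ≫ ru.inv ▷ ipre p D =
    eqToHom rfl

theorem PreUnit.whisker (H : PreUnit lu ru c) (k : y ⟶ x) : PreUnit lu ru (preCell c k) := by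
  rw [PreUnit] at H ⊢
  have h := congrArg (fun t => t ▷ ipre k D) H
  have h₁ := (whisker_exchange lu.hom (ipreComp k p D).hom).symm
  have h₂ := whisker_exchange ru.inv (ipreComp k p D).inv
  simp [eqToHom_comp_iff] at h h₁ h₂
  simp only [← Category.assoc, comp_eqToHom_iff] at h h₁ h₂
  simp only [Category.assoc, eqToHom_trans] at h h₁ h₂
  simp [preCell_hom, reassoc_of% h, reassoc_of% h₁, h₂]

end PreUnit

namespace ExtraFromData

variable {V : Type u} [Bicategory.{w, v} V] [Bicategory.Strict V] [GrayMonoid V] [Braiding V]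
  [RightClosedData V] {B : VBicatData.{w, v, u, u₁} V} {P : Partials B} {x y : V}

theorem unit_iff (i : ExtraFromData x P) (b : B.Obj) :
    Iso.refl (iunit (ob P b b) ≫ ipre (i.app b) (ob P b b)) =
      icast (cwr (RUnit P b b) (ipre (i.app b) (ob P b b)) ⊚ cwl (B.u b) (i.cell b b) ⊚
        cwr (LUnit P b b).symm (ipre (i.app b) (ob P b b))) ↔
    PreUnit (RUnit P b b) (LUnit P b b) (i.cell b b) := by
  rw [PreUnit, Iso.ext_iff]
  simp [eq_comm]

theorem functoriality_iff (i : ExtraFromData x P) (a b c : B.Obj) :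
    Iso.refl (R P a b c ⊠ᵣ B.Hom b c ≫ iho (ob P c b) (ob P c a) ⊠ₗ R P b c c ≫
        icomp (ob P c c) (ob P c b) (ob P c a) ≫ ipre (i.app c) (ob P c a)) ⊚
      cwr (RMult P a b c c) (ipre (i.app c) (ob P c a)) ⊚
      cwl (β (B.Hom a b) (B.Hom b c) ≫ B.m a b c) (i.cell a c) ⊚
      cw (β (B.Hom a b) (B.Hom b c)) (LMult P a b c a).symm (ipre (i.app a) (ob P c a)) =
    icast (
      Iso.refl (R P a b c ⊠ᵣ B.Hom b c ≫ iho (ob P c b) (ob P c a) ⊠ₗ R P b c c ≫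
        icomp (ob P c c) (ob P c b) (ob P c a) ≫ ipre (i.app c) (ob P c a)) ⊚
      cwl (R P a b c ⊠ᵣ B.Hom b c ≫ₑ iho (ob P c b) (ob P c a) ⊠ₗ R P b c c)
        (icompPre (i.app c) (ob P c b) (ob P c a)) ⊚
      cw (R P a b c ⊠ᵣ B.Hom b c) (lI (iho (ob P c b) (ob P c a)) (i.cell b c))
        (icomp x (ob P c b) (ob P c a)) ⊚
      cwl (R P a b c ⊠ᵣ B.Hom b c ≫ₑ iho (ob P c b) (ob P c a) ⊠ₗ L P b c b)
        (icompPre (i.app b) (ob P c b) (ob P c a)).symm ⊚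
      cwr (Exch P a b b c) (ipre (i.app b) (ob P c a)) ⊚
      cwl (β (B.Hom a b) (B.Hom b c) ≫ₑ L P b c a ⊠ᵣ B.Hom a b ≫ₑ
          iho (ob P b a) (ob P c a) ⊠ₗ R P a b b)
        (icompPre (i.app b) (ob P b a) (ob P c a)) ⊚
      cw (β (B.Hom a b) (B.Hom b c) ≫ₑ L P b c a ⊠ᵣ B.Hom a b)
        (lI (iho (ob P b a) (ob P c a)) (i.cell a b)) (icomp x (ob P b a) (ob P c a)) ⊚
      cwl (β (B.Hom a b) (B.Hom b c) ≫ₑ L P b c a ⊠ᵣ B.Hom a b ≫ₑ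
          iho (ob P b a) (ob P c a) ⊠ₗ L P a b a)
        (icompPre (i.app a) (ob P b a) (ob P c a)).symm) ↔
    PreFunctoriality (RMult P a b c c) (LMult P a b c a) (Exch P a b b c) (i.cell b c)
      (i.cell a b) (i.cell a c) := by
  rw [PreFunctoriality, Iso.ext_iff]
  simp [preTensorCell_hom, preTensor_hom, preTensor_inv, ccomp_whiskerLeft, eqToHom_comp_iff]
  simp only [← Category.assoc, comp_eqToHom_iff]
  simp only [Category.assoc, eqToHom_trans]

theorem isExtra_whisker [RightClosed V] {i : ExtraFromData x P} (h : i.IsExtra) (k : y ⟶ x) :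
    (i.whisker k).IsExtra where
  unit b := (unit_iff _ b).2 (((unit_iff i b).1 (h.unit b)).whisker _ _ _ k)
  functoriality a b c := (functoriality_iff _ a b c).2
    (((functoriality_iff i a b c).1 (h.functoriality a b c)).whisker _ _ _ _ _ _ k)

end ExtraFromData

theorem ExtraFrom.whiskerLaws {V : Type u} [Bicategory.{w, v} V] [Bicategory.Strict V]
    [GrayMonoid V] [Braiding V] [RightClosedData V] [RightClosed V]
    {B : VBicatData.{w, v, u, u₁} V} (P : Partials B) : ExtraFrom.WhiskerLaws P where
  isExtra i k := ExtraFromData.isExtra_whisker i.isExtra k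
  map k _ _ Γ a b := preCell_naturality _ _ _ _ (Γ.isMod a b) k
  map₂ θ i a b := preCell_whiskerRight (i.cell a b) θ
  mapId i a b := preCell_id (i.cell a b)
  mapComp l k i a b := preCell_comp (i.cell a b) k l

/-! ### Universal properties and representability. -/

section Representability

variable {V : Type u} [Bicategory.{w, v} V]

/-- An isomorphism of `V(c, x)` from an invertible 2-cell. -/
def homToIsoMk {c x : V} {f g : HomTo.{w, v, u, u₃} c x} (θ : f.hom ≅ g.hom) : f ≅ g where
  hom := ⟨θ.hom⟩
  inv := ⟨θ.inv⟩
  hom_inv_id := HomTo.hom_ext θ.hom_inv_id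
  inv_hom_id := HomTo.hom_ext θ.inv_hom_id

variable [Bicategory.Strict V] [GrayMonoid V] [Braiding V] [RightClosedData V]
  {B : VBicatData.{w, v, u, u₁} V}

namespace ExtraTo

variable {P : VPsfData (B.op.tensor B) (selfEnriched V)} (h : ExtraTo.WhiskerLaws P) {c : V}

/-- The components of an isomorphism of extra-pseudonatural transformations are invertible. -/
def appIso {x : V} {i j : ExtraTo P x} (e : i ≅ j) (b : B.Obj) : i.app b ≅ j.app b where
  hom := Hom.app e.hom b
  inv := Hom.app e.inv b
  hom_inv_id := by rw [← comp_app, e.hom_inv_id, id_app]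
  inv_hom_id := by rw [← comp_app, e.inv_hom_id, id_app]

/-- (BC1) is essential surjectivity of `precompFunctor`, existence in (BC2) is fullness and
uniqueness is faithfulness. The two ways of stating an isomorphism of transformations agree because
the inverse of an invertible morphism is again a morphism. -/
theorem isBicoend_iff (i : ExtraTo P c) :
    IsBicoend i ↔ ∀ x : V, (precompFunctor h i x).IsEquivalence := by
  constructor
  · intro hi x
    refine { faithful := ⟨fun {k l γ δ} e => ?_⟩, full := ⟨fun {k l} Γ => ?_⟩,
             essSurj := ⟨fun j => ?_⟩ }
    -- Uniqueness in (BC2) is applied to the family induced by `γ`, which is a morphism by `h.map₂`;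
    -- both `γ` and `δ` induce it.
    · refine HomTo.hom_ext ((hi.existsUnique_cell k.hom l.hom _
        (h.map₂ (HomTo.Cell.cell γ) i)).unique (fun _ => rfl) fun b => ?_)
      exact congrArg (fun Γ => Hom.app Γ b) e
    · obtain ⟨γ, hγ, -⟩ := hi.existsUnique_cell k.hom l.hom (Hom.app Γ) Γ.isMod
      exact ⟨⟨γ⟩, hom_ext fun b => (hγ b).symm⟩
    · obtain ⟨k, J, hJ⟩ := hi.exists_factor j
      exact ⟨⟨k⟩, ⟨isoMk J hJ⟩⟩
  · intro hi
    refine ⟨fun {x} j => ?_, fun {x} k l Γ hΓ => ?_⟩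
    · have := hi x
      let e := (precompFunctor h i x).objObjPreimageIso j
      exact ⟨((precompFunctor h i x).objPreimage j).hom, appIso e, e.hom.isMod⟩
    · have := hi x
      let k' : HomTo.{w, v, u, max u₁ w} c x := ⟨k⟩
      let l' : HomTo.{w, v, u, max u₁ w} c x := ⟨l⟩
      let Γ' : (precompFunctor h i x).obj k' ⟶ (precompFunctor h i x).obj l' := ⟨Γ, hΓ⟩
      obtain ⟨γ, hγ⟩ := (precompFunctor h i x).map_surjective Γ'
      refine ⟨γ.cell, fun b => congrArg (fun Θ => Hom.app Θ b) hγ.symm, fun δ hδ => ?_⟩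
      have : (⟨δ⟩ : k' ⟶ l') = γ := (precompFunctor h i x).map_injective
        ((hom_ext fun b => (hδ b).symm : (precompFunctor h i x).map ⟨δ⟩ = Γ').trans hγ.symm)
      exact congrArg HomTo.Cell.cell this

variable {h}

/-- The bicategorical Yoneda lemma: `Φ : V(c, -) ⇒ V-PsNat^e(P, -)` is isomorphic to
precomposition with `Φ_c(𝟙 c)`. -/
def ofRepIso (Φ : Pseudofunctor.StrongTrans (repTo.{w, v, u, max u₁ w} c) (pseudofunctor h))
    (x : V) : precompFunctor h (ofRep Φ) x ≅ (Φ.app x).toFunctor :=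
  letI F : HomTo.{w, v, u, max u₁ w} c x ⥤ ExtraTo P x := (Φ.app x).toFunctor
  -- By definition `precompFunctor` at `k` is `post h k` applied to `Φ_c(𝟙 c)`, so the inverse
  -- pseudonaturality cell of `Φ` at `k`, evaluated at `𝟙 c`, has the required source.
  letI N (k : HomTo.{w, v, u, max u₁ w} c x) :
      (precompFunctor h (ofRep Φ) x).obj k ≅ F.obj ⟨𝟙 c ≫ k.hom⟩ :=
    (Cat.Hom.toNatIso (Φ.naturality k.hom)).symm.app (show HomTo.{w, v, u, max u₁ w} c c from ⟨𝟙 c⟩)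
  NatIso.ofComponents (F := precompFunctor h (ofRep Φ) x) (G := F)
    (fun k => N k ≪≫ F.mapIso (homToIsoMk (λ_ k.hom))) (by
      intro k l γ
      -- Naturality of the isomorphism in `k` comes from compatibility of `Φ` with 2-cells,
      -- evaluated at `𝟙 c`, together with naturality of the left unitor.
      have nat : F.map (⟨𝟙 c ◁ γ.cell⟩ : (⟨𝟙 c ≫ k.hom⟩ : HomTo.{w, v, u, max u₁ w} c x) ⟶
            ⟨𝟙 c ≫ l.hom⟩) ≫ (N l).inv =
          (N k).inv ≫ (precompFunctor h (ofRep Φ) x).map γ :=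
        congrArg (fun t => Cat.Hom₂.toNatTrans t |>.app
          (show HomTo.{w, v, u, max u₁ w} c c from ⟨𝟙 c⟩)) (Φ.naturality_naturality γ.cell)
      have unit : (⟨𝟙 c ◁ γ.cell⟩ : (⟨𝟙 c ≫ k.hom⟩ : HomTo.{w, v, u, max u₁ w} c x) ⟶
            ⟨𝟙 c ≫ l.hom⟩) ≫ (homToIsoMk (λ_ l.hom)).hom = (homToIsoMk (λ_ k.hom)).hom ≫ γ :=
        HomTo.hom_ext (leftUnitor_naturality γ.cell)
      simp only [Iso.trans_hom, Functor.mapIso_hom, Category.assoc]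
      rw [← F.map_comp, ← unit, F.map_comp, ← Iso.inv_comp_eq, ← reassoc_of% nat,
        Iso.inv_hom_id_assoc])

theorem isBicoend_ofRep
    (Φ : Pseudofunctor.StrongTrans (repTo.{w, v, u, max u₁ w} c) (pseudofunctor h))
    (hΦ : ∀ x : V, (Φ.app x).toFunctor.IsEquivalence) : IsBicoend (ofRep Φ) :=
  (isBicoend_iff h _).2 fun x =>
    @Functor.isEquivalence_of_iso _ _ _ _ _ _ (ofRepIso Φ x).symm (hΦ x)

end ExtraTo

namespace ExtraFrom

variable {P : Partials B} (h : ExtraFrom.WhiskerLaws P) {e : V}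

/-- The components of an isomorphism of extra-pseudonatural transformations are invertible. -/
def appIso {x : V} {i j : ExtraFrom x P} (t : i ≅ j) (b : B.Obj) : i.app b ≅ j.app b where
  hom := Hom.app t.hom b
  inv := Hom.app t.inv b
  hom_inv_id := by rw [← comp_app, t.hom_inv_id, id_app]
  inv_hom_id := by rw [← comp_app, t.inv_hom_id, id_app]

/-- The same dictionary as for bicoends, with existence of factorisations giving essential
surjectivity and unique 2-cells giving full faithfulness. -/
theorem isBiend_iff (i : ExtraFrom e P) :
    IsBiend i ↔ ∀ x : V, (postcompFunctor h i x).IsEquivalence := by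
  constructor
  · intro hi x
    refine { faithful := ⟨fun {k l γ δ} t => ?_⟩, full := ⟨fun {k l} Γ => ?_⟩,
             essSurj := ⟨fun j => ?_⟩ }
    · refine HomTo.hom_ext ((hi.existsUnique_cell k.hom l.hom _
        (h.map₂ (HomTo.Cell.cell γ) i)).unique (fun _ => rfl) fun b => ?_)
      exact congrArg (fun Γ => Hom.app Γ b) t
    · obtain ⟨γ, hγ, -⟩ := hi.existsUnique_cell k.hom l.hom (Hom.app Γ) Γ.isMod
      exact ⟨⟨γ⟩, hom_ext fun b => (hγ b).symm⟩
    · obtain ⟨k, J, hJ⟩ := hi.exists_factor j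
      exact ⟨⟨k⟩, ⟨isoMk J hJ⟩⟩
  · intro hi
    refine ⟨fun {x} j => ?_, fun {x} k l Γ hΓ => ?_⟩
    · have := hi x
      let t := (postcompFunctor h i x).objObjPreimageIso j
      exact ⟨((postcompFunctor h i x).objPreimage j).hom, appIso t, t.hom.isMod⟩
    · have := hi x
      let k' : HomTo.{w, v, u, max u₁ w} x e := ⟨k⟩
      let l' : HomTo.{w, v, u, max u₁ w} x e := ⟨l⟩
      let Γ' : (postcompFunctor h i x).obj k' ⟶ (postcompFunctor h i x).obj l' := ⟨Γ, hΓ⟩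
      obtain ⟨γ, hγ⟩ := (postcompFunctor h i x).map_surjective Γ'
      refine ⟨γ.cell, fun b => congrArg (fun Θ => Hom.app Θ b) hγ.symm, fun δ hδ => ?_⟩
      have : (⟨δ⟩ : k' ⟶ l') = γ := (postcompFunctor h i x).map_injective
        ((hom_ext fun b => (hδ b).symm : (postcompFunctor h i x).map ⟨δ⟩ = Γ').trans hγ.symm)
      exact congrArg HomTo.Cell.cell this

variable {h}

/-- The bicategorical Yoneda lemma: `Φ : V(-, e) ⇒ V-PsNat^e(-, P)` is isomorphic to
composition with `Φ_e(𝟙 e)`. -/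
def ofRepIso (Φ : Pseudofunctor.StrongTrans (repFrom.{w, v, u, max u₁ w} e) (pseudofunctor h))
    (x : V) : postcompFunctor h (ofRep Φ) x ≅ (Φ.app (op x)).toFunctor :=
  letI F : HomTo.{w, v, u, max u₁ w} x e ⥤ ExtraFrom x P := (Φ.app (op x)).toFunctor
  -- The 1-cell is taken in the opposite bicategory, and the identity now appears on the right;
  -- hence the right unitor in the next step.
  letI N (k : HomTo.{w, v, u, max u₁ w} x e) :
      (postcompFunctor h (ofRep Φ) x).obj k ≅ F.obj ⟨k.hom ≫ 𝟙 e⟩ :=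
    (Cat.Hom.toNatIso (Φ.naturality k.hom.op)).symm.app (show HomTo.{w, v, u, max u₁ w} e e from ⟨𝟙 e⟩)
  NatIso.ofComponents (F := postcompFunctor h (ofRep Φ) x) (G := F)
    (fun k => N k ≪≫ F.mapIso (homToIsoMk (ρ_ k.hom))) (by
      intro k l γ
      have nat : F.map (⟨γ.cell ▷ 𝟙 e⟩ : (⟨k.hom ≫ 𝟙 e⟩ : HomTo.{w, v, u, max u₁ w} x e) ⟶
            ⟨l.hom ≫ 𝟙 e⟩) ≫ (N l).inv =
          (N k).inv ≫ (postcompFunctor h (ofRep Φ) x).map γ :=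
        congrArg (fun t => Cat.Hom₂.toNatTrans t |>.app
          (show HomTo.{w, v, u, max u₁ w} e e from ⟨𝟙 e⟩)) (Φ.naturality_naturality (op2 γ.cell))
      have unit : (⟨γ.cell ▷ 𝟙 e⟩ : (⟨k.hom ≫ 𝟙 e⟩ : HomTo.{w, v, u, max u₁ w} x e) ⟶
            ⟨l.hom ≫ 𝟙 e⟩) ≫ (homToIsoMk (ρ_ l.hom)).hom = (homToIsoMk (ρ_ k.hom)).hom ≫ γ :=
        HomTo.hom_ext (rightUnitor_naturality γ.cell)
      simp only [Iso.trans_hom, Functor.mapIso_hom, Category.assoc]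
      rw [← F.map_comp, ← unit, F.map_comp, ← Iso.inv_comp_eq, ← reassoc_of% nat,
        Iso.inv_hom_id_assoc])

theorem isBiend_ofRep
    (Φ : Pseudofunctor.StrongTrans (repFrom.{w, v, u, max u₁ w} e) (pseudofunctor h))
    (hΦ : ∀ x : V, (Φ.app (op x)).toFunctor.IsEquivalence) : IsBiend (ofRep Φ) :=
  (isBiend_iff h _).2 fun x =>
    @Functor.isEquivalence_of_iso _ _ _ _ _ _ (ofRepIso Φ x).symm (hΦ x)

end ExtraFrom

end Representability

end

theorem mainTheorem4 {V : Type u} [Bicategory.{w, v} V] [Bicategory.Strict V] [GrayMonoid V]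
    [Braiding V] [RightClosedData V] [RightClosed V] (B : VBicatData.{w, v, u, u₁} V)
    (hB : B.Lawful) :
    (∀ P : VPsfData (B.op.tensor B) (selfEnriched V), P.Lawful →
      ∃ h : ExtraTo.WhiskerLaws P,
        (∀ (c : V) (i : ExtraTo P c), IsBicoend i →
          ∀ x : V, ((ExtraTo.precomp h i).app x).toFunctor.IsEquivalence) ∧
        (∀ (c : V) (i : ExtraTo P c),
          (∀ x : V, ((ExtraTo.precomp h i).app x).toFunctor.IsEquivalence) → IsBicoend i) ∧
        (∀ (c : V) (Φ : Pseudofunctor.StrongTrans (repTo.{w, v, u, max u₁ w} c)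
            (ExtraTo.pseudofunctor h)),
          (∀ x : V, (Φ.app x).toFunctor.IsEquivalence) →
            IsBicoend (ExtraTo.ofRep Φ))) ∧
    (∀ P : VPsfData (B.tensor B.op) (selfEnriched V), P.Lawful →
      ∃ h : ExtraFrom.WhiskerLaws P.partials,
        (∀ (e : V) (i : ExtraFrom e P.partials), IsBiend i →
          ∀ x : V, ((ExtraFrom.postcomp h i).app (op x)).toFunctor.IsEquivalence) ∧
        (∀ (e : V) (i : ExtraFrom e P.partials),
          (∀ x : V, ((ExtraFrom.postcomp h i).app (op x)).toFunctor.IsEquivalence) → IsBiend i) ∧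
        (∀ (e : V) (Φ : Pseudofunctor.StrongTrans (repFrom.{w, v, u, max u₁ w} e)
            (ExtraFrom.pseudofunctor h)),
          (∀ x : V, (Φ.app (op x)).toFunctor.IsEquivalence) → IsBiend (ExtraFrom.ofRep Φ))) ∧
    (∀ [Syllepsis V] (P : VPsfData (B.op.tensor B) (selfEnriched V)), P.Lawful →
      ∃ h : ExtraFrom.WhiskerLaws P.partialsOp,
        (∀ (e : V) (i : ExtraFrom e P.partialsOp), IsBiend i →
          ∀ x : V, ((ExtraFrom.postcomp h i).app (op x)).toFunctor.IsEquivalence) ∧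
        (∀ (e : V) (i : ExtraFrom e P.partialsOp),
          (∀ x : V, ((ExtraFrom.postcomp h i).app (op x)).toFunctor.IsEquivalence) → IsBiend i) ∧
        (∀ (e : V) (Φ : Pseudofunctor.StrongTrans (repFrom.{w, v, u, max u₁ w} e)
            (ExtraFrom.pseudofunctor h)),
          (∀ x : V, (Φ.app (op x)).toFunctor.IsEquivalence) → IsBiend (ExtraFrom.ofRep Φ))) := by
  -- Both variants of biends are instances of a single statement about `Partials`. The functors
  -- underlying `precomp` and `postcomp` are `precompFunctor` and `postcompFunctor` by definition,
  -- so the characterisations apply as they stand.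
  have hto (P : VPsfData (B.op.tensor B) (selfEnriched V)) := ExtraTo.whiskerLaws P
  have hfrom (P : Partials B) := ExtraFrom.whiskerLaws P
  exact ⟨fun P _ => ⟨hto P, fun _ i => (ExtraTo.isBicoend_iff (hto P) i).1,
      fun _ i => (ExtraTo.isBicoend_iff (hto P) i).2, fun _ => ExtraTo.isBicoend_ofRep⟩,
    fun P _ => ⟨hfrom P.partials, fun _ i => (ExtraFrom.isBiend_iff (hfrom P.partials) i).1,
      fun _ i => (ExtraFrom.isBiend_iff (hfrom P.partials) i).2,
      fun _ => ExtraFrom.isBiend_ofRep⟩,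
    fun P _ => ⟨hfrom P.partialsOp, fun _ i => (ExtraFrom.isBiend_iff (hfrom P.partialsOp) i).1,
      fun _ i => (ExtraFrom.isBiend_iff (hfrom P.partialsOp) i).2,
      fun _ => ExtraFrom.isBiend_ofRep⟩⟩
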